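/- Let $\alpha_{12},\alpha_{13},\alpha_{23}>0$ and consider on the flag manifold $\mathcal F(3)=\mathrm U(3)/\mathrm U(1)^3$ the invariant metric $\mathrm ds^2=\sum_{i<j}\frac1{\alpha_{ij}}|\bar u_i\cdot \mathrm du_j|^2$, where a point is represented by a unitary matrix $\mathsf U=(u_1\,u_2\,u_3)$. Consider the reduced Euler equations for $a,b,c:\mathbb R\to\mathbb C$, $$i\dot a=(\alpha_{23}-\alpha_{13})\,b\bar c,\qquad i\dot b=(\alpha_{23}-\alpha_{12})\,ac,\qquad i\dot c=(\alpha_{13}-\alpha_{12})\,\bar a b ,$$ and put $\mathcal L=\begin{pmatrix}0&a&b\\ \bar a&0&c\\ \bar b&\bar c&0\end{pmatrix}$, $[\mathfrak I(\mathcal L)]_{ij}=\alpha_{ij}\mathcal L_{ij}$, with $\alpha_{ij}=\alpha_{ji}$ and $\alpha_{ii}=0$. **(1) Solution of the Euler equations.** Assume that $\alpha_{12}>\alpha_{23}>\alpha_{13}$; for arbitrary pairwise distinct $\alpha_{ij}$ the statement holds after any permutation of the indices $1,2,3$ (applied simultaneously to $\alpha_{ij}$ and to the entries of $\mathcal L$,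 where $a=\mathcal L_{12}$, $b=\mathcal L_{13}$, $c=\mathcal L_{23}$) which produces this order. For initial data $a_0,b_0,c_0\in\mathbb C$ at $t=0$ let $$\mathrm I_2=|c_0|^2+\tfrac{\alpha_{12}-\alpha_{13}}{\alpha_{23}-\alpha_{13}}|a_0|^2,\quad \mathrm I_3=|c_0|^2+\tfrac{\alpha_{12}-\alpha_{13}}{\alpha_{12}-\alpha_{23}}|b_0|^2,\quad \mathsf h_4=\bar a_0b_0\bar c_0+a_0\bar b_0c_0,\quad \mathrm I_4=-\tfrac{(\alpha_{12}-\alpha_{13})^2}{(\alpha_{12}-\alpha_{23})(\alpha_{23}-\alpha_{13})}\mathsf h_4^2,$$ $$g_2=\tfrac43(\mathrm I_2^2-\mathrm I_2\mathrm I_3+\mathrm I_3^2),\quad g_3=-\mathrm I_4+\tfrac4{27}(\mathrm I_2+\mathrm I_3)(2\mathrm I_2^2-5\mathrm I_2\mathrm I_3+2\mathrm I_3^2),\quad \tau=\sqrt{(\alpha_{12}-\alpha_{23})(\alpha_{23}-\alpha_{13})}\;t .$$ Assume $g_2^3-27g_3^2\ne0$. Then $4\mathrm Y^3-g_2\mathrm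 Y-g_3$ has three real roots $e_1>e_2>e_3$, and with $$\omega_1=\int_{e_1}^\infty\frac{\mathrm d\mathrm Y}{\sqrt{4\mathrm Y^3-g_2\mathrm Y-g_3}},\qquad \omega_2=i\int_{-e_3}^\infty\frac{\mathrm d\mathrm Y}{\sqrt{4\mathrm Y^3-g_2\mathrm Y+g_3}}$$ the lattice $2\omega_1\mathbb Z+2\omega_2\mathbb Z$ has invariants $g_2,g_3$; let $\wp,\zeta,\sigma$ be its Weierstrass functions. There is $\tau_0\in\mathbb R$ such that $\wp(-\tau_0+\omega_2)+\frac13(\mathrm I_2+\mathrm I_3)$ and $\wp'(-\tau_0+\omega_2)$ are the values of $|c|^2$ and $\frac{\mathrm d}{\mathrm d\tau}|c|^2$ at $\tau=0$ prescribed by the initial data and the equations, and every real number is a value of $\wp$. For every such $\tau_0$, every solution with these initial data satisfies $$|c|^2=\wp(\tau-\tau_0+\omega_2)+\tfrac13(\mathrm I_2+\mathrm I_3).$$ If moreover $\mathsf h_4\ne0$, then for all $\mu_1,\mu_2,\mu_3$ with $\wp(\mu_1)=\frac23\mathrm I_2-\frac13\mathrm I_3$, $\wp(\mu_2)=-\frac13\mathrm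 I_2+\frac23\mathrm I_3$, $\wp(\mu_3)=-\frac13\mathrm I_2-\frac13\mathrm I_3$, functions $a,b,c$ solve the Euler equations on $\mathbb R$ with $a(0)=a_0$, $b(0)=b_0$, $c(0)=c_0$ if and only if for all $t$ $$a=\mathcal A_+y_+(\tau|\mu_1)+\mathcal A_-y_-(\tau|\mu_1),\quad b=\mathcal B_+y_+(\tau|\mu_2)+\mathcal B_-y_-(\tau|\mu_2),\quad c=\mathcal C_+y_+(\tau|\mu_3)+\mathcal C_-y_-(\tau|\mu_3),$$ where $$y_\pm(\tau|\mu)=e^{\mp\tau\zeta(\mu)}\frac{\sigma(\tau-\tau_0+\omega_2\pm\mu)\,\sigma(-\tau_0+\omega_2)}{\sigma(\tau-\tau_0+\omega_2)\,\sigma(-\tau_0+\omega_2\pm\mu)},$$ $$\mathcal A_\pm=\tfrac12\mathrm M_\pm(\mu_1)a_0\pm i\,\mathrm N(\mu_1)\sqrt{\tfrac{\alpha_{23}-\alpha_{13}}{\alpha_{12}-\alpha_{23}}}\,b_0\bar c_0,\qquad \mathcal B_\pm=\tfrac12\mathrm M_\pm(\mu_2)b_0\mp i\,\mathrm N(\mu_2)\sqrt{\tfrac{\alpha_{12}-\alpha_{23}}{\alpha_{23}-\alpha_{13}}}\,a_0c_0,$$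 $$\mathcal C_\pm=\tfrac12\mathrm M_\pm(\mu_3)c_0\mp i\,\mathrm N(\mu_3)\frac{\alpha_{12}-\alpha_{13}}{\sqrt{(\alpha_{12}-\alpha_{23})(\alpha_{23}-\alpha_{13})}}\,\bar a_0b_0,$$ $$\mathrm M_\pm(\mu)=1\pm\frac{\wp'(-\tau_0+\omega_2)}{\wp'(\mu)},\qquad \mathrm N(\mu)=\frac{\wp(-\tau_0+\omega_2)-\wp(\mu)}{\wp'(\mu)} .$$ **(2) The geodesics.** Let $\alpha_{12},\alpha_{13},\alpha_{23}>0$ be arbitrary, let $a,b,c$ solve the Euler equations on $\mathbb R$, and assume that the spectrum of $\mathcal L(0)$ is simple. Then there is a continuously differentiable unitary matrix of eigenvectors $\mathsf E(t)$, $\mathcal L(t)=\mathsf E(t)\Lambda\mathsf E(t)^\dagger$ with $\Lambda$ constant and diagonal. For every such $\mathsf E$ the matrix $\mathsf Q=-i\mathsf E^\dagger\dot{\mathsf E}-\mathsf E^\dagger\mathfrak I(\mathcal L)\mathsf E$ is diagonal, and $$\mathsf V(t)=\mathsf E(0)\exp\Big(i\int_0^t\mathsf Q(t')\,\mathrm dt'\Big)\mathsf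 E(t)^\dagger$$ satisfies $i\dot{\mathsf V}=\mathsf V\,\mathfrak I(\mathcal L)$, $\mathsf V(0)=1$. For every unitary $\mathsf U(0)$ the curve $\mathsf U(t)=\mathsf U(0)\mathsf V(t)$ represents a geodesic of $\mathcal F(3)$, namely the one starting at $\mathsf U(0)$ with velocity $\bar u_i\cdot\dot u_j=-i\alpha_{ij}\mathcal L_{ij}(0)$ for $i\neq j$: every smooth unitary curve that represents a geodesic with these initial data equals $\mathsf U(0)\mathsf V(t)\mathsf D(t)$ with diagonal unitary matrices $\mathsf D(t)$. -/

import Mathlib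

open scoped ComplexConjugate ContDiff

noncomputable section

namespace PeriodPair

/-- The Weierstrass `ζ` function of the lattice:
`ζ(z) = 1/z + ∑_{l ≠ 0} (1/(z - l) + 1/l + z/l²)`. The summand of `l = 0` is `1/z`, because
division by zero gives zero. -/
def weierstrassZeta (L : PeriodPair) (z : ℂ) : ℂ :=
  ∑' l : L.lattice, (1 / (z - l) + 1 / (l : ℂ) + z / (l : ℂ) ^ 2)

/-- The Weierstrass `σ` function of the lattice:
`σ(z) = z ∏_{l ≠ 0} (1 - z/l) exp (z/l + z²/(2l²))`. The factor of `l = 0` is `1`, because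
division by zero gives zero. -/
def weierstrassSigma (L : PeriodPair) (z : ℂ) : ℂ :=
  z * ∏' l : L.lattice,
    ((1 - z / (l : ℂ)) * Complex.exp (z / (l : ℂ) + z ^ 2 / (2 * (l : ℂ) ^ 2)))

end PeriodPair

namespace FlagThree

/-! ### The reduced Euler equations

The sites `1, 2, 3` are the elements `0, 1, 2` of `Fin 3`, so `α₁₂, α₁₃, α₂₃` are
`α 0 1`, `α 0 2`, `α 1 2`. -/

/-- The Hermitian matrix with zero diagonal and entries `a, b, c` above the diagonal. -/
def momentum (a b c : ℂ) : Matrix (Fin 3) (Fin 3) ℂ :=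
  !![0, a, b; conj a, 0, c; conj b, conj c, 0]

/-- The entrywise scaling `[ℑ(M)]ᵢⱼ = αᵢⱼ Mᵢⱼ`. -/
def inertia (α : Matrix (Fin 3) (Fin 3) ℝ) (M : Matrix (Fin 3) (Fin 3) ℂ) :
    Matrix (Fin 3) (Fin 3) ℂ :=
  Matrix.of fun i j => (α i j : ℂ) * M i j

/-- `i ȧ = (α₂₃ - α₁₃) b c̄`, `i ḃ = (α₂₃ - α₁₂) a c`, `i ċ = (α₁₃ - α₁₂) ā b` on the real line. -/
structure IsEulerSolution (α : Matrix (Fin 3) (Fin 3) ℝ) (a b c : ℝ → ℂ) : Prop where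
  differentiable_a : Differentiable ℝ a
  differentiable_b : Differentiable ℝ b
  differentiable_c : Differentiable ℝ c
  eq_a : ∀ t, Complex.I * deriv a t = ((α 1 2 - α 0 2 : ℝ) : ℂ) * (b t * conj (c t))
  eq_b : ∀ t, Complex.I * deriv b t = ((α 1 2 - α 0 1 : ℝ) : ℂ) * (a t * c t)
  eq_c : ∀ t, Complex.I * deriv c t = ((α 0 2 - α 0 1 : ℝ) : ℂ) * (conj (a t) * b t)

/-! ### Integrals of motion and the elliptic curve -/

def h₂ (α : Matrix (Fin 3) (Fin 3) ℝ) (a c : ℂ) : ℝ :=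
  (α 0 1 - α 0 2) * ‖a‖ ^ 2 + (α 1 2 - α 0 2) * ‖c‖ ^ 2

def h₃ (α : Matrix (Fin 3) (Fin 3) ℝ) (b c : ℂ) : ℝ :=
  (α 0 1 - α 0 2) * ‖b‖ ^ 2 + (α 0 1 - α 1 2) * ‖c‖ ^ 2

/-- `ā b c̄ + a b̄ c`, a sum of two conjugate numbers. -/
def h₄ (a b c : ℂ) : ℝ :=
  (conj a * b * conj c + a * conj b * c).re

def I₂ (α : Matrix (Fin 3) (Fin 3) ℝ) (a c : ℂ) : ℝ := -(h₂ α a c) / (α 0 2 - α 1 2)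

def I₃ (α : Matrix (Fin 3) (Fin 3) ℝ) (b c : ℂ) : ℝ := -(h₃ α b c) / (α 1 2 - α 0 1)

def I₄ (α : Matrix (Fin 3) (Fin 3) ℝ) (a b c : ℂ) : ℝ :=
  -((α 0 1 - α 0 2) ^ 2 / ((α 0 1 - α 1 2) * (α 1 2 - α 0 2))) * h₄ a b c ^ 2

def g₂ (α : Matrix (Fin 3) (Fin 3) ℝ) (a b c : ℂ) : ℝ :=
  4 / 3 * (I₂ α a c ^ 2 - I₂ α a c * I₃ α b c + I₃ α b c ^ 2)

def g₃ (α : Matrix (Fin 3) (Fin 3) ℝ) (a b c : ℂ) : ℝ :=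
  -(I₄ α a b c) + 4 / 27 * (I₂ α a c + I₃ α b c) *
    (2 * I₂ α a c ^ 2 - 5 * (I₂ α a c * I₃ α b c) + 2 * I₃ α b c ^ 2)

/-- The factor `√((α₁₂ - α₂₃)(α₂₃ - α₁₃))` in `τ = √((α₁₂ - α₂₃)(α₂₃ - α₁₃)) t`. -/
def timeScale (α : Matrix (Fin 3) (Fin 3) ℝ) : ℝ :=
  √((α 0 1 - α 1 2) * (α 1 2 - α 0 2))

/-! ### The explicit solution

In the following `L.ω₂ / 2` is the half-period `ω₂`, and `ε` is the sign `1` or `-1`. -/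

/-- `y_±(τ|μ)`, a solution of the Lamé equation normalised by `y_±(0|μ) = 1`. -/
def lameSol (L : PeriodPair) (τ₀ : ℝ) (μ : ℂ) (ε : ℂ) (τ : ℝ) : ℂ :=
  Complex.exp (-ε * τ * L.weierstrassZeta μ) *
    (L.weierstrassSigma ((τ : ℂ) - τ₀ + L.ω₂ / 2 + ε * μ) *
        L.weierstrassSigma (-(τ₀ : ℂ) + L.ω₂ / 2)) /
    (L.weierstrassSigma ((τ : ℂ) - τ₀ + L.ω₂ / 2) *
        L.weierstrassSigma (-(τ₀ : ℂ) + L.ω₂ / 2 + ε * μ))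

def coeffM (L : PeriodPair) (τ₀ : ℝ) (μ : ℂ) (ε : ℂ) : ℂ :=
  1 + ε * (L.derivWeierstrassP (-(τ₀ : ℂ) + L.ω₂ / 2) / L.derivWeierstrassP μ)

def coeffN (L : PeriodPair) (τ₀ : ℝ) (μ : ℂ) : ℂ :=
  (L.weierstrassP (-(τ₀ : ℂ) + L.ω₂ / 2) - L.weierstrassP μ) / L.derivWeierstrassP μ

def coeffA (α : Matrix (Fin 3) (Fin 3) ℝ) (a₀ b₀ c₀ : ℂ) (L : PeriodPair) (τ₀ : ℝ)
    (μ : ℂ) (ε : ℂ) : ℂ :=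
  1 / 2 * coeffM L τ₀ μ ε * a₀ + ε * Complex.I * coeffN L τ₀ μ *
    (√((α 1 2 - α 0 2) / (α 0 1 - α 1 2)) : ℝ) * (b₀ * conj c₀)

def coeffB (α : Matrix (Fin 3) (Fin 3) ℝ) (a₀ b₀ c₀ : ℂ) (L : PeriodPair) (τ₀ : ℝ)
    (μ : ℂ) (ε : ℂ) : ℂ :=
  1 / 2 * coeffM L τ₀ μ ε * b₀ - ε * Complex.I * coeffN L τ₀ μ *
    (√((α 0 1 - α 1 2) / (α 1 2 - α 0 2)) : ℝ) * (a₀ * c₀)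

def coeffC (α : Matrix (Fin 3) (Fin 3) ℝ) (a₀ b₀ c₀ : ℂ) (L : PeriodPair) (τ₀ : ℝ)
    (μ : ℂ) (ε : ℂ) : ℂ :=
  1 / 2 * coeffM L τ₀ μ ε * c₀ - ε * Complex.I * coeffN L τ₀ μ *
    ((α 0 1 - α 0 2) / √((α 0 1 - α 1 2) * (α 1 2 - α 0 2)) : ℝ) * (conj a₀ * b₀)

def solA (α : Matrix (Fin 3) (Fin 3) ℝ) (a₀ b₀ c₀ : ℂ) (L : PeriodPair) (τ₀ : ℝ)
    (μ : ℂ) (τ : ℝ) : ℂ :=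
  coeffA α a₀ b₀ c₀ L τ₀ μ 1 * lameSol L τ₀ μ 1 τ +
    coeffA α a₀ b₀ c₀ L τ₀ μ (-1) * lameSol L τ₀ μ (-1) τ

def solB (α : Matrix (Fin 3) (Fin 3) ℝ) (a₀ b₀ c₀ : ℂ) (L : PeriodPair) (τ₀ : ℝ)
    (μ : ℂ) (τ : ℝ) : ℂ :=
  coeffB α a₀ b₀ c₀ L τ₀ μ 1 * lameSol L τ₀ μ 1 τ +
    coeffB α a₀ b₀ c₀ L τ₀ μ (-1) * lameSol L τ₀ μ (-1) τ

def solC (α : Matrix (Fin 3) (Fin 3) ℝ) (a₀ b₀ c₀ : ℂ) (L : PeriodPair) (τ₀ : ℝ)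
    (μ : ℂ) (τ : ℝ) : ℂ :=
  coeffC α a₀ b₀ c₀ L τ₀ μ 1 * lameSol L τ₀ μ 1 τ +
    coeffC α a₀ b₀ c₀ L τ₀ μ (-1) * lameSol L τ₀ μ (-1) τ

/-- `μ` is a solution of `℘(μ) = r` (the poles of `℘` are excluded). -/
def IsWeierstrassRoot (L : PeriodPair) (μ : ℂ) (r : ℝ) : Prop :=
  μ ∉ L.lattice ∧ L.weierstrassP μ = r

/-- The shift `τ₀` is the one fixed by the initial data: `℘(-τ₀ + ω₂) + (I₂ + I₃)/3` is the initial
value of `|c|²`, and `℘'(-τ₀ + ω₂)` is the initial value of `d|c|²/dτ = 2 Re (c̄ dc/dτ)`, where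
`i dc/dτ = (α₁₃ - α₁₂) ā b / √((α₁₂ - α₂₃)(α₂₃ - α₁₃))`. -/
def IsInitialShift (α : Matrix (Fin 3) (Fin 3) ℝ) (a₀ b₀ c₀ : ℂ) (L : PeriodPair)
    (τ₀ : ℝ) : Prop :=
  L.weierstrassP (-(τ₀ : ℂ) + L.ω₂ / 2) =
      ((‖c₀‖ ^ 2 - (I₂ α a₀ c₀ + I₃ α b₀ c₀) / 3 : ℝ) : ℂ) ∧
  L.derivWeierstrassP (-(τ₀ : ℂ) + L.ω₂ / 2) =
      ((2 * (conj c₀ * (-Complex.I * ((α 0 2 - α 0 1 : ℝ) : ℂ) * (conj a₀ * b₀))).re /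
        timeScale α : ℝ) : ℂ)

/-! ### Geodesics on the flag manifold

A curve in the manifold of full flags of `ℂ³` is represented by a curve of unitary matrices `U`
whose columns `u₁, u₂, u₃` span the three lines; `U` is determined up to right multiplication by
diagonal unitary matrices. -/

/-- The entrywise derivative of a curve of matrices. -/
def matDeriv (U : ℝ → Matrix (Fin 3) (Fin 3) ℂ) (t : ℝ) : Matrix (Fin 3) (Fin 3) ℂ :=
  Matrix.of fun i j => deriv (fun s => U s i j) t

/-- The squared speed `∑_{i<j} |ūᵢ · u̇ⱼ|² / αᵢⱼ` in the invariant metric. It does not change when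
`U` is multiplied on the right by diagonal unitary matrices depending on `t`. -/
def speedSq (α : Matrix (Fin 3) (Fin 3) ℝ) (U : ℝ → Matrix (Fin 3) (Fin 3) ℂ) (t : ℝ) : ℝ :=
  ∑ i, ∑ j ∈ Finset.Ioi i, (α i j)⁻¹ * ‖((U t).conjTranspose * matDeriv U t) i j‖ ^ 2

/-- `U` represents a geodesic of the flag manifold: it is smooth and, on every compact interval,
a critical point of the energy under smooth variations with fixed ends. -/
structure IsGeodesic (α : Matrix (Fin 3) (Fin 3) ℝ) (U : ℝ → Matrix (Fin 3) (Fin 3) ℂ) :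
    Prop where
  smooth : ∀ i j, ContDiff ℝ ∞ fun t => U t i j
  unitary : ∀ t, U t ∈ Matrix.unitaryGroup (Fin 3) ℂ
  critical : ∀ t₀ t₁ : ℝ, t₀ < t₁ → ∀ Φ : ℝ → ℝ → Matrix (Fin 3) (Fin 3) ℂ,
    (∀ i j, ContDiff ℝ ∞ fun x : ℝ × ℝ => Φ x.1 x.2 i j) →
    (∀ s t, Φ s t ∈ Matrix.unitaryGroup (Fin 3) ℂ) →
    (∀ t, Φ 0 t = U t) →
    (∀ s t, t ∉ Set.Ioo t₀ t₁ → Φ s t = U t) →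
    HasDerivAt (fun s => ∫ t in t₀..t₁, speedSq α (Φ s) t) 0 0

/-- The initial condition `U(0) = U₀`, `ūᵢ · u̇ⱼ = -i αᵢⱼ Mᵢⱼ` at `t = 0` for `i ≠ j`; the
off-diagonal numbers `ūᵢ · u̇ⱼ` are the velocity in the flag manifold. -/
def HasInitialData (α : Matrix (Fin 3) (Fin 3) ℝ) (U : ℝ → Matrix (Fin 3) (Fin 3) ℂ)
    (U₀ M : Matrix (Fin 3) (Fin 3) ℂ) : Prop :=
  U 0 = U₀ ∧ ∀ i j, i ≠ j →
    ((U 0).conjTranspose * matDeriv U 0) i j = -Complex.I * inertia α M i j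

/-- The spectrum of `M` is simple. -/
def HasSimpleSpectrum (M : Matrix (Fin 3) (Fin 3) ℂ) : Prop :=
  M.charpoly.roots.Nodup

/-- `E(t)` is a continuously differentiable unitary matrix of eigenvectors of `M(t)`,
`M(t) = E(t) Λ E(t)†` with a constant diagonal matrix `Λ`. -/
structure IsEigenframe (M E : ℝ → Matrix (Fin 3) (Fin 3) ℂ) : Prop where
  contDiff : ∀ i j, ContDiff ℝ 1 fun t => E t i j
  unitary : ∀ t, E t ∈ Matrix.unitaryGroup (Fin 3) ℂ
  eq : ∃ Λ : Fin 3 → ℂ, ∀ t, M t = E t * Matrix.diagonal Λ * (E t).conjTranspose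

/-- `Q = -i E† Ė - E† ℑ(M) E`. -/
def connection (α : Matrix (Fin 3) (Fin 3) ℝ) (M E : ℝ → Matrix (Fin 3) (Fin 3) ℂ) (t : ℝ) :
    Matrix (Fin 3) (Fin 3) ℂ :=
  -Complex.I • ((E t).conjTranspose * matDeriv E t) -
    (E t).conjTranspose * inertia α (M t) * E t

/-- `V(t) = E(0) exp(i ∫₀ᵗ Q) E(t)†`, for a diagonal `Q`. -/
def transport (α : Matrix (Fin 3) (Fin 3) ℝ) (M E : ℝ → Matrix (Fin 3) (Fin 3) ℂ) (t : ℝ) :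
    Matrix (Fin 3) (Fin 3) ℂ :=
  E 0 * Matrix.diagonal
      (fun k => Complex.exp (Complex.I * ∫ s in (0 : ℝ)..t, connection α M E s k k)) *
    (E t).conjTranspose

end FlagThree

end

open FlagThree

/-!
The Euler equations and the geodesics are treated by different means: the first by elliptic
functions along a real line in the complex torus, the second by the Lax form of the equations and
the first variation of the energy.

*The elliptic functions.* The Weierstrass product of `σ` and the series of `ζ` give `(log σ)' = ζ`
and `ζ' = -℘`. Liouville's theorem (`PeriodPair.eq_of_periodic_of_removable`) yields
`σ(u + v) σ(u - v) = -σ(u)² σ(v)² (℘(u) - ℘(v))`, and from it the addition formula of `ζ`, the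
differential equation `℘'' = 6℘² - g₂/2`, and the fact that `℘` takes a value only at two opposite
points of the torus. For a rectangular lattice `℘` is real on the boundary of the rectangle of
half-periods, where it takes every real value; the three roots of the cubic are the values at the
half-periods, and `Y = ℘(x)` turns a side into a complete elliptic integral
(`PeriodPair.rect_halfPeriod_eq_integral`). Every pair of real invariants with positive discriminant
comes from a rectangular lattice (`PeriodPair.exists_rect_of_discr_pos`): the ratio `27 g₃² / g₂³`
of the lattice with periods `2` and `2ti` is `0` for `t = 1`, tends to `1` as `t → ∞`, and is
continuous.

*The Euler equations.* `I₂`, `I₃` and `h₄` are integrals, and with them the square of `d|c|²/dτ` is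
the cubic at `|c|² - (I₂ + I₃)/3` (`FlagThree.speedC_sq`). This forces the discriminant to be
nonnegative (`FlagThree.discr_nonneg`) and puts the initial value between the two smaller roots, the
range of `℘` on the line `τ - τ₀ + ω₂`. The pairs `(|c|², d|c|²/dτ)` and `(℘, ℘')` then solve one
and the same autonomous equation, so they agree (`FlagThree.IsAdapted.eq_of_isEulerSolution`).

The product `ā b c̄` has the known real part `h₄/2`, and its imaginary part is a multiple of
`d|c|²/dτ`, so that it is a multiple of `℘' + iκh₄` with a constant `κ`. After multiplication of an
Euler equation by a squared absolute value, it becomes a scalar linear equation, with the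
logarithmic derivative `(℘' ± iκh₄) / (2 (℘ - ℘(μ)))`. At each of the three values `℘(μ)` the cubic
is `-(κh₄)²`, so `℘'(μ) = ± iκh₄`, and by the addition formula of `ζ` this logarithmic derivative
belongs to `y_+` or `y_-` (`FlagThree.hasDerivAt_lameSol`); of the two coefficients of the explicit
formula one vanishes (`FlagThree.exists_lameCombination_eq`). That proves that a solution is given
by the formula (`FlagThree.IsAdapted.eq_sol`). Conversely the functions of the formula have squared
absolute values proportional to `℘ - ℘(μ)`, and their product `ā b c̄` has the logarithmic
derivative of `℘' + iκh₄`; this turns the three linear equations back into the Euler equations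
(`FlagThree.IsAdapted.isEulerSolution_sol`).

*The geodesics.* In the Lax form `i M' = [M, ℑ(M)]` a unitary frame with `E' = i ℑ(M) E`, which
exists for all times (`FlagThree.exists_frame`), keeps diagonalising `M` with constant eigenvalues.
For any eigenframe, differentiation of `M = E Λ E†` shows that `Q` commutes with `Λ`; its
eigenvalues are distinct, so `Q` is diagonal (`FlagThree.IsEigenframe.isDiag_connection`) and
`i V' = V ℑ(M)` follows.

The first variation formula (`FlagThree.hasDerivAt_energy`) expresses the derivative of the energy
by `L' - [L, Ω]`, where `Ω = U† U'` is the velocity and `L` its momentum. It vanishes for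
`U = U₀ V`. For the uniqueness, a critical point is tested with rotations in the coordinate planes,
by an angle of compact support, which gives `L' = [L, Ω]`
(`FlagThree.IsGeodesic.hasMatDerivAt_velocityMomentum`). A gauge of diagonal unitary matrices
removes the diagonal of `Ω`, after which the momentum solves the Euler equations with the initial
values of `M`; hence it is `M`, and the curve and `U₀ V` solve the same linear equation
(`FlagThree.IsGeodesic.eq_mul_diagonal`).
-/


/-! ### The Weierstrass functions `ζ` and `σ` -/

namespace PeriodPair

open Filter Topology

variable (L : PeriodPair)

/-- The factor of the Weierstrass product of `σ` that belongs to the lattice point `l`. It is `1`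
for `l = 0`, because `z / 0 = 0`. -/
noncomputable def sigmaFactor (l z : ℂ) : ℂ :=
  (1 - z / l) * Complex.exp (z / l + z ^ 2 / (2 * l ^ 2))

/-- The entire function `σ(z) / z`. -/
noncomputable def sigmaProd (z : ℂ) : ℂ := ∏' l : L.lattice, sigmaFactor (l : ℂ) z

lemma weierstrassSigma_eq (z : ℂ) : L.weierstrassSigma z = z * L.sigmaProd z := rfl

/-- The exponent `w + w²/2` cancels the Taylor polynomial of `log (1 - w)`, which leaves an error of
third order. -/
lemma norm_one_sub_mul_exp_sub_one_le {w : ℂ} (hw : ‖w‖ ≤ 1 / 2) :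
    ‖(1 - w) * Complex.exp (w + w ^ 2 / 2) - 1‖ ≤ 2 * ‖w‖ ^ 3 := by
  have h1 : 1 - w ≠ 0 := by
    intro h
    have : w = 1 := by linear_combination -h
    rw [this] at hw; norm_num at hw
  have h2 := Complex.norm_log_sub_logTaylor_le 2 (z := -w) (by rw [norm_neg]; linarith)
  have h3 : Complex.logTaylor 3 (-w) = -(w + w ^ 2 / 2) := by
    simp [Complex.logTaylor, Finset.sum_range_succ]; ring
  rw [show 2 + 1 = 3 from rfl, h3, norm_neg, sub_neg_eq_add, ← sub_eq_add_neg] at h2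
  have h4 : ‖Complex.log (1 - w) + (w + w ^ 2 / 2)‖ ≤ ‖w‖ ^ 3 := by
    refine h2.trans ?_
    have : (1 - ‖w‖)⁻¹ ≤ 2 := by
      rw [inv_le_comm₀ (by linarith) (by norm_num)]; linarith
    have h5 : 0 ≤ ‖w‖ ^ 3 := by positivity
    norm_num
    nlinarith
  have h6 : (1 - w) * Complex.exp (w + w ^ 2 / 2) =
      Complex.exp (Complex.log (1 - w) + (w + w ^ 2 / 2)) := by
    rw [Complex.exp_add (Complex.log _), Complex.exp_log h1]
  rw [h6]
  refine (Complex.norm_exp_sub_one_le (h4.trans ?_)).trans (by linarith)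
  calc ‖w‖ ^ 3 ≤ (1 / 2 : ℝ) ^ 3 := by gcongr
    _ ≤ 1 := by norm_num

lemma norm_sigmaFactor_sub_one_le {r : ℝ} {z l : ℂ} (hz : ‖z‖ < r) (hl : 2 * r ≤ ‖l‖) :
    ‖sigmaFactor l z - 1‖ ≤ 2 * r ^ 3 * ‖l‖ ^ (-3 : ℝ) := by
  have hr : 0 < r := (norm_nonneg z).trans_lt hz
  have hl0 : 0 < ‖l‖ := by linarith
  have hw : ‖z / l‖ ≤ 1 / 2 := by
    rw [norm_div, div_le_iff₀ hl0]; linarith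
  have h := norm_one_sub_mul_exp_sub_one_le hw
  have e : sigmaFactor l z = (1 - z / l) * Complex.exp (z / l + (z / l) ^ 2 / 2) := by
    rw [sigmaFactor, div_pow, div_div, mul_comm (l ^ 2) 2]
  rw [e]
  refine h.trans ?_
  rw [norm_div, div_pow, show (-3 : ℝ) = -((3 : ℕ) : ℝ) by norm_num, Real.rpow_neg hl0.le,
    Real.rpow_natCast, mul_div_assoc', div_eq_mul_inv]
  gcongr

lemma summable_norm_lattice_rpow : Summable fun l : L.lattice => ‖(l : ℂ)‖ ^ (-3 : ℝ) :=
  ZLattice.summable_norm_rpow _ _ (by simp; norm_num)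

lemma eventually_le_norm_lattice (r : ℝ) : ∀ᶠ l : L.lattice in cofinite, r ≤ ‖(l : ℂ)‖ := by
  have h : {l : L.lattice | ¬ r ≤ ‖(l : ℂ)‖} ⊆ Metric.closedBall (0 : L.lattice) r := by
    intro l hl
    simp only [Set.mem_ofPred_eq, not_le] at hl
    simpa using hl.le
  exact ((isCompact_iff_finite.mp (isCompact_closedBall (0 : L.lattice) r)).subset h)

lemma differentiable_sigmaFactor (l : ℂ) : Differentiable ℂ (sigmaFactor l) := by
  unfold sigmaFactor; fun_prop

lemma hasProdLocallyUniformlyOn_sigmaFactor (r : ℝ) :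
    HasProdLocallyUniformlyOn (fun (l : L.lattice) z => sigmaFactor (l : ℂ) z) L.sigmaProd
      (Metric.ball 0 r) := by
  have h := Summable.hasProdLocallyUniformlyOn_one_add (K := Metric.ball (0 : ℂ) r)
    (f := fun (l : L.lattice) z => sigmaFactor (l : ℂ) z - 1)
    (u := fun l : L.lattice => 2 * r ^ 3 * ‖(l : ℂ)‖ ^ (-3 : ℝ)) Metric.isOpen_ball
    (L.summable_norm_lattice_rpow.mul_left _) ?_ ?_
  · simp only [add_sub_cancel] at h
    exact h
  · filter_upwards [L.eventually_le_norm_lattice (2 * r)] with l hl z hz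
    exact norm_sigmaFactor_sub_one_le (by simpa using hz) hl
  · exact fun l => ((differentiable_sigmaFactor _).sub_const 1).continuous.continuousOn

lemma differentiable_sigmaProd : Differentiable ℂ L.sigmaProd := by
  intro z
  have h := L.hasProdLocallyUniformlyOn_sigmaFactor (‖z‖ + 1)
  have h2 := (hasProdLocallyUniformlyOn_iff_tendstoLocallyUniformlyOn.mp h).differentiableOn
    (.of_forall fun s => (Differentiable.fun_finsetProd fun (l : L.lattice) _ =>
      differentiable_sigmaFactor (l : ℂ)).differentiableOn) Metric.isOpen_ball
  exact h2.differentiableAt (Metric.isOpen_ball.mem_nhds (by simp))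

lemma differentiable_weierstrassSigma : Differentiable ℂ L.weierstrassSigma := by
  have := L.differentiable_sigmaProd
  unfold weierstrassSigma
  exact differentiable_id.mul this

lemma sigmaProd_zero : L.sigmaProd 0 = 1 := by simp [sigmaProd, sigmaFactor]

lemma sigmaFactor_ne_zero {l z : ℂ} (h : z ≠ l) : sigmaFactor l z ≠ 0 := by
  refine mul_ne_zero ?_ (Complex.exp_ne_zero _)
  rcases eq_or_ne l 0 with rfl | hl
  · simp
  · rw [sub_ne_zero, ne_comm, Ne, div_eq_one_iff_eq hl]; exact h

lemma sigmaProd_ne_zero {z : ℂ} (hz : z ∉ L.lattice) : L.sigmaProd z ≠ 0 := by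
  have h := tprod_one_add_ne_zero_of_summable (ι := L.lattice)
    (f := fun l => sigmaFactor (l : ℂ) z - 1) ?_ ?_
  · simpa only [add_sub_cancel, sigmaProd] using h
  · intro l
    rw [add_sub_cancel]
    exact sigmaFactor_ne_zero (by rintro rfl; exact hz l.2)
  · have h := (L.summable_norm_lattice_rpow.mul_left (2 * (‖z‖ + 1) ^ 3))
    refine h.of_norm_bounded_eventually ?_
    filter_upwards [L.eventually_le_norm_lattice (2 * (‖z‖ + 1))] with l hl
    rw [norm_norm]
    exact norm_sigmaFactor_sub_one_le (by simp) hl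

lemma weierstrassSigma_ne_zero {z : ℂ} (hz : z ∉ L.lattice) : L.weierstrassSigma z ≠ 0 :=
  mul_ne_zero (by rintro rfl; exact hz (zero_mem _)) (L.sigmaProd_ne_zero hz)

lemma weierstrassSigma_coe {l : ℂ} (hl : l ∈ L.lattice) : L.weierstrassSigma l = 0 := by
  rcases eq_or_ne l 0 with rfl | h0
  · simp [weierstrassSigma]
  · rw [weierstrassSigma_eq]
    refine mul_eq_zero_of_right _ ?_
    exact tprod_of_exists_eq_zero ⟨⟨l, hl⟩, by simp [sigmaFactor, h0]⟩

lemma weierstrassSigma_zero : L.weierstrassSigma 0 = 0 := L.weierstrassSigma_coe (zero_mem _)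

lemma sigmaProd_neg (z : ℂ) : L.sigmaProd (-z) = L.sigmaProd z := by
  unfold sigmaProd
  rw [← (Equiv.neg L.lattice).tprod_eq]
  congr 1; ext l
  simp [sigmaFactor, neg_div_neg_eq]

lemma weierstrassSigma_neg (z : ℂ) : L.weierstrassSigma (-z) = -L.weierstrassSigma z := by
  simp [weierstrassSigma_eq, sigmaProd_neg]

/-- The summand of `ζ` that belongs to the lattice point `l`. It is `1 / z` for `l = 0`, because
`1 / 0 = 0`. -/
noncomputable def zetaSummand (l z : ℂ) : ℂ := 1 / (z - l) + 1 / l + z / l ^ 2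

lemma norm_zetaSummand_le {r : ℝ} {z l : ℂ} (hz : ‖z‖ < r) (hl : 2 * r ≤ ‖l‖) :
    ‖zetaSummand l z‖ ≤ 2 * r ^ 2 * ‖l‖ ^ (-3 : ℝ) := by
  have hr : 0 < r := (norm_nonneg z).trans_lt hz
  have hl0 : 0 < ‖l‖ := by linarith
  have hl1 : l ≠ 0 := norm_pos_iff.mp hl0
  have h1 : ‖l‖ / 2 ≤ ‖z - l‖ := by
    rw [norm_sub_rev]; exact .trans (by linarith) (norm_sub_norm_le l z)
  have h2 : z - l ≠ 0 := norm_pos_iff.mp (by linarith)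
  have e : zetaSummand l z = z ^ 2 / (l ^ 2 * (z - l)) := by
    unfold zetaSummand; field_simp; ring
  rw [e, norm_div, norm_mul, norm_pow, norm_pow, show (-3 : ℝ) = -((3 : ℕ) : ℝ) by norm_num,
    Real.rpow_neg hl0.le, Real.rpow_natCast, ← div_eq_mul_inv]
  calc ‖z‖ ^ 2 / (‖l‖ ^ 2 * ‖z - l‖) ≤ r ^ 2 / (‖l‖ ^ 2 * (‖l‖ / 2)) := by gcongr
    _ = _ := by field_simp

lemma hasSumLocallyUniformly_weierstrassZeta :
    HasSumLocallyUniformly (fun (l : L.lattice) z => zetaSummand (l : ℂ) z)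
      L.weierstrassZeta := by
  refine L.hasSumLocallyUniformly_aux (u := fun r l => 2 * r ^ 2 * ‖(l : ℂ)‖ ^ (-3 : ℝ)) _
    (fun r hr => L.summable_norm_lattice_rpow.mul_left _) fun r hr => ?_
  filter_upwards [eventually_ge_atTop (2 * r)] with R hR x hx l hl
  exact norm_zetaSummand_le hx (by rw [hl]; exact hR)

lemma hasSum_weierstrassZeta (z : ℂ) :
    HasSum (fun l : L.lattice => zetaSummand (l : ℂ) z) (L.weierstrassZeta z) :=
  L.hasSumLocallyUniformly_weierstrassZeta.tendstoLocallyUniformlyOn.tendsto_at (Set.mem_univ z)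

lemma hasDerivAt_zetaSummand {l z : ℂ} (h : z ≠ l) :
    HasDerivAt (zetaSummand l) (-(1 / (z - l) ^ 2 - 1 / l ^ 2)) z := by
  have h0 := sub_ne_zero.mpr h
  have h1 : HasDerivAt (fun z : ℂ => (z - l)⁻¹) (-1 / (z - l) ^ 2) z :=
    ((hasDerivAt_id z).sub_const l).inv h0
  have h2 := (h1.add_const (1 / l)).add ((hasDerivAt_id z).div_const (l ^ 2))
  refine (h2.congr_deriv ?_).congr_of_eventuallyEq (.of_forall fun y => ?_)
  · ring
  · simp [zetaSummand, one_div]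

lemma hasDerivAt_weierstrassZeta {z : ℂ} (hz : z ∉ L.lattice) :
    HasDerivAt L.weierstrassZeta (-L.weierstrassP z) z := by
  have hopen : IsOpen ((L.lattice : Set ℂ)ᶜ) := L.isClosed_lattice.isOpen_compl
  have hd : ∀ s : Finset L.lattice, ∀ y ∈ ((L.lattice : Set ℂ)ᶜ),
      HasDerivAt (fun y => ∑ l ∈ s, zetaSummand (l : ℂ) y)
        (∑ l ∈ s, -(1 / (y - (l : ℂ)) ^ 2 - 1 / (l : ℂ) ^ 2)) y := fun s y hy =>
    HasDerivAt.fun_sum fun l _ => hasDerivAt_zetaSummand (by rintro rfl; exact hy l.2)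
  have hloc := L.hasSumLocallyUniformly_weierstrassZeta.tendstoLocallyUniformlyOn
    (s := ((L.lattice : Set ℂ)ᶜ))
  have hdiff := hloc.differentiableOn (.of_forall fun s y hy =>
    (hd s y hy).differentiableAt.differentiableWithinAt) hopen
  have hder := hloc.deriv (.of_forall fun s y hy =>
    (hd s y hy).differentiableAt.differentiableWithinAt) hopen
  have h1 := hder.tendsto_at hz
  have h2 := (L.hasSum_weierstrassP z).neg
  have h3 : deriv L.weierstrassZeta z = -L.weierstrassP z := by
    refine tendsto_nhds_unique h1 (h2.congr fun s => ?_)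
    exact ((hd s z hz).deriv).symm
  rw [← h3]
  exact (hdiff.differentiableAt (hopen.mem_nhds hz)).hasDerivAt

lemma logDeriv_sigmaFactor {l z : ℂ} (h : z ≠ l) (hl : l ≠ 0) :
    logDeriv (sigmaFactor l) z = zetaSummand l z := by
  have h0 := sub_ne_zero.mpr h
  have h1 : (1 : ℂ) - z / l ≠ 0 := by
    rw [sub_ne_zero, ne_comm, Ne, div_eq_one_iff_eq hl]; exact h
  have h1' : l - z ≠ 0 := sub_ne_zero.mpr h.symm
  have d1 : HasDerivAt (fun z : ℂ => 1 - z / l) (-(1 / l)) z :=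
    ((hasDerivAt_id z).div_const l).const_sub 1
  have d2 : HasDerivAt (fun z : ℂ => z / l + z ^ 2 / (2 * l ^ 2)) (1 / l + z / l ^ 2) z := by
    refine (((hasDerivAt_id z).div_const l).add
      (((hasDerivAt_id z).pow 2).div_const (2 * l ^ 2))).congr_deriv ?_
    simp; field_simp
  have d3 := d1.mul d2.cexp
  have e : sigmaFactor l = (fun z : ℂ => 1 - z / l) *
      fun z => Complex.exp (z / l + z ^ 2 / (2 * l ^ 2)) := by ext; rfl
  rw [logDeriv_apply, e, d3.deriv, Pi.mul_apply, zetaSummand]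
  have := Complex.exp_ne_zero (z / l + z ^ 2 / (2 * l ^ 2))
  have e2 : 1 - z / l = (l - z) / l := by field_simp
  rw [e2]
  generalize Complex.exp (z / l + z ^ 2 / (2 * l ^ 2)) = E at *
  rw [← sub_eq_zero]
  have e3 : z - l = -(l - z) := by ring
  rw [e3]
  field_simp
  ring

lemma logDeriv_sigmaFactor_zero (z : ℂ) : logDeriv (sigmaFactor 0) z = 0 := by
  have : sigmaFactor 0 = fun _ => 1 := by ext; simp [sigmaFactor]
  simp [this, logDeriv_apply]

lemma logDeriv_weierstrassSigma {z : ℂ} (hz : z ∉ L.lattice) :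
    logDeriv L.weierstrassSigma z = L.weierstrassZeta z := by
  have hz0 : z ≠ 0 := by rintro rfl; exact hz (zero_mem _)
  have hne : ∀ l : L.lattice, z ≠ l := by rintro l rfl; exact hz l.2
  have hs : HasSum (fun l : L.lattice => logDeriv (sigmaFactor (l : ℂ)) z)
      (L.weierstrassZeta z - 1 / z) := by
    have h := (L.hasSum_weierstrassZeta z).sub
      (hasSum_ite_eq (0 : L.lattice) (1 / z))
    refine h.congr_fun ?_ |> fun h => h
    intro l
    by_cases hl : l = 0
    · subst hl; simp [logDeriv_sigmaFactor_zero, zetaSummand]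
    · rw [logDeriv_sigmaFactor (hne l) (by simpa using hl), if_neg hl, sub_zero]
  have h := logDeriv_tprod_eq_tsum (s := Metric.ball (0 : ℂ) (‖z‖ + 1)) Metric.isOpen_ball
    (x := z) (by simp) (f := fun l : L.lattice => sigmaFactor (l : ℂ))
    (fun l => sigmaFactor_ne_zero (hne l))
    (fun l => (differentiable_sigmaFactor _).differentiableOn) hs.summable
    (L.hasProdLocallyUniformlyOn_sigmaFactor _).multipliableLocallyUniformlyOn
    (L.sigmaProd_ne_zero hz)
  have e : L.weierstrassSigma = fun z => id z * L.sigmaProd z := by ext; rfl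
  rw [e, logDeriv_mul z hz0 (L.sigmaProd_ne_zero hz) differentiableAt_id
    (L.differentiable_sigmaProd z)]
  have h' : logDeriv L.sigmaProd z = L.weierstrassZeta z - 1 / z := by
    rw [← hs.tsum_eq]; exact h
  rw [h', logDeriv_id]; ring

lemma hasDerivAt_weierstrassSigma {z : ℂ} (hz : z ∉ L.lattice) :
    HasDerivAt L.weierstrassSigma (L.weierstrassZeta z * L.weierstrassSigma z) z := by
  rw [← L.logDeriv_weierstrassSigma hz, logDeriv_apply,
    div_mul_cancel₀ _ (L.weierstrassSigma_ne_zero hz)]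
  exact (L.differentiable_weierstrassSigma z).hasDerivAt

lemma weierstrassZeta_neg (z : ℂ) : L.weierstrassZeta (-z) = -L.weierstrassZeta z := by
  refine (L.hasSum_weierstrassZeta (-z)).unique ?_
  have h := (Equiv.neg L.lattice).hasSum_iff.mpr (L.hasSum_weierstrassZeta z).neg
  refine h.congr_fun fun l => ?_
  have : z - -(l : ℂ) = -(-z - l) := by ring
  have h2 : (l : ℂ) + z = -(-z - l) := by ring
  simp [zetaSummand, this]
  rw [h2, inv_neg]
  ring

/-- A lattice is countable, so that its complement in the plane is connected. -/
lemma isPreconnected_compl_lattice : IsPreconnected ((L.lattice : Set ℂ)ᶜ) := by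
  have : Countable L.lattice := L.latticeEquivProd.toEquiv.countable_iff.mpr inferInstance
  refine (Set.Countable.isConnected_compl_of_one_lt_rank ?_ ?_).isPreconnected
  · simp [Complex.rank_real_complex]
  · exact Set.countable_coe_iff.mp this

lemma eq_of_hasDerivAt_zero {f : ℂ → ℂ} (hf : ∀ z ∉ L.lattice, HasDerivAt f 0 z) {x y : ℂ}
    (hx : x ∉ L.lattice) (hy : y ∉ L.lattice) : f x = f y :=
  L.isClosed_lattice.isOpen_compl.is_const_of_deriv_eq_zero L.isPreconnected_compl_lattice
    (fun z hz => (hf z hz).differentiableAt.differentiableWithinAt)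
    (fun z hz => (hf z hz).deriv) hx hy

lemma add_notMem_lattice {z l : ℂ} (hz : z ∉ L.lattice) (hl : l ∈ L.lattice) :
    z + l ∉ L.lattice := fun h => hz (by simpa using sub_mem h hl)

lemma exists_notMem_lattice : ∃ z, z ∉ L.lattice := ⟨_, L.ω₁_div_two_notMem_lattice⟩

/-- `ζ` changes by a constant under a translation by a period, because its derivative `-℘` is
periodic. -/
lemma exists_weierstrassZeta_add {l : ℂ} (hl : l ∈ L.lattice) :
    ∃ η : ℂ, ∀ z ∉ L.lattice, L.weierstrassZeta (z + l) = L.weierstrassZeta z + η := by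
  obtain ⟨z₀, hz₀⟩ := L.exists_notMem_lattice
  refine ⟨L.weierstrassZeta (z₀ + l) - L.weierstrassZeta z₀, fun z hz => ?_⟩
  have := L.eq_of_hasDerivAt_zero (f := fun z => L.weierstrassZeta (z + l) - L.weierstrassZeta z)
    (fun z hz => ?_) hz hz₀
  · linear_combination this
  · have h1 := (L.hasDerivAt_weierstrassZeta (L.add_notMem_lattice hz hl)).comp_add_const z l
    refine (h1.sub (L.hasDerivAt_weierstrassZeta hz)).congr_deriv ?_
    rw [L.weierstrassP_add_coe z ⟨l, hl⟩]; ring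

/-- `σ` is multiplied by `c exp(ηz)` under a translation by a period, because its logarithmic
derivative `ζ` changes by a constant. -/
lemma exists_weierstrassSigma_add {l : ℂ} (hl : l ∈ L.lattice) :
    ∃ c η : ℂ, c ≠ 0 ∧ ∀ z, L.weierstrassSigma (z + l) =
      c * Complex.exp (η * z) * L.weierstrassSigma z := by
  obtain ⟨η, hη⟩ := L.exists_weierstrassZeta_add hl
  obtain ⟨z₀, hz₀⟩ := L.exists_notMem_lattice
  set f : ℂ → ℂ := fun z => L.weierstrassSigma (z + l) /
    (Complex.exp (η * z) * L.weierstrassSigma z) with hf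
  have hden : ∀ z ∉ L.lattice, Complex.exp (η * z) * L.weierstrassSigma z ≠ 0 := fun z hz =>
    mul_ne_zero (Complex.exp_ne_zero _) (L.weierstrassSigma_ne_zero hz)
  refine ⟨f z₀, η, div_ne_zero (L.weierstrassSigma_ne_zero (L.add_notMem_lattice hz₀ hl))
    (hden _ hz₀), fun z => ?_⟩
  by_cases hz : z ∈ L.lattice
  · rw [L.weierstrassSigma_coe hz, L.weierstrassSigma_coe (add_mem hz hl), mul_zero]
  have hfz : f z = f z₀ := by
    refine L.eq_of_hasDerivAt_zero (fun z hz => ?_) hz hz₀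
    have h1 := (L.hasDerivAt_weierstrassSigma (L.add_notMem_lattice hz hl)).comp_add_const z l
    have h2 : HasDerivAt (fun z => Complex.exp (η * z)) (Complex.exp (η * z) * η) z := by
      simpa using ((hasDerivAt_id z).const_mul η).cexp
    refine (h1.div (h2.mul (L.hasDerivAt_weierstrassSigma hz)) (hden z hz)).congr_deriv ?_
    rw [hη z hz, Pi.mul_apply, div_eq_zero_iff]
    left; ring
  rw [← hfz, hf, mul_assoc, div_mul_cancel₀ _ (hden z hz)]

end PeriodPair

/-! ### Elliptic functions and the addition formulas -/

namespace PeriodPair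

open Filter Topology

variable (L : PeriodPair)

lemma eventually_notMem_lattice (z : ℂ) : ∀ᶠ w in 𝓝[≠] z, w ∉ L.lattice := by
  have h := mem_nhdsWithin_of_mem_nhds (t := {z}ᶜ) (L.compl_lattice_sdiff_singleton_mem_nhds z)
  filter_upwards [h, self_mem_nhdsWithin] with w hw hwz hwL
  exact hw ⟨hwL, hwz⟩

/-- An elliptic function without poles is constant. The function need only be given off the
lattice, if it extends to the origin. -/
lemma eq_of_periodic_of_removable {k B : ℂ → ℂ}
    (hper : ∀ z ∉ L.lattice, ∀ l ∈ L.lattice, k (z + l) = k z)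
    (hd : ∀ z ∉ L.lattice, DifferentiableAt ℂ k z)
    (hB : DifferentiableAt ℂ B 0) (hkB : ∀ᶠ u in 𝓝[≠] 0, k u = B u)
    {x y : ℂ} (hx : x ∉ L.lattice) (hy : y ∉ L.lattice) : k x = k y := by
  classical
  -- the extension to the lattice points is entire and bounded
  set K : ℂ → ℂ := fun z => if z ∈ L.lattice then B 0 else k z with hK
  have hKper : ∀ z w, w ∈ L.lattice → K (z + w) = K z := by
    intro z w hw
    by_cases hz : z ∈ L.lattice
    · simp [hK, hz, add_mem hz hw]
    · simp [hK, hz, L.add_notMem_lattice hz hw, hper z hz w hw]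
  have hK0 : DifferentiableAt ℂ K 0 := by
    refine hB.congr_of_eventuallyEq ?_
    rw [EventuallyEq, ← nhdsNE_sup_pure, eventually_sup]
    refine ⟨?_, ?_⟩
    · filter_upwards [hkB, L.eventually_notMem_lattice 0] with u hu hu'
      simp [hK, hu', hu]
    · simp [hK]
  have hKd : Differentiable ℂ K := by
    intro z
    by_cases hz : z ∈ L.lattice
    · have e : K = fun w => K (w - z) := by
        ext w
        have := hKper (w - z) z hz
        rwa [sub_add_cancel] at this
      rw [e]
      refine DifferentiableAt.fun_comp' z (g := K) ?_ (differentiableAt_id.sub_const z)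
      simpa using hK0
    · refine (hd z hz).congr_of_eventuallyEq ?_
      filter_upwards [L.isClosed_lattice.isOpen_compl.mem_nhds hz] with w hw
      exact if_neg hw
  have h := hKd.apply_eq_apply_of_bounded
    (IsZLattice.isCompact_range_of_periodic L.lattice K hKd.continuous hKper).isBounded x y
  simpa [hK, hx, hy] using h

lemma hasDerivAt_weierstrassP {z : ℂ} (hz : z ∉ L.lattice) :
    HasDerivAt L.weierstrassP (L.derivWeierstrassP z) z := by
  rw [← deriv_weierstrassP]
  exact (L.differentiableOn_weierstrassP.differentiableAt
    (L.isClosed_lattice.isOpen_compl.mem_nhds hz)).hasDerivAt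

/-- The product formula `σ(u + v) σ(u - v) = -σ(u)² σ(v)² (℘(u) - ℘(v))`. The quotient of the left
side by `σ(u)²` is an elliptic function of `u` whose principal part at the origin is that of
`-σ(v)² ℘(u)`. -/
lemma weierstrassSigma_add_mul_sub {u v : ℂ} (hu : u ∉ L.lattice) (hv : v ∉ L.lattice) :
    L.weierstrassSigma (u + v) * L.weierstrassSigma (u - v) =
      -(L.weierstrassSigma u ^ 2 * L.weierstrassSigma v ^ 2 *
        (L.weierstrassP u - L.weierstrassP v)) := by
  have hσd := L.differentiable_weierstrassSigma
  -- the elliptic function `k` is `A / u²`, where `A` is holomorphic and even near the origin and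
  -- vanishes there, so that it has a double zero
  set k : ℂ → ℂ := fun u => L.weierstrassSigma (u + v) * L.weierstrassSigma (u - v) /
    L.weierstrassSigma u ^ 2 + L.weierstrassSigma v ^ 2 * L.weierstrassP u with hk
  set A : ℂ → ℂ := fun u => L.weierstrassSigma (u + v) * L.weierstrassSigma (u - v) /
    L.sigmaProd u ^ 2 + L.weierstrassSigma v ^ 2 * (u ^ 2 * L.weierstrassPExcept 0 u + 1) with hA
  have hs : ((L.lattice : Set ℂ) \ {0})ᶜ ∈ 𝓝 (0 : ℂ) :=
    L.compl_lattice_sdiff_singleton_mem_nhds 0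
  have hPne : ∀ u ∈ ((L.lattice : Set ℂ) \ {0})ᶜ, L.sigmaProd u ≠ 0 := by
    intro u hu
    rcases eq_or_ne u 0 with rfl | h0
    · simp [L.sigmaProd_zero]
    · exact L.sigmaProd_ne_zero fun h => hu ⟨h, h0⟩
  have hAd : DifferentiableOn ℂ A ((L.lattice : Set ℂ) \ {0})ᶜ := by
    refine DifferentiableOn.add (DifferentiableOn.div ?_ ?_ ?_) ?_
    · exact Differentiable.differentiableOn (by fun_prop)
    · exact (L.differentiable_sigmaProd.pow 2).differentiableOn
    · exact fun u hu => pow_ne_zero _ (hPne u hu)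
    · exact (((differentiable_id.pow 2).differentiableOn.mul
        (L.differentiableOn_weierstrassPExcept 0)).add_const 1).const_mul _
  have hA0 : A 0 = 0 := by
    simp [hA, L.sigmaProd_zero, L.weierstrassSigma_neg]; ring
  have hAeven : ∀ u, A (-u) = A u := by
    intro u
    simp only [hA]
    rw [show -u + v = -(u - v) by ring, show -u - v = -(u + v) by ring, L.weierstrassSigma_neg,
      L.weierstrassSigma_neg, L.sigmaProd_neg, L.weierstrassPExcept_neg, neg_zero]
    ring
  have hA1 : deriv A 0 = 0 := by
    have h := deriv_comp_neg A 0
    have e : (fun u => A (-u)) = A := funext hAeven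
    rw [e, neg_zero] at h
    have : (2 : ℂ) * deriv A 0 = 0 := by linear_combination h
    simpa using this
  have hB : DifferentiableAt ℂ (dslope (dslope A 0) 0) 0 :=
    (((Complex.differentiableOn_dslope hs).mpr
      ((Complex.differentiableOn_dslope hs).mpr hAd))).differentiableAt hs
  have hkB : ∀ᶠ u in 𝓝[≠] 0, k u = dslope (dslope A 0) 0 u := by
    filter_upwards [L.eventually_notMem_lattice 0, self_mem_nhdsWithin] with u hu hu0
    have hu0 : u ≠ 0 := hu0
    rw [dslope_of_ne _ hu0, slope_def_field, dslope_same, hA1, dslope_of_ne _ hu0, slope_def_field,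
      hA0]
    have hP := L.weierstrassPExcept_add (0 : L.lattice) u
    simp only [ZeroMemClass.coe_zero, sub_zero, ne_eq, OfNat.ofNat_ne_zero, not_false_eq_true,
      zero_pow, div_zero] at hP
    have h1 : L.sigmaProd u ≠ 0 := L.sigmaProd_ne_zero hu
    simp only [hk, hA, ← hP]
    rw [L.weierstrassSigma_eq u]
    field_simp
    ring
  have hconst := L.eq_of_periodic_of_removable (k := k) ?_ ?_ hB hkB hu hv
  · have h1 := L.weierstrassSigma_ne_zero hu
    simp only [hk, sub_self, L.weierstrassSigma_zero, mul_zero, zero_div, zero_add] at hconst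
    have h2 : L.weierstrassSigma (u + v) * L.weierstrassSigma (u - v) / L.weierstrassSigma u ^ 2 =
      L.weierstrassSigma v ^ 2 * (L.weierstrassP v - L.weierstrassP u) := by
        linear_combination hconst
    rw [div_eq_iff (pow_ne_zero _ h1)] at h2
    rw [h2]; ring
  · intro z hz l hl
    obtain ⟨c, η, hc, h⟩ := L.exists_weierstrassSigma_add hl
    have h1 := L.weierstrassSigma_ne_zero hz
    simp only [hk]
    rw [show z + l + v = z + v + l by ring, show z + l - v = z - v + l by ring, h, h, h,
      L.weierstrassP_add_coe z ⟨l, hl⟩]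
    have e : Complex.exp (η * (z + v)) * Complex.exp (η * (z - v)) = Complex.exp (η * z) ^ 2 := by
      rw [← Complex.exp_add, sq, ← Complex.exp_add]; congr 1; ring
    have h2 := Complex.exp_ne_zero (η * z)
    congr 1
    field_simp
    linear_combination L.weierstrassSigma (z + v) * L.weierstrassSigma (z - v) * e
  · intro z hz
    refine DifferentiableAt.add (DifferentiableAt.div ?_ ?_ ?_) ?_
    · fun_prop
    · fun_prop
    · exact pow_ne_zero _ (L.weierstrassSigma_ne_zero hz)
    · exact (L.hasDerivAt_weierstrassP hz).differentiableAt.const_mul _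

lemma weierstrassP_sub_ne_zero {u v : ℂ} (hu : u ∉ L.lattice) (hv : v ∉ L.lattice)
    (h1 : u + v ∉ L.lattice) (h2 : u - v ∉ L.lattice) :
    L.weierstrassP u - L.weierstrassP v ≠ 0 := by
  intro h
  have := L.weierstrassSigma_add_mul_sub hu hv
  rw [h, mul_zero, neg_zero] at this
  exact mul_ne_zero (L.weierstrassSigma_ne_zero h1) (L.weierstrassSigma_ne_zero h2) this

/-- `℘` takes a value only at two points of the torus, which are opposite. -/
lemma add_mem_or_sub_mem_of_weierstrassP_eq {u v : ℂ} (hu : u ∉ L.lattice) (hv : v ∉ L.lattice)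
    (h : L.weierstrassP u = L.weierstrassP v) : u + v ∈ L.lattice ∨ u - v ∈ L.lattice := by
  by_contra! hc
  exact L.weierstrassP_sub_ne_zero hu hv hc.1 hc.2 (sub_eq_zero.mpr h)

/-- The logarithmic derivative of the product formula of `σ` with respect to `u`. -/
lemma zeta_add_aux {u v : ℂ} (hu : u ∉ L.lattice) (hv : v ∉ L.lattice)
    (h1 : u + v ∉ L.lattice) (h2 : u - v ∉ L.lattice) :
    (L.weierstrassZeta (u + v) + L.weierstrassZeta (u - v) - 2 * L.weierstrassZeta u) *
      (L.weierstrassP u - L.weierstrassP v) = L.derivWeierstrassP u := by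
  have d1 := ((L.hasDerivAt_weierstrassSigma h1).comp_add_const u v).mul
    ((L.hasDerivAt_weierstrassSigma h2).comp_sub_const u v)
  have d2 := ((((L.hasDerivAt_weierstrassSigma hu).pow 2).mul_const
    (L.weierstrassSigma v ^ 2)).mul ((L.hasDerivAt_weierstrassP hu).sub_const
      (L.weierstrassP v))).neg
  have h := d1.unique (d2.congr_of_eventuallyEq ?_)
  · have e := L.weierstrassSigma_add_mul_sub hu hv
    have n1 := L.weierstrassSigma_ne_zero hu
    have n2 := L.weierstrassSigma_ne_zero hv
    have n3 : L.weierstrassSigma u ^ 2 * L.weierstrassSigma v ^ 2 ≠ 0 := by positivity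
    refine mul_left_cancel₀ n3 ?_
    simp only [Pi.pow_apply] at h
    norm_num at h
    linear_combination (L.weierstrassZeta (u + v) + L.weierstrassZeta (u - v)) * e - h
  · filter_upwards [L.isClosed_lattice.isOpen_compl.mem_nhds hu] with w hw
    simpa using L.weierstrassSigma_add_mul_sub hw hv

/-- The addition formula of `ζ`:
`ζ(u + v) - ζ(u) - ζ(v) = (℘'(u) - ℘'(v)) / (2 (℘(u) - ℘(v)))`. -/
lemma weierstrassZeta_add {u v : ℂ} (hu : u ∉ L.lattice) (hv : v ∉ L.lattice)
    (h1 : u + v ∉ L.lattice) (h2 : u - v ∉ L.lattice) :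
    L.weierstrassZeta (u + v) - L.weierstrassZeta u - L.weierstrassZeta v =
      (L.derivWeierstrassP u - L.derivWeierstrassP v) /
        (2 * (L.weierstrassP u - L.weierstrassP v)) := by
  have h3 : v - u ∉ L.lattice := fun h => h2 (by simpa using neg_mem h)
  have e1 := L.zeta_add_aux hu hv h1 h2
  have e2 := L.zeta_add_aux hv hu (by rwa [add_comm]) h3
  have hne := L.weierstrassP_sub_ne_zero hu hv h1 h2
  rw [eq_div_iff (mul_ne_zero two_ne_zero hne)]
  rw [show v - u = -(u - v) by ring, L.weierstrassZeta_neg, add_comm v u] at e2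
  linear_combination e1 - e2

/-- The duplication formula `σ(2v) = -℘'(v) σ(v)⁴`. -/
lemma weierstrassSigma_two_mul {v : ℂ} (hv : v ∉ L.lattice) :
    L.weierstrassSigma (2 * v) = -(L.derivWeierstrassP v * L.weierstrassSigma v ^ 4) := by
  have hσ0 : HasDerivAt L.weierstrassSigma 1 0 := by
    have h := (hasDerivAt_id (0 : ℂ)).mul (L.differentiable_sigmaProd 0).hasDerivAt
    refine (h.congr_deriv ?_).congr_of_eventuallyEq (.of_forall fun z => rfl)
    simp [L.sigmaProd_zero]
  have d0 : HasDerivAt (fun u => L.weierstrassSigma (u - v)) 1 v :=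
    HasDerivAt.comp_sub_const v v (by rwa [sub_self])
  have d1 := ((L.differentiable_weierstrassSigma (v + v)).hasDerivAt.comp_add_const v v).mul d0
  have d2 := ((((L.hasDerivAt_weierstrassSigma hv).pow 2).mul_const
    (L.weierstrassSigma v ^ 2)).mul ((L.hasDerivAt_weierstrassP hv).sub_const
      (L.weierstrassP v))).neg
  have h := d1.unique (d2.congr_of_eventuallyEq ?_)
  · simp [L.weierstrassSigma_zero] at h
    rw [two_mul, h]; ring
  · filter_upwards [L.isClosed_lattice.isOpen_compl.mem_nhds hv] with w hw
    simpa using L.weierstrassSigma_add_mul_sub hw hv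

lemma derivWeierstrassP_ne_zero {v : ℂ} (hv : 2 * v ∉ L.lattice) : L.derivWeierstrassP v ≠ 0 := by
  have hv' : v ∉ L.lattice := fun h => hv (by rw [two_mul]; exact add_mem h h)
  intro h
  have := L.weierstrassSigma_two_mul hv'
  rw [h, zero_mul, neg_zero] at this
  exact L.weierstrassSigma_ne_zero hv this

lemma derivWeierstrassP_eq_zero {v : ℂ} (hv : 2 * v ∈ L.lattice) : L.derivWeierstrassP v = 0 := by
  have h := L.derivWeierstrassP_sub_coe v ⟨_, hv⟩
  simp only [show v - 2 * v = -v by ring, L.derivWeierstrassP_neg] at h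
  have : (2 : ℂ) * L.derivWeierstrassP v = 0 := by linear_combination -h
  simpa using this

/-- The second derivative of `℘` is `6℘² - g₂/2`. -/
lemma hasDerivAt_derivWeierstrassP {z : ℂ} (hz : z ∉ L.lattice) :
    HasDerivAt L.derivWeierstrassP (6 * L.weierstrassP z ^ 2 - L.g₂ / 2) z := by
  have hopen := L.isClosed_lattice.isOpen_compl
  have hd : ∀ w ∉ L.lattice, HasDerivAt L.derivWeierstrassP (deriv L.derivWeierstrassP w) w :=
    fun w hw => (L.differentiableOn_derivWeierstrassP.differentiableAt
      (hopen.mem_nhds hw)).hasDerivAt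
  have key : ∀ w ∉ L.lattice, 2 * w ∉ L.lattice →
      deriv L.derivWeierstrassP w = 6 * L.weierstrassP w ^ 2 - L.g₂ / 2 := by
    intro w hw hw2
    have d1 := (hd w hw).pow 2
    have d2 := ((((L.hasDerivAt_weierstrassP hw).pow 3).const_mul 4).sub
      ((L.hasDerivAt_weierstrassP hw).const_mul L.g₂)).sub_const L.g₃
    have h := d1.unique (d2.congr_of_eventuallyEq ?_)
    · have hne := L.derivWeierstrassP_ne_zero hw2
      refine mul_left_cancel₀ (mul_ne_zero two_ne_zero hne) ?_
      norm_num at h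
      linear_combination h
    · filter_upwards [hopen.mem_nhds hw] with y hy
      simpa using L.derivWeierstrassP_sq y hy
  have h1 : Tendsto (deriv L.derivWeierstrassP) (𝓝[≠] z) (𝓝 (deriv L.derivWeierstrassP z)) :=
    ((L.analyticOnNhd_derivWeierstrassP z hz).deriv.continuousAt).tendsto.mono_left
      nhdsWithin_le_nhds
  have hP := ((L.hasDerivAt_weierstrassP hz).continuousAt.tendsto.mono_left
    (nhdsWithin_le_nhds (s := {z}ᶜ)))
  have h2 : Tendsto (fun w => 6 * L.weierstrassP w ^ 2 - L.g₂ / 2) (𝓝[≠] z)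
      (𝓝 (6 * L.weierstrassP z ^ 2 - L.g₂ / 2)) := ((hP.pow 2).const_mul 6).sub_const _
  have h3 : deriv L.derivWeierstrassP z = 6 * L.weierstrassP z ^ 2 - L.g₂ / 2 := by
    refine tendsto_nhds_unique (h1.congr' ?_) h2
    have e1 : ∀ᶠ w in 𝓝[≠] z, w ∉ L.lattice := L.eventually_notMem_lattice z
    have e2 : ∀ᶠ w in 𝓝[≠] z, 2 * w ∉ L.lattice := by
      have ht : Tendsto (fun w : ℂ => 2 * w) (𝓝[≠] z) (𝓝[≠] (2 * z)) := by
        refine tendsto_nhdsWithin_iff.mpr ⟨?_, ?_⟩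
        · exact ((continuous_const_mul 2).tendsto z).mono_left nhdsWithin_le_nhds
        · filter_upwards [self_mem_nhdsWithin] with w hw
          simpa using hw
      exact ht.eventually (L.eventually_notMem_lattice (2 * z))
    filter_upwards [e1, e2] with w hw hw2 using key w hw hw2
  rw [← h3]
  exact hd z hz

end PeriodPair

/-! ### Homothetic lattices and rectangular lattices -/

namespace PeriodPair

open Filter Topology

section Homothety

variable {L L' : PeriodPair} {c : ℂ}

/-- Multiplication by `c` as a bijection of a lattice onto a homothetic one. -/
noncomputable def homothetyEquiv (hc : c ≠ 0) (h : ∀ z, c * z ∈ L'.lattice ↔ z ∈ L.lattice) :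
    L.lattice ≃ L'.lattice where
  toFun l := ⟨c * l, (h l).mpr l.2⟩
  invFun l := ⟨c⁻¹ * l, (h _).mp (by rw [mul_inv_cancel_left₀ hc]; exact l.2)⟩
  left_inv l := by ext; simp [hc]
  right_inv l := by ext; simp [hc]

lemma G_homothety (hc : c ≠ 0) (h : ∀ z, c * z ∈ L'.lattice ↔ z ∈ L.lattice) (n : ℕ) :
    L'.G n = (c ^ n)⁻¹ * L.G n := by
  unfold G
  rw [← (homothetyEquiv hc h).tsum_eq, ← tsum_mul_left]
  congr 1; ext l
  simp [homothetyEquiv, mul_pow, mul_comm]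

lemma g₂_homothety (hc : c ≠ 0) (h : ∀ z, c * z ∈ L'.lattice ↔ z ∈ L.lattice) :
    L'.g₂ = (c ^ 4)⁻¹ * L.g₂ := by
  rw [g₂, g₂, G_homothety hc h]; ring

lemma g₃_homothety (hc : c ≠ 0) (h : ∀ z, c * z ∈ L'.lattice ↔ z ∈ L.lattice) :
    L'.g₃ = (c ^ 6)⁻¹ * L.g₃ := by
  rw [g₃, g₃, G_homothety hc h]; ring

lemma weierstrassP_homothety (hc : c ≠ 0) (h : ∀ z, c * z ∈ L'.lattice ↔ z ∈ L.lattice) (z : ℂ) :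
    L'.weierstrassP (c * z) = (c ^ 2)⁻¹ * L.weierstrassP z := by
  unfold weierstrassP
  rw [← (homothetyEquiv hc h).tsum_eq, ← tsum_mul_left]
  congr 1; ext l
  simp only [homothetyEquiv, Equiv.coe_fn_mk, ← mul_sub, mul_pow, one_div, mul_inv]

end Homothety

/-- The pair of periods `2p` and `2qi`, which spans a rectangular lattice. -/
noncomputable def rect (p q : ℝ) (hp : 0 < p) (hq : 0 < q) : PeriodPair where
  ω₁ := 2 * p
  ω₂ := 2 * q * Complex.I
  indep := by
    rw [LinearIndependent.pair_iff]
    intro s t h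
    have h1 := congrArg Complex.re h
    have h2 := congrArg Complex.im h
    simp at h1 h2
    exact ⟨h1.resolve_right hp.ne', h2.resolve_right hq.ne'⟩

section Rect

variable {p q : ℝ} (hp : 0 < p) (hq : 0 < q)

lemma mem_rect_lattice {z : ℂ} : z ∈ (rect p q hp hq).lattice ↔
    ∃ m n : ℤ, z.re = 2 * p * m ∧ z.im = 2 * q * n := by
  rw [mem_lattice]
  refine exists_congr fun m => exists_congr fun n => ?_
  rw [Complex.ext_iff]
  simp [rect]
  constructor <;> rintro ⟨h1, h2⟩ <;> constructor <;> linarith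

lemma rect_swap {z : ℂ} :
    Complex.I * z ∈ (rect q p hq hp).lattice ↔ z ∈ (rect p q hp hq).lattice := by
  simp only [mem_rect_lattice, Complex.mul_re, Complex.mul_im, Complex.I_re, Complex.I_im]
  constructor
  · rintro ⟨m, n, h1, h2⟩
    exact ⟨n, -m, by linarith, by push_cast; linarith⟩
  · rintro ⟨m, n, h1, h2⟩
    exact ⟨-n, m, by push_cast; linarith, by linarith⟩

lemma rect_smul {c : ℝ} (hc : 0 < c) {z : ℂ} :
    (c : ℂ) * z ∈ (rect (c * p) (c * q) (mul_pos hc hp) (mul_pos hc hq)).lattice ↔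
      z ∈ (rect p q hp hq).lattice := by
  simp only [mem_rect_lattice, Complex.re_ofReal_mul, Complex.im_ofReal_mul]
  refine exists_congr fun m => exists_congr fun n => ?_
  have := hc.ne'
  refine and_congr ⟨fun h => ?_, fun h => ?_⟩ ⟨fun h => ?_, fun h => ?_⟩
  · exact mul_left_cancel₀ this (by linarith)
  · rw [h]; ring
  · exact mul_left_cancel₀ this (by linarith)
  · rw [h]; ring

lemma conj_mem_rect_lattice {z : ℂ} :
    conj z ∈ (rect p q hp hq).lattice ↔ z ∈ (rect p q hp hq).lattice := by
  simp only [mem_rect_lattice, Complex.conj_re, Complex.conj_im]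
  constructor
  · rintro ⟨m, n, h1, h2⟩
    exact ⟨m, -n, h1, by push_cast; linarith⟩
  · rintro ⟨m, n, h1, h2⟩
    exact ⟨m, -n, h1, by push_cast; linarith⟩

/-- Complex conjugation as a bijection of a rectangular lattice. -/
noncomputable def rectConjEquiv : (rect p q hp hq).lattice ≃ (rect p q hp hq).lattice where
  toFun l := ⟨conj (l : ℂ), (conj_mem_rect_lattice hp hq).mpr l.2⟩
  invFun l := ⟨conj (l : ℂ), (conj_mem_rect_lattice hp hq).mpr l.2⟩
  left_inv l := by ext; simp
  right_inv l := by ext; simp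

lemma conj_weierstrassP_rect (z : ℂ) :
    conj ((rect p q hp hq).weierstrassP z) = (rect p q hp hq).weierstrassP (conj z) := by
  unfold weierstrassP
  rw [Complex.conj_tsum, ← (rectConjEquiv hp hq).tsum_eq]
  congr 1; ext l
  simp [rectConjEquiv]

lemma conj_derivWeierstrassP_rect (z : ℂ) :
    conj ((rect p q hp hq).derivWeierstrassP z) =
      (rect p q hp hq).derivWeierstrassP (conj z) := by
  unfold derivWeierstrassP
  rw [map_neg, Complex.conj_tsum, ← (rectConjEquiv hp hq).tsum_eq]
  congr 2; ext l
  simp [rectConjEquiv, Complex.conj_ofNat]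

lemma conj_G_rect (n : ℕ) : conj ((rect p q hp hq).G n) = (rect p q hp hq).G n := by
  unfold G
  rw [Complex.conj_tsum, ← (rectConjEquiv hp hq).tsum_eq]
  congr 1; ext l
  simp [rectConjEquiv]

lemma g₂_rect_im : (rect p q hp hq).g₂.im = 0 := by
  rw [← Complex.conj_eq_iff_im, g₂, map_mul, conj_G_rect, Complex.conj_ofNat]

lemma g₃_rect_im : (rect p q hp hq).g₃.im = 0 := by
  rw [← Complex.conj_eq_iff_im, g₃, map_mul, conj_G_rect, Complex.conj_ofNat]

lemma two_p_mem_rect : (2 * p : ℂ) ∈ (rect p q hp hq).lattice :=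
  (mem_rect_lattice hp hq).mpr ⟨1, 0, by simp, by simp⟩

lemma two_q_mem_rect : (2 * q * Complex.I : ℂ) ∈ (rect p q hp hq).lattice :=
  (mem_rect_lattice hp hq).mpr ⟨0, 1, by simp, by simp⟩

/-- `℘` is real at points that are congruent to their conjugate or to its opposite. -/
lemma weierstrassP_rect_im {z : ℂ}
    (h : conj z - z ∈ (rect p q hp hq).lattice ∨ conj z + z ∈ (rect p q hp hq).lattice) :
    ((rect p q hp hq).weierstrassP z).im = 0 := by
  rw [← Complex.conj_eq_iff_im, conj_weierstrassP_rect]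
  rcases h with h | h
  · have := (rect p q hp hq).weierstrassP_add_coe z ⟨_, h⟩
    simpa using this
  · have := (rect p q hp hq).weierstrassP_add_coe (-z) ⟨_, h⟩
    rw [weierstrassP_neg] at this
    rw [← this]; congr 1; simp

lemma weierstrassP_rect_real_im (x : ℝ) : ((rect p q hp hq).weierstrassP x).im = 0 :=
  weierstrassP_rect_im hp hq (.inl (by simp))

lemma weierstrassP_rect_shift_im (x : ℝ) :
    ((rect p q hp hq).weierstrassP (x + q * Complex.I)).im = 0 :=
  weierstrassP_rect_im hp hq (.inl ((mem_rect_lattice hp hq).mpr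
    ⟨0, -1, by simp, by simp; ring⟩))

lemma weierstrassP_rect_side_im (y : ℝ) :
    ((rect p q hp hq).weierstrassP (p + y * Complex.I)).im = 0 :=
  weierstrassP_rect_im hp hq (.inr ((mem_rect_lattice hp hq).mpr
    ⟨1, 0, by simp; ring, by simp⟩))

lemma derivWeierstrassP_rect_im {z : ℂ} (h : conj z - z ∈ (rect p q hp hq).lattice) :
    ((rect p q hp hq).derivWeierstrassP z).im = 0 := by
  rw [← Complex.conj_eq_iff_im, conj_derivWeierstrassP_rect]
  have := (rect p q hp hq).derivWeierstrassP_add_coe z ⟨_, h⟩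
  simpa using this

lemma derivWeierstrassP_rect_shift_im (x : ℝ) :
    ((rect p q hp hq).derivWeierstrassP (x + q * Complex.I)).im = 0 :=
  derivWeierstrassP_rect_im hp hq ((mem_rect_lattice hp hq).mpr ⟨0, -1, by simp, by simp; ring⟩)

lemma shift_notMem_rect (x : ℝ) : (x + q * Complex.I : ℂ) ∉ (rect p q hp hq).lattice := by
  rw [mem_rect_lattice]
  rintro ⟨m, n, -, h⟩
  simp at h
  have h1 : (1 : ℝ) = 2 * n := mul_left_cancel₀ hq.ne' (by linarith)
  have : (1 : ℤ) = 2 * n := by exact_mod_cast h1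
  omega

lemma side_notMem_rect (y : ℝ) : (p + y * Complex.I : ℂ) ∉ (rect p q hp hq).lattice := by
  rw [mem_rect_lattice]
  rintro ⟨m, n, h, -⟩
  simp at h
  have h1 : (1 : ℝ) = 2 * m := mul_left_cancel₀ hp.ne' (by linarith)
  have : (1 : ℤ) = 2 * m := by exact_mod_cast h1
  omega

lemma real_mem_rect {x : ℝ} : (x : ℂ) ∈ (rect p q hp hq).lattice ↔ ∃ m : ℤ, x = 2 * p * m := by
  rw [mem_rect_lattice]
  simp only [Complex.ofReal_re, Complex.ofReal_im]
  exact ⟨fun ⟨m, _, h, _⟩ => ⟨m, h⟩, fun ⟨m, h⟩ => ⟨m, 0, h, by simp⟩⟩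

lemma real_notMem_rect {x : ℝ} (h0 : 0 < x) (h1 : x < 2 * p) :
    (x : ℂ) ∉ (rect p q hp hq).lattice := by
  rw [real_mem_rect]
  rintro ⟨m, rfl⟩
  have h2 : (0 : ℝ) < m := by
    by_contra! h; nlinarith
  have h3 : (m : ℝ) < 1 := by
    by_contra! h; nlinarith
  have h2' : 0 < m := by exact_mod_cast h2
  have h3' : m < 1 := by exact_mod_cast h3
  omega

/-- The restriction of `℘` to the real axis. -/
noncomputable def rectReal (p q : ℝ) (hp : 0 < p) (hq : 0 < q) (x : ℝ) : ℝ :=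
  ((rect p q hp hq).weierstrassP x).re

lemma ofReal_rectReal (x : ℝ) :
    (rectReal p q hp hq x : ℂ) = (rect p q hp hq).weierstrassP x :=
  Complex.ext rfl (weierstrassP_rect_real_im hp hq x).symm

lemma hasDerivAt_rectReal {x : ℝ} (h0 : 0 < x) (h1 : x < 2 * p) :
    HasDerivAt (rectReal p q hp hq) ((rect p q hp hq).derivWeierstrassP x).re x :=
  ((rect p q hp hq).hasDerivAt_weierstrassP (real_notMem_rect hp hq h0 h1)).real_of_complex

lemma injOn_rectReal : Set.InjOn (rectReal p q hp hq) (Set.Ioc 0 p) := by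
  intro x hx y hy h
  have h' : (rect p q hp hq).weierstrassP x = (rect p q hp hq).weierstrassP y := by
    rw [← ofReal_rectReal, ← ofReal_rectReal, h]
  have hx1 := hx.1; have hx2 := hx.2; have hy1 := hy.1; have hy2 := hy.2
  rcases (rect p q hp hq).add_mem_or_sub_mem_of_weierstrassP_eq
    (real_notMem_rect hp hq hx1 (by linarith)) (real_notMem_rect hp hq hy1 (by linarith)) h'
    with h | h
  · by_contra hne
    refine real_notMem_rect hp hq (x := x + y) (by linarith) ?_ (by push_cast; exact h)
    rcases lt_or_gt_of_ne hne with h | h <;> linarith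
  · by_contra hne
    rcases lt_or_gt_of_ne hne with h2 | h2
    · refine real_notMem_rect hp hq (x := y - x) (by linarith) (by linarith) ?_
      push_cast; simpa using neg_mem h
    · refine real_notMem_rect hp hq (x := x - y) (by linarith) (by linarith) ?_
      push_cast; exact h

lemma tendsto_rectReal : Tendsto (rectReal p q hp hq) (𝓝[>] 0) atTop := by
  set L := rect p q hp hq with hL
  have hc : ContinuousAt (L.weierstrassPExcept 0) 0 :=
    (L.analyticAt_weierstrassPExcept 0).continuousAt
  have h1 : Tendsto (fun x : ℝ => (L.weierstrassPExcept 0 x).re) (𝓝[>] 0)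
      (𝓝 (L.weierstrassPExcept 0 0).re) := by
    have h2 : ContinuousAt (fun x : ℝ => (L.weierstrassPExcept 0 x).re) 0 := by
      refine Complex.continuous_re.continuousAt.comp (ContinuousAt.comp' (f := Complex.ofReal) ?_
        Complex.continuous_ofReal.continuousAt)
      simpa using hc
    simpa using h2.tendsto.mono_left nhdsWithin_le_nhds
  have h3 : Tendsto (fun x : ℝ => (x ^ 2)⁻¹) (𝓝[>] 0) atTop := by
    have := (tendsto_inv_nhdsGT_zero (𝕜 := ℝ)).comp (f := fun x : ℝ => x ^ 2) (x := 𝓝[>] 0) ?_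
    · exact this
    · refine tendsto_nhdsWithin_iff.mpr ⟨?_, ?_⟩
      · have : Tendsto (fun x : ℝ => x ^ 2) (𝓝 0) (𝓝 (0 ^ 2)) := (continuous_pow 2).tendsto 0
        simpa using this.mono_left nhdsWithin_le_nhds
      · filter_upwards [self_mem_nhdsWithin] with x hx
        exact pow_pos (Set.mem_Ioi.mp hx) 2
  refine (h1.add_atTop h3).congr fun x => ?_
  have := L.weierstrassPExcept_add (0 : L.lattice) x
  simp only [ZeroMemClass.coe_zero, sub_zero, ne_eq, OfNat.ofNat_ne_zero, not_false_eq_true,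
      zero_pow, div_zero] at this
  rw [rectReal, ← hL, ← this, Complex.add_re]
  congr 1
  rw [← Complex.ofReal_pow, ← Complex.ofReal_one, ← Complex.ofReal_div, Complex.ofReal_re, one_div]

lemma continuousOn_rectReal : ContinuousOn (rectReal p q hp hq) (Set.Ioc 0 p) := fun x hx =>
  (hasDerivAt_rectReal hp hq hx.1 (by linarith [hx.2])).continuousAt.continuousWithinAt

lemma exists_rectReal_eq {y : ℝ} (hy : rectReal p q hp hq p ≤ y) :
    ∃ x ∈ Set.Ioc 0 p, rectReal p q hp hq x = y := by
  obtain ⟨x₀, h1, h2⟩ := (((tendsto_rectReal hp hq).eventually_ge_atTop y).and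
    (Ioo_mem_nhdsGT hp)).exists
  have hc : ContinuousOn (rectReal p q hp hq) (Set.Icc x₀ p) :=
    (continuousOn_rectReal hp hq).mono fun x hx => ⟨h2.1.trans_le hx.1, hx.2⟩
  obtain ⟨x, hx, hxy⟩ := intermediate_value_Icc' h2.2.le hc ⟨hy, h1⟩
  exact ⟨x, ⟨h2.1.trans_le hx.1, hx.2⟩, hxy⟩

lemma image_rectReal :
    rectReal p q hp hq '' Set.Ioo 0 p = Set.Ioi (rectReal p q hp hq p) := by
  have hpm : p ∈ Set.Ioc 0 p := ⟨hp, le_rfl⟩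
  ext y
  constructor
  · rintro ⟨x, hx, rfl⟩
    by_contra! hle
    rw [Set.mem_Ioi, not_lt] at hle
    obtain ⟨x₀, h1, h2⟩ := (((tendsto_rectReal hp hq).eventually_ge_atTop
      (rectReal p q hp hq p)).and (Ioo_mem_nhdsGT hx.1)).exists
    have hc : ContinuousOn (rectReal p q hp hq) (Set.Icc x₀ x) :=
      (continuousOn_rectReal hp hq).mono fun z hz => ⟨h2.1.trans_le hz.1, hz.2.trans hx.2.le⟩
    obtain ⟨z, hz, hzy⟩ := intermediate_value_Icc' h2.2.le hc ⟨hle, h1⟩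
    have := injOn_rectReal hp hq ⟨h2.1.trans_le hz.1, hz.2.trans hx.2.le⟩ hpm hzy
    linarith [hz.2, hx.2]
  · intro hy
    obtain ⟨x, hx, rfl⟩ := exists_rectReal_eq hp hq (le_of_lt hy)
    refine ⟨x, ⟨hx.1, lt_of_le_of_ne hx.2 ?_⟩, rfl⟩
    rintro rfl
    exact lt_irrefl _ (Set.mem_Ioi.mp hy)

lemma derivWeierstrassP_rect_real_sq {x : ℝ} (h0 : 0 < x) (h1 : x < 2 * p) :
    ((rect p q hp hq).derivWeierstrassP x).re ^ 2 = 4 * rectReal p q hp hq x ^ 3 -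
      (rect p q hp hq).g₂.re * rectReal p q hp hq x - (rect p q hp hq).g₃.re := by
  have h := (rect p q hp hq).derivWeierstrassP_sq x (real_notMem_rect hp hq h0 h1)
  have e1 : (rect p q hp hq).derivWeierstrassP x =
      (((rect p q hp hq).derivWeierstrassP x).re : ℂ) :=
    Complex.ext rfl (derivWeierstrassP_rect_im hp hq (by simp))
  have e2 : (rect p q hp hq).g₂ = ((rect p q hp hq).g₂.re : ℂ) :=
    Complex.ext rfl (g₂_rect_im hp hq)
  have e3 : (rect p q hp hq).g₃ = ((rect p q hp hq).g₃.re : ℂ) :=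
    Complex.ext rfl (g₃_rect_im hp hq)
  rw [e1, e2, e3, ← ofReal_rectReal] at h
  exact_mod_cast h

/-- The real half-period of a rectangular lattice as a complete elliptic integral, by the
substitution `Y = ℘(x)`. -/
lemma rect_halfPeriod_eq_integral :
    ∫ Y in Set.Ioi (rectReal p q hp hq p), 1 / √(4 * Y ^ 3 - (rect p q hp hq).g₂.re * Y -
      (rect p q hp hq).g₃.re) = p := by
  rw [← image_rectReal hp hq, MeasureTheory.integral_image_eq_integral_abs_deriv_smul
    measurableSet_Ioo (fun x hx => (hasDerivAt_rectReal hp hq hx.1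
      (by linarith [hx.2, hp])).hasDerivWithinAt)
    ((injOn_rectReal hp hq).mono Set.Ioo_subset_Ioc_self)]
  have : ∀ x ∈ Set.Ioo 0 p, |((rect p q hp hq).derivWeierstrassP x).re| •
      (1 / √(4 * rectReal p q hp hq x ^ 3 - (rect p q hp hq).g₂.re * rectReal p q hp hq x -
        (rect p q hp hq).g₃.re)) = 1 := by
    intro x hx
    have h1 := hx.1
    have h2 := hx.2
    rw [← derivWeierstrassP_rect_real_sq hp hq h1 (by linarith), Real.sqrt_sq_eq_abs, smul_eq_mul,
      mul_one_div_cancel]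
    rw [Ne, abs_eq_zero]
    intro h
    refine (rect p q hp hq).derivWeierstrassP_ne_zero (v := x) ?_ (Complex.ext h
      (derivWeierstrassP_rect_im hp hq (by simp)))
    have := real_notMem_rect hp hq (x := 2 * x) (by linarith) (by linarith)
    simpa using this
  rw [MeasureTheory.setIntegral_congr_fun measurableSet_Ioo this]
  simp [hp.le]

/-! The three roots of the cubic are the values of `℘` at the half-periods. -/

lemma two_side_mem_rect : 2 * (p + q * Complex.I : ℂ) ∈ (rect p q hp hq).lattice :=
  (mem_rect_lattice hp hq).mpr ⟨1, 1, by simp, by simp⟩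

/-- A real value of `℘` at a point that is not congruent to a real one is smaller than `℘(p)`,
because all larger numbers are values on the real axis. -/
lemma weierstrassP_rect_lt {z : ℂ} (hz : z ∉ (rect p q hp hq).lattice)
    (hz0 : ((rect p q hp hq).weierstrassP z).im = 0) (him : ¬ ∃ n : ℤ, z.im = 2 * q * n) :
    ((rect p q hp hq).weierstrassP z).re < rectReal p q hp hq p := by
  by_contra! hle
  obtain ⟨x, hx, h⟩ := exists_rectReal_eq hp hq hle
  have h' : (rect p q hp hq).weierstrassP z = (rect p q hp hq).weierstrassP x := by
    rw [← ofReal_rectReal, h]; exact Complex.ext rfl hz0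
  rcases (rect p q hp hq).add_mem_or_sub_mem_of_weierstrassP_eq hz
    (real_notMem_rect hp hq hx.1 (by linarith [hx.2, hp])) h' with h | h <;>
  · obtain ⟨m, n, -, h⟩ := (mem_rect_lattice hp hq).mp h
    exact him ⟨n, by simpa using h⟩

lemma half_ne_int (n : ℤ) : q ≠ 2 * q * n ∨ q = 0 := by
  by_cases h : q = 0
  · exact .inr h
  · left
    intro e
    have h1 : (1 : ℝ) = 2 * n := mul_left_cancel₀ h (by linarith)
    have : (1 : ℤ) = 2 * n := by exact_mod_cast h1
    omega

/-- `℘` on the imaginary axis is `-℘` of the lattice turned by a quarter on the real axis. -/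
lemma weierstrassP_rect_mul_I (z : ℂ) :
    (rect p q hp hq).weierstrassP (Complex.I * z) = -(rect q p hq hp).weierstrassP z := by
  rw [weierstrassP_homothety Complex.I_ne_zero (fun z => rect_swap hq hp)]
  simp

lemma g₂_rect_swap : (rect q p hq hp).g₂ = (rect p q hp hq).g₂ := by
  rw [g₂_homothety Complex.I_ne_zero (fun z => rect_swap hp hq)]; simp

lemma g₃_rect_swap : (rect q p hq hp).g₃ = -(rect p q hp hq).g₃ := by
  rw [g₃_homothety Complex.I_ne_zero (fun z => rect_swap hp hq)]
  rw [show Complex.I ^ 6 = -1 by rw [show 6 = 2 * 3 by rfl, pow_mul, Complex.I_sq]; norm_num]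
  norm_num

/-- The value of `℘` at the half-period that is not on the axes. -/
noncomputable def rectMid (p q : ℝ) (hp : 0 < p) (hq : 0 < q) : ℝ :=
  ((rect p q hp hq).weierstrassP (p + q * Complex.I)).re

lemma ofReal_rectMid : (rectMid p q hp hq : ℂ) =
    (rect p q hp hq).weierstrassP (p + q * Complex.I) :=
  Complex.ext rfl (weierstrassP_rect_shift_im hp hq p).symm

lemma rectMid_lt : rectMid p q hp hq < rectReal p q hp hq p := by
  refine weierstrassP_rect_lt hp hq (shift_notMem_rect hp hq p)
    (weierstrassP_rect_shift_im hp hq p) ?_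
  rintro ⟨n, h⟩
  simp at h
  rcases half_ne_int (q := q) n with h' | h'
  · exact h' h
  · exact hq.ne' h'

lemma rectMid_swap : rectMid q p hq hp = -rectMid p q hp hq := by
  have h := weierstrassP_rect_mul_I hq hp (p + q * Complex.I)
  have e : Complex.I * (p + q * Complex.I) = (q + p * Complex.I) + -(2 * q) := by
    ring_nf; rw [Complex.I_sq]; ring
  have h2 := (rect q p hq hp).weierstrassP_add_coe (q + p * Complex.I)
    ⟨-(2 * q), neg_mem (two_p_mem_rect hq hp)⟩
  simp only at h2
  rw [e, h2] at h
  rw [rectMid, h, Complex.neg_re, rectMid]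

lemma neg_rectReal_swap_lt : -rectReal q p hq hp q < rectMid p q hp hq := by
  have := rectMid_lt hq hp
  rw [rectMid_swap hp hq] at this
  linarith

lemma weierstrassP_rect_im_axis (y : ℝ) :
    (rect p q hp hq).weierstrassP (y * Complex.I) = ((-rectReal q p hq hp y : ℝ) : ℂ) := by
  rw [mul_comm, weierstrassP_rect_mul_I, Complex.ofReal_neg, ofReal_rectReal]

lemma rect_cubic_root {z : ℂ} (hz : z ∉ (rect p q hp hq).lattice)
    (h2 : 2 * z ∈ (rect p q hp hq).lattice) {e : ℝ}
    (he : (rect p q hp hq).weierstrassP z = e) :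
    4 * e ^ 3 - (rect p q hp hq).g₂.re * e - (rect p q hp hq).g₃.re = 0 := by
  have h := (rect p q hp hq).derivWeierstrassP_sq z hz
  rw [(rect p q hp hq).derivWeierstrassP_eq_zero h2, he] at h
  have e2 : (rect p q hp hq).g₂ = ((rect p q hp hq).g₂.re : ℂ) :=
    Complex.ext rfl (g₂_rect_im hp hq)
  have e3 : (rect p q hp hq).g₃ = ((rect p q hp hq).g₃.re : ℂ) :=
    Complex.ext rfl (g₃_rect_im hp hq)
  rw [e2, e3] at h
  have h' : (0 : ℝ) ^ 2 = 4 * e ^ 3 - (rect p q hp hq).g₂.re * e - (rect p q hp hq).g₃.re := by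
    exact_mod_cast h
  linarith

lemma cubic_eq_of_roots {c₂ c₃ x y z : ℝ} (hxy : x ≠ y) (hxz : x ≠ z) (hyz : y ≠ z)
    (hx : 4 * x ^ 3 - c₂ * x - c₃ = 0) (hy : 4 * y ^ 3 - c₂ * y - c₃ = 0)
    (hz : 4 * z ^ 3 - c₂ * z - c₃ = 0) :
    x + y + z = 0 ∧ c₂ = -4 * (x * y + x * z + y * z) ∧ c₃ = 4 * x * y * z := by
  have h1 : 4 * (x ^ 2 + x * y + y ^ 2) = c₂ :=
    mul_left_cancel₀ (sub_ne_zero.mpr hxy) (by linear_combination hx - hy)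
  have h2 : 4 * (x ^ 2 + x * z + z ^ 2) = c₂ :=
    mul_left_cancel₀ (sub_ne_zero.mpr hxz) (by linear_combination hx - hz)
  have h3 : x + y + z = 0 :=
    mul_left_cancel₀ (sub_ne_zero.mpr hyz) (by linear_combination (h1 - h2) / 4)
  obtain rfl : z = -x - y := by linarith
  refine ⟨by ring, by rw [← h1]; ring, by linear_combination -hx + x * h1⟩

/-- The relations between the invariants and the values of `℘` at the three half-periods. -/
lemma rect_cubic : rectReal p q hp hq p + rectMid p q hp hq + -rectReal q p hq hp q = 0 ∧
    (rect p q hp hq).g₂.re = -4 * (rectReal p q hp hq p * rectMid p q hp hq +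
      rectReal p q hp hq p * -rectReal q p hq hp q +
      rectMid p q hp hq * -rectReal q p hq hp q) ∧
    (rect p q hp hq).g₃.re = 4 * rectReal p q hp hq p * rectMid p q hp hq *
      -rectReal q p hq hp q := by
  have h1 := rectMid_lt hp hq
  have h2 := neg_rectReal_swap_lt hp hq
  refine cubic_eq_of_roots (by linarith) (by linarith) (by linarith) ?_ ?_ ?_
  · refine rect_cubic_root hp hq (z := p) ?_ (two_p_mem_rect hp hq) (ofReal_rectReal hp hq p).symm
    simpa using side_notMem_rect hp hq 0
  · exact rect_cubic_root hp hq (shift_notMem_rect hp hq p) (two_side_mem_rect hp hq)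
      (ofReal_rectMid hp hq).symm
  · refine rect_cubic_root hp hq (z := q * Complex.I) ?_ ?_ (weierstrassP_rect_im_axis hp hq q)
    · simpa using shift_notMem_rect hp hq 0
    · rw [← mul_assoc]; exact two_q_mem_rect hp hq

lemma rect_discr_pos :
    27 * (rect p q hp hq).g₃.re ^ 2 < (rect p q hp hq).g₂.re ^ 3 := by
  obtain ⟨h0, h2, h3⟩ := rect_cubic hp hq
  have h4 := rectMid_lt hp hq
  have h5 := neg_rectReal_swap_lt hp hq
  generalize rectReal p q hp hq p = x at *
  generalize rectMid p q hp hq = y at *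
  generalize -rectReal q p hq hp q = z at *
  rw [h2, h3]
  obtain rfl : z = -x - y := by linarith
  have : 0 < 16 * ((x - y) * (x - (-x - y)) * (y - (-x - y))) ^ 2 := by
    have a1 : 0 < x - y := by linarith
    have a2 : 0 < x - (-x - y) := by linarith
    have a3 : 0 < y - (-x - y) := by linarith
    positivity
  linear_combination this

lemma continuous_rect_shift :
    Continuous fun x : ℝ => ((rect p q hp hq).weierstrassP (x + q * Complex.I)).re := by
  refine Complex.continuous_re.comp (continuous_iff_continuousAt.mpr fun x => ?_)
  exact ContinuousAt.comp (f := fun x : ℝ => (x + q * Complex.I : ℂ))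
    ((rect p q hp hq).hasDerivAt_weierstrassP (shift_notMem_rect hp hq x)).continuousAt
    (by fun_prop)

/-- On the line through the imaginary half-period, `℘` takes all values between its two smaller
real branch values. -/
lemma exists_weierstrassP_rect_shift {r : ℝ} (h1 : -rectReal q p hq hp q ≤ r)
    (h2 : r ≤ rectMid p q hp hq) :
    ∃ x : ℝ, (rect p q hp hq).weierstrassP (x + q * Complex.I) = r := by
  have h := intermediate_value_Icc hp.le (continuous_rect_shift hp hq).continuousOn
  have e0 : ((rect p q hp hq).weierstrassP ((0 : ℝ) + q * Complex.I)).re =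
      -rectReal q p hq hp q := by
    rw [Complex.ofReal_zero, zero_add, weierstrassP_rect_im_axis, Complex.ofReal_re]
  obtain ⟨x, -, hx⟩ := h ⟨(by simpa only [e0] using h1), h2⟩
  exact ⟨x, Complex.ext hx (weierstrassP_rect_shift_im hp hq x)⟩

/-- `℘` takes every real value on the boundary of the rectangle of half-periods: on each of its four
sides one of the intervals between the real branch values and infinity. -/
lemma exists_weierstrassP_rect_eq (r : ℝ) :
    ∃ z ∉ (rect p q hp hq).lattice, (rect p q hp hq).weierstrassP z = r := by
  rcases le_total (rectReal p q hp hq p) r with h1 | h1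
  · obtain ⟨x, hx, h⟩ := exists_rectReal_eq hp hq h1
    exact ⟨x, real_notMem_rect hp hq hx.1 (by linarith [hx.2, hp]), by
      rw [← ofReal_rectReal, h]⟩
  rcases le_total r (-rectReal q p hq hp q) with h3 | h3
  · obtain ⟨y, hy, h⟩ := exists_rectReal_eq hq hp (y := -r) (by linarith)
    refine ⟨y * Complex.I, ?_, by rw [weierstrassP_rect_im_axis, h, neg_neg]⟩
    rw [mul_comm, rect_swap hq hp]
    exact real_notMem_rect hq hp hy.1 (by linarith [hy.2, hq])
  rcases le_total r (rectMid p q hp hq) with h2 | h2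
  · obtain ⟨x, hx⟩ := exists_weierstrassP_rect_shift hp hq h3 h2
    exact ⟨_, shift_notMem_rect hp hq x, hx⟩
  · have hc : Continuous
        fun y : ℝ => ((rect p q hp hq).weierstrassP (p + y * Complex.I)).re := by
      refine Complex.continuous_re.comp (continuous_iff_continuousAt.mpr fun y => ?_)
      exact ContinuousAt.comp (f := fun y : ℝ => (p + y * Complex.I : ℂ))
        ((rect p q hp hq).hasDerivAt_weierstrassP (side_notMem_rect hp hq y)).continuousAt
        (by fun_prop)
    have h := intermediate_value_Icc' hq.le hc.continuousOn
    have e0 : ((rect p q hp hq).weierstrassP (p + (0 : ℝ) * Complex.I)).re =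
        rectReal p q hp hq p := by
      rw [Complex.ofReal_zero, zero_mul, add_zero]; rfl
    obtain ⟨y, -, hy⟩ := h ⟨h2, by simpa only [e0] using h1⟩
    exact ⟨_, side_notMem_rect hp hq y, Complex.ext hy (weierstrassP_rect_side_im hp hq y)⟩

end Rect

end PeriodPair

/-! ### Rectangular lattices with prescribed invariants -/

namespace PeriodPair

open Filter Topology

/-- The summand of the Eisenstein series of weight `k` of the lattice `2ℤ + 2tiℤ`. The origin
contributes `0⁻¹ = 0`. -/
noncomputable def eisTerm (k : ℕ) (t : ℝ) (x : ℤ × ℤ) : ℂ :=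
  ((x.1 * 2 + x.2 * (2 * t * Complex.I)) ^ k)⁻¹

lemma G_rect_one (k : ℕ) {t : ℝ} (ht : 0 < t) :
    (rect 1 t one_pos ht).G k = ∑' x : ℤ × ℤ, eisTerm k t x := by
  unfold G
  rw [← (rect 1 t one_pos ht).latticeEquivProd.symm.toEquiv.tsum_eq]
  congr 1; ext x
  have := (rect 1 t one_pos ht).latticeEquiv_symm_apply x
  simp only [LinearEquiv.coe_toEquiv]
  rw [this, eisTerm]
  simp [rect]

lemma summable_norm_eisTerm {k : ℕ} (hk : 2 < k) : Summable fun x => ‖eisTerm k 1 x‖ := by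
  have h := ((rect 1 1 one_pos one_pos).hasSum_sumInvPow 0 hk).summable
  rw [← (rect 1 1 one_pos one_pos).latticeEquivProd.symm.toEquiv.summable_iff] at h
  refine h.norm.congr fun x => ?_
  have := (rect 1 1 one_pos one_pos).latticeEquiv_symm_apply x
  simp only [Function.comp, LinearEquiv.coe_toEquiv]
  rw [this, eisTerm, sub_zero]
  simp [rect]

lemma normSq_eisBase (t : ℝ) (x : ℤ × ℤ) :
    ‖(x.1 * 2 + x.2 * (2 * t * Complex.I) : ℂ)‖ ^ 2 =
      4 * ((x.1 : ℝ) ^ 2 + t ^ 2 * (x.2 : ℝ) ^ 2) := by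
  rw [← Complex.normSq_eq_norm_sq, Complex.normSq_apply]
  simp; ring

lemma eisBase_ne_zero {t : ℝ} (ht : 0 < t) {x : ℤ × ℤ} (hx : x ≠ 0) :
    (x.1 * 2 + x.2 * (2 * t * Complex.I) : ℂ) ≠ 0 := by
  intro h
  have h2 := normSq_eisBase t x
  rw [h, norm_zero] at h2
  refine hx (Prod.ext ?_ ?_)
  · have : (x.1 : ℝ) = 0 := by nlinarith [sq_nonneg (x.1 : ℝ), sq_nonneg (t * x.2)]
    exact_mod_cast this
  · have : t * (x.2 : ℝ) = 0 := by nlinarith [sq_nonneg (x.1 : ℝ), sq_nonneg (t * x.2)]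
    exact_mod_cast (mul_eq_zero.mp this).resolve_left ht.ne'

/-- The domination of the Eisenstein series for `t ≥ 1` by the series of the square lattice. -/
lemma norm_eisTerm_le (k : ℕ) {t : ℝ} (ht : 1 ≤ t) (x : ℤ × ℤ) :
    ‖eisTerm k t x‖ ≤ ‖eisTerm k 1 x‖ := by
  by_cases hx : x = 0
  · subst hx; simp [eisTerm]
  have h1 := norm_pos_iff.mpr (eisBase_ne_zero one_pos hx)
  unfold eisTerm
  rw [norm_inv, norm_inv, norm_pow, norm_pow]
  refine inv_anti₀ (pow_pos h1 k) (pow_le_pow_left₀ (norm_nonneg _) ?_ k)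
  refine (pow_le_pow_iff_left₀ (norm_nonneg _) (norm_nonneg _) two_ne_zero).mp ?_
  rw [normSq_eisBase, normSq_eisBase]
  gcongr

lemma continuousOn_tsum_eisTerm {k : ℕ} (hk : 2 < k) :
    ContinuousOn (fun t => ∑' x, eisTerm k t x) (Set.Ici 1) := by
  refine continuousOn_tsum (fun x => ?_) (summable_norm_eisTerm hk)
    fun x t ht => norm_eisTerm_le k ht x
  by_cases hx : x = 0
  · subst hx
    simp only [eisTerm]
    simp only [Prod.fst_zero, Prod.snd_zero, Int.cast_zero, zero_mul, add_zero]
    exact continuousOn_const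
  · unfold eisTerm
    refine ContinuousOn.inv₀ (by fun_prop) fun t ht => pow_ne_zero _
      (eisBase_ne_zero (one_pos.trans_le ht) hx)

/-- As `t → ∞` only the lattice points on the real axis contribute to the Eisenstein series, which
tends to a value of the Riemann zeta function. -/
lemma tendsto_tsum_eisTerm {k : ℕ} (hk : 2 < k) (hk' : Even k) {s : ℝ}
    (hs : HasSum (fun n : ℕ => 1 / (n : ℝ) ^ k) s) :
    Tendsto (fun t => ∑' x, eisTerm k t x) atTop (𝓝 ((2 * s / 2 ^ k : ℝ) : ℂ)) := by
  have hk0 : k ≠ 0 := by omega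
  set g : ℤ × ℤ → ℂ := fun x => if x.2 = 0 then ((x.1 * 2 : ℂ) ^ k)⁻¹ else 0 with hg
  have hnat : HasSum (fun n : ℕ => (((n : ℂ) * 2) ^ k)⁻¹) ((s / 2 ^ k : ℝ) : ℂ) := by
    have h := Complex.hasSum_ofReal.mpr (hs.div_const (2 ^ k))
    refine h.congr_fun fun n => ?_
    push_cast
    rw [mul_pow, mul_inv, one_div, div_eq_mul_inv]
  have hint : HasSum (fun n : ℤ => (((n : ℂ) * 2) ^ k)⁻¹) ((2 * s / 2 ^ k : ℝ) : ℂ) := by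
    have h := HasSum.of_nat_of_neg (f := fun n : ℤ => (((n : ℂ) * 2) ^ k)⁻¹)
      (g := ((s / 2 ^ k : ℝ) : ℂ)) (g' := ((s / 2 ^ k : ℝ) : ℂ)) (by simpa using hnat) ?_
    · convert! h using 1
      simp [hk0]; ring
    · refine hnat.congr_fun fun n => ?_
      simp [hk'.neg_pow]
  have hgsum : HasSum g ((2 * s / 2 ^ k : ℝ) : ℂ) := by
    have hi : Function.Injective fun n : ℤ => ((n, 0) : ℤ × ℤ) := fun a b h => by simpa using h
    refine (hi.hasSum_iff ?_).mp ?_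
    · rintro ⟨m, n⟩ hmn
      have : n ≠ 0 := by rintro rfl; exact hmn ⟨m, rfl⟩
      simp [hg, this]
    · refine hint.congr_fun fun n => ?_
      simp [hg]
  rw [← hgsum.tsum_eq]
  refine tendsto_tsum_of_dominated_convergence (summable_norm_eisTerm hk) (fun x => ?_) ?_
  · by_cases hx : x.2 = 0
    · simp only [eisTerm, hg, hx]
      simp
    · simp only [hg, if_neg hx]
      unfold eisTerm
      rw [tendsto_zero_iff_norm_tendsto_zero]
      have h1 : Tendsto (fun t : ℝ => ‖(x.1 * 2 + x.2 * (2 * t * Complex.I) : ℂ)‖) atTop atTop := by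
        refine tendsto_atTop_mono' _ ?_ tendsto_id
        filter_upwards [eventually_ge_atTop 0] with t ht
        refine (pow_le_pow_iff_left₀ ht (norm_nonneg _) two_ne_zero).mp ?_
        rw [normSq_eisBase]
        have h2 : (1 : ℝ) ≤ (x.2 : ℝ) ^ 2 := by
          have : (0 : ℤ) < x.2 ^ 2 := by positivity
          exact_mod_cast this
        nlinarith [sq_nonneg (x.1 : ℝ), sq_nonneg t]
      have h3 := ((tendsto_pow_atTop hk0).comp h1).inv_tendsto_atTop
      refine h3.congr fun t => ?_
      simp
  · filter_upwards [eventually_ge_atTop 1] with t ht x using norm_eisTerm_le k ht x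

lemma hasSum_zeta_six : HasSum (fun n : ℕ => (1 : ℝ) / (n : ℝ) ^ 6) (Real.pi ^ 6 / 945) := by
  have h6 : bernoulli' 6 = 1 / 42 := by
    have h1 : Nat.choose 6 2 = 15 := by decide
    have h2 : Nat.choose 6 4 = 15 := by decide
    have h5 : bernoulli' 5 = 0 := bernoulli'_eq_zero_of_odd (by decide) (by norm_num)
    rw [bernoulli'_def]
    norm_num [Finset.sum_range_succ, Finset.sum_range_zero, h1, h2, h5]
  convert! hasSum_zeta_nat (k := 3) (by norm_num) using 1
  rw [show 2 * 3 = 6 by rfl, bernoulli_eq_bernoulli'_of_ne_one (by decide), h6]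
  simp [Nat.factorial]; ring

/-- The invariant `g₂` of the lattice `2ℤ + 2tiℤ`, as a function of `t`. -/
noncomputable def rectG₂ (t : ℝ) : ℝ := 60 * (∑' x, eisTerm 4 t x).re

/-- The invariant `g₃` of the lattice `2ℤ + 2tiℤ`, as a function of `t`. -/
noncomputable def rectG₃ (t : ℝ) : ℝ := 140 * (∑' x, eisTerm 6 t x).re

lemma g₂_rect_one {t : ℝ} (ht : 0 < t) : (rect 1 t one_pos ht).g₂ = rectG₂ t := by
  refine Complex.ext ?_ (g₂_rect_im one_pos ht)
  rw [g₂, G_rect_one, rectG₂]; simp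

lemma g₃_rect_one {t : ℝ} (ht : 0 < t) : (rect 1 t one_pos ht).g₃ = rectG₃ t := by
  refine Complex.ext ?_ (g₃_rect_im one_pos ht)
  rw [g₃, G_rect_one, rectG₃]; simp

lemma rectG_discr_pos {t : ℝ} (ht : 0 < t) : 27 * rectG₃ t ^ 2 < rectG₂ t ^ 3 := by
  simpa [g₂_rect_one, g₃_rect_one] using rect_discr_pos one_pos ht

lemma rectG₂_pos {t : ℝ} (ht : 0 < t) : 0 < rectG₂ t := by
  have h := rectG_discr_pos ht
  by_contra! hle
  have : rectG₂ t ^ 3 ≤ 0 := Odd.pow_nonpos (by decide) hle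
  nlinarith [sq_nonneg (rectG₃ t)]

/-- The square lattice is invariant under a quarter turn. -/
lemma rectG₃_one : rectG₃ 1 = 0 := by
  have h := g₃_rect_swap one_pos one_pos
  rw [g₃_rect_one] at h
  have h' : rectG₃ 1 = -rectG₃ 1 := by exact_mod_cast h
  linarith

/-- The ratio `27 g₃² / g₂³` of the lattices `2ℤ + 2tiℤ` takes all values in `[0, 1)`: it vanishes
for `t = 1`, and as `t → ∞` the lattice degenerates and the ratio tends to `1`. -/
lemma exists_rectG_ratio {r : ℝ} (h0 : 0 ≤ r) (h1 : r < 1) :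
    ∃ t : ℝ, 1 ≤ t ∧ 27 * rectG₃ t ^ 2 / rectG₂ t ^ 3 = r := by
  set J : ℝ → ℝ := fun t => 27 * rectG₃ t ^ 2 / rectG₂ t ^ 3 with hJ
  have c2 : ContinuousOn rectG₂ (Set.Ici 1) :=
    (Complex.continuous_re.comp_continuousOn (continuousOn_tsum_eisTerm (by norm_num))).const_mul _
  have c3 : ContinuousOn rectG₃ (Set.Ici 1) :=
    (Complex.continuous_re.comp_continuousOn (continuousOn_tsum_eisTerm (by norm_num))).const_mul _
  have cJ : ContinuousOn J (Set.Ici 1) := ((c3.pow 2).const_mul 27).div (c2.pow 3) fun t ht =>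
    pow_ne_zero _ (rectG₂_pos (one_pos.trans_le ht)).ne'
  have t2 : Tendsto rectG₂ atTop (𝓝 (60 * (2 * (Real.pi ^ 4 / 90) / 2 ^ 4))) := by
    have h := (Complex.continuous_re.tendsto _).comp
      (tendsto_tsum_eisTerm (by norm_num) (by decide) hasSum_zeta_four)
    rw [Complex.ofReal_re] at h
    exact h.const_mul 60
  have t3 : Tendsto rectG₃ atTop (𝓝 (140 * (2 * (Real.pi ^ 6 / 945) / 2 ^ 6))) := by
    have h := (Complex.continuous_re.tendsto _).comp
      (tendsto_tsum_eisTerm (by norm_num) (by decide) hasSum_zeta_six)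
    rw [Complex.ofReal_re] at h
    exact h.const_mul 140
  have tJ : Tendsto J atTop (𝓝 1) := by
    have h := ((t3.pow 2).const_mul 27).div (t2.pow 3) (by positivity)
    convert! h using 2
    have := Real.pi_pos
    field_simp
    norm_num
  obtain ⟨T, hT1, hT2⟩ :=
    ((tJ.eventually (eventually_gt_nhds h1)).and (eventually_ge_atTop 1)).exists
  have hJ1 : J 1 = 0 := by simp [hJ, rectG₃_one]
  obtain ⟨t, ht, h⟩ := intermediate_value_Icc hT2 (cJ.mono fun x hx => hx.1)
    (show r ∈ Set.Icc (J 1) (J T) from ⟨by rw [hJ1]; exact h0, hT1.le⟩)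
  exact ⟨t, ht.1, h⟩

/-- Every pair of real invariants with positive discriminant belongs to a rectangular lattice. -/
theorem exists_rect_of_discr_pos {c₂ c₃ : ℝ} (h : 27 * c₃ ^ 2 < c₂ ^ 3) :
    ∃ (p q : ℝ) (hp : 0 < p) (hq : 0 < q),
      (rect p q hp hq).g₂ = c₂ ∧ (rect p q hp hq).g₃ = c₃ := by
  have hc2 : 0 < c₂ := by
    by_contra! hle
    have : c₂ ^ 3 ≤ 0 := Odd.pow_nonpos (by decide) hle
    nlinarith [sq_nonneg c₃]
  obtain ⟨t, ht, hr⟩ := exists_rectG_ratio (r := 27 * c₃ ^ 2 / c₂ ^ 3) (by positivity)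
    ((div_lt_one (by positivity)).mpr h)
  have ht0 : 0 < t := one_pos.trans_le ht
  have hg := rectG₂_pos ht0
  -- the scale that corrects `g₂`; then `g₃` is correct up to its sign
  set l : ℝ := (rectG₂ t / c₂) ^ ((4 : ℝ)⁻¹) with hl
  have hl0 : 0 < l := Real.rpow_pos_of_pos (by positivity) _
  have hl4 : l ^ 4 = rectG₂ t / c₂ := by
    have := Real.rpow_inv_natCast_pow (x := rectG₂ t / c₂) (by positivity) (n := 4) (by norm_num)
    exact_mod_cast this
  have hlC : (l : ℂ) ≠ 0 := by exact_mod_cast hl0.ne'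
  set p := l * 1 with hp
  set q := l * t with hq
  have hp0 : 0 < p := mul_pos hl0 one_pos
  have hq0 : 0 < q := mul_pos hl0 ht0
  have e2 : (rect p q hp0 hq0).g₂ = c₂ := by
    rw [g₂_homothety hlC fun z => rect_smul one_pos ht0 hl0, g₂_rect_one]
    have : (l ^ 4)⁻¹ * rectG₂ t = c₂ := by rw [hl4]; field_simp
    exact_mod_cast this
  have e3 : (rect p q hp0 hq0).g₃ = (((l ^ 6)⁻¹ * rectG₃ t : ℝ) : ℂ) := by
    rw [g₃_homothety hlC fun z => rect_smul one_pos ht0 hl0, g₃_rect_one]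
    push_cast; rfl
  have hsq : ((l ^ 6)⁻¹ * rectG₃ t) ^ 2 = c₃ ^ 2 := by
    have h12 : (l ^ 6) ^ 2 = (rectG₂ t / c₂) ^ 3 := by rw [← hl4]; ring
    rw [mul_pow, inv_pow, h12]
    rw [div_eq_div_iff (by positivity) (by positivity)] at hr
    field_simp
    linear_combination hr / 27
  rcases sq_eq_sq_iff_eq_or_eq_neg.mp hsq with h | h
  · exact ⟨p, q, hp0, hq0, e2, by rw [e3, h]⟩
  -- a quarter turn changes the sign of `g₃`
  · exact ⟨q, p, hq0, hp0, by rw [g₂_rect_swap, e2], by rw [g₃_rect_swap, e3, h]; simp⟩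

end PeriodPair

/-! ### Tools for ordinary differential equations -/

namespace FlagThree

lemma eq_of_hasDerivAt_zero {E : Type*} [NormedAddCommGroup E] [NormedSpace ℝ E] {f : ℝ → E}
    (hf : ∀ t, HasDerivAt f 0 t) (x y : ℝ) : f x = f y :=
  is_const_of_deriv_eq_zero (fun t => (hf t).differentiableAt) (fun t => (hf t).deriv) x y

/-- Two global solutions of an autonomous equation with continuously differentiable right side
agree if they agree at one time. -/
lemma eq_of_hasDerivAt_of_contDiff {E : Type*} [NormedAddCommGroup E] [NormedSpace ℝ E]
    [FiniteDimensional ℝ E] {v : E → E} (hv : ContDiff ℝ 1 v) {f g : ℝ → E}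
    (hf : ∀ t, HasDerivAt f (v (f t)) t) (hg : ∀ t, HasDerivAt g (v (g t)) t)
    (h0 : f 0 = g 0) : f = g := by
  have : ProperSpace E := FiniteDimensional.proper_real E
  have cf : Continuous f := continuous_iff_continuousAt.mpr fun t => (hf t).continuousAt
  have cg : Continuous g := continuous_iff_continuousAt.mpr fun t => (hg t).continuousAt
  ext t
  set T := |t| + 1 with hT
  have hT0 : 0 < T := by positivity
  obtain ⟨R, hR⟩ := ((isCompact_Icc (a := -T) (b := T)).image cf).union
    ((isCompact_Icc (a := -T) (b := T)).image cg) |>.isBounded.subset_closedBall 0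
  obtain ⟨K, hK⟩ := (hv.locallyLipschitz.locallyLipschitzOn
    (s := Metric.closedBall (0 : E) R)).exists_lipschitzOnWith_of_compact
      (isCompact_closedBall 0 R)
  have ht : t ∈ Set.Ioo (-T) T := abs_lt.mp (by rw [hT]; linarith)
  exact ODE_solution_unique_of_mem_Ioo (v := fun _ => v) (s := fun _ => Metric.closedBall 0 R)
    (K := K) (fun _ _ => hK) (t₀ := 0) ⟨by linarith, hT0⟩
    (fun s hs => ⟨hf s, hR (.inl ⟨s, Set.Ioo_subset_Icc_self hs, rfl⟩)⟩)
    (fun s hs => ⟨hg s, hR (.inr ⟨s, Set.Ioo_subset_Icc_self hs, rfl⟩)⟩) h0 ht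

lemma hasDerivAt_conj {f : ℝ → ℂ} {f' : ℂ} {t : ℝ} (h : HasDerivAt f f' t) :
    HasDerivAt (fun t => conj (f t)) (conj f') t := h.star

lemma hasDerivAt_re {f : ℝ → ℂ} {f' : ℂ} {t : ℝ} (h : HasDerivAt f f' t) :
    HasDerivAt (fun t => (f t).re) f'.re t :=
  Complex.reCLM.hasFDerivAt.comp_hasDerivAt t h

lemma hasDerivAt_im {f : ℝ → ℂ} {f' : ℂ} {t : ℝ} (h : HasDerivAt f f' t) :
    HasDerivAt (fun t => (f t).im) f'.im t :=
  Complex.imCLM.hasFDerivAt.comp_hasDerivAt t h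

lemma hasDerivAt_norm_sq {f : ℝ → ℂ} {f' : ℂ} {t : ℝ} (h : HasDerivAt f f' t) :
    HasDerivAt (fun t => ‖f t‖ ^ 2) (2 * (conj (f t) * f').re) t := by
  have h1 := h.norm_sq
  rw [Complex.inner, mul_comm f'] at h1
  exact h1

/-- Solutions of a scalar linear equation are determined by their initial value. -/
lemma eq_of_hasDerivAt_mul {f g q : ℝ → ℂ} (hf : ∀ t, HasDerivAt f (q t * f t) t)
    (hg : ∀ t, HasDerivAt g (q t * g t) t) (hne : ∀ t, g t ≠ 0) (h0 : f 0 = g 0) : f = g := by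
  have hd : ∀ t, HasDerivAt (fun t => f t / g t) 0 t := fun t => by
    refine ((hf t).div (hg t) (hne t)).congr_deriv ?_
    rw [div_eq_zero_iff]; left; ring
  ext t
  have h := eq_of_hasDerivAt_zero hd t 0
  simp only [h0, div_self (hne 0)] at h
  exact (div_eq_one_iff_eq (hne t)).mp h

/-! ### Integrals of the Euler equations -/

variable {α : Matrix (Fin 3) (Fin 3) ℝ} {a b c : ℝ → ℂ}

namespace IsEulerSolution

lemma hasDerivAt_a (h : IsEulerSolution α a b c) (t : ℝ) : HasDerivAt a
    (-Complex.I * ((α 1 2 - α 0 2 : ℝ) : ℂ) * (b t * conj (c t))) t := by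
  refine (h.differentiable_a t).hasDerivAt.congr_deriv ?_
  have := h.eq_a t
  linear_combination -Complex.I * this + deriv a t * Complex.I_mul_I

lemma hasDerivAt_b (h : IsEulerSolution α a b c) (t : ℝ) : HasDerivAt b
    (-Complex.I * ((α 1 2 - α 0 1 : ℝ) : ℂ) * (a t * c t)) t := by
  refine (h.differentiable_b t).hasDerivAt.congr_deriv ?_
  have := h.eq_b t
  linear_combination -Complex.I * this + deriv b t * Complex.I_mul_I

lemma hasDerivAt_c (h : IsEulerSolution α a b c) (t : ℝ) : HasDerivAt c
    (-Complex.I * ((α 0 2 - α 0 1 : ℝ) : ℂ) * (conj (a t) * b t)) t := by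
  refine (h.differentiable_c t).hasDerivAt.congr_deriv ?_
  have := h.eq_c t
  linear_combination -Complex.I * this + deriv c t * Complex.I_mul_I

lemma hasDerivAt_norm_sq_a (h : IsEulerSolution α a b c) (t : ℝ) : HasDerivAt (fun t => ‖a t‖ ^ 2)
    (2 * (α 1 2 - α 0 2) * (conj (a t) * b t * conj (c t)).im) t := by
  refine (hasDerivAt_norm_sq (h.hasDerivAt_a t)).congr_deriv ?_
  simp; ring

lemma hasDerivAt_norm_sq_b (h : IsEulerSolution α a b c) (t : ℝ) : HasDerivAt (fun t => ‖b t‖ ^ 2)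
    (2 * (α 0 1 - α 1 2) * (conj (a t) * b t * conj (c t)).im) t := by
  refine (hasDerivAt_norm_sq (h.hasDerivAt_b t)).congr_deriv ?_
  simp; ring

lemma hasDerivAt_norm_sq_c (h : IsEulerSolution α a b c) (t : ℝ) : HasDerivAt (fun t => ‖c t‖ ^ 2)
    (-2 * (α 0 1 - α 0 2) * (conj (a t) * b t * conj (c t)).im) t := by
  refine (hasDerivAt_norm_sq (h.hasDerivAt_c t)).congr_deriv ?_
  simp; ring

lemma hasDerivAt_prod (h : IsEulerSolution α a b c) (t : ℝ) :
    HasDerivAt (fun t => conj (a t) * b t * conj (c t))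
    (Complex.I * ((((α 1 2 - α 0 2) * (‖b t‖ ^ 2 * ‖c t‖ ^ 2) +
      (α 0 1 - α 1 2) * (‖a t‖ ^ 2 * ‖c t‖ ^ 2) -
      (α 0 1 - α 0 2) * (‖a t‖ ^ 2 * ‖b t‖ ^ 2) : ℝ)) : ℂ)) t := by
  refine (((hasDerivAt_conj (h.hasDerivAt_a t)).mul (h.hasDerivAt_b t)).mul
    (hasDerivAt_conj (h.hasDerivAt_c t))).congr_deriv ?_
  simp only [Complex.ofReal_sub, Complex.ofReal_add, Complex.ofReal_mul, Complex.ofReal_pow,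
    ← Complex.conj_mul', map_mul, map_neg, Complex.conj_I, Complex.conj_ofReal, map_sub,
    Complex.conj_conj, Pi.mul_apply]
  ring

lemma I₂_eq (h : IsEulerSolution α a b c) (t : ℝ) : I₂ α (a t) (c t) = I₂ α (a 0) (c 0) := by
  refine eq_of_hasDerivAt_zero (f := fun t => I₂ α (a t) (c t)) (fun t => ?_) t 0
  unfold I₂ h₂
  refine ((((h.hasDerivAt_norm_sq_a t).const_mul (α 0 1 - α 0 2)).add
    ((h.hasDerivAt_norm_sq_c t).const_mul (α 1 2 - α 0 2))).neg.div_const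
    (α 0 2 - α 1 2)).congr_deriv ?_
  rw [div_eq_zero_iff]; left; ring

lemma I₃_eq (h : IsEulerSolution α a b c) (t : ℝ) : I₃ α (b t) (c t) = I₃ α (b 0) (c 0) := by
  refine eq_of_hasDerivAt_zero (f := fun t => I₃ α (b t) (c t)) (fun t => ?_) t 0
  unfold I₃ h₃
  refine ((((h.hasDerivAt_norm_sq_b t).const_mul (α 0 1 - α 0 2)).add
    ((h.hasDerivAt_norm_sq_c t).const_mul (α 0 1 - α 1 2))).neg.div_const
    (α 1 2 - α 0 1)).congr_deriv ?_
  rw [div_eq_zero_iff]; left; ring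

lemma h₄_eq_re (a b c : ℂ) : h₄ a b c = 2 * (conj a * b * conj c).re := by
  unfold h₄; simp; ring

lemma h₄_eq (h : IsEulerSolution α a b c) (t : ℝ) :
    h₄ (a t) (b t) (c t) = h₄ (a 0) (b 0) (c 0) := by
  simp only [h₄_eq_re]
  refine eq_of_hasDerivAt_zero (f := fun t => 2 * (conj (a t) * b t * conj (c t)).re)
    (fun t => ?_) t 0
  refine ((hasDerivAt_re (h.hasDerivAt_prod t)).const_mul 2).congr_deriv ?_
  rw [Complex.I_mul_re, Complex.ofReal_im]; simp

end IsEulerSolution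

/-! ### Algebra of the integrals -/

lemma norm_sq_a_eq (hα : α 0 2 < α 1 2) (hα' : α 1 2 < α 0 1) (a c : ℂ) :
    ‖a‖ ^ 2 = (α 1 2 - α 0 2) / (α 0 1 - α 0 2) * (I₂ α a c - ‖c‖ ^ 2) := by
  have h1 : α 1 2 - α 0 2 ≠ 0 := by linarith
  have h2 : α 0 1 - α 0 2 ≠ 0 := by linarith
  have h3 : α 0 2 - α 1 2 ≠ 0 := by linarith
  unfold I₂ h₂
  field_simp
  ring

lemma norm_sq_b_eq (hα : α 0 2 < α 1 2) (hα' : α 1 2 < α 0 1) (b c : ℂ) :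
    ‖b‖ ^ 2 = (α 0 1 - α 1 2) / (α 0 1 - α 0 2) * (I₃ α b c - ‖c‖ ^ 2) := by
  have h1 : α 0 1 - α 1 2 ≠ 0 := by linarith
  have h2 : α 0 1 - α 0 2 ≠ 0 := by linarith
  have h3 : α 1 2 - α 0 1 ≠ 0 := by linarith
  unfold I₃ h₃
  field_simp
  ring

lemma timeScale_pos (hα : α 0 2 < α 1 2) (hα' : α 1 2 < α 0 1) : 0 < timeScale α :=
  Real.sqrt_pos.mpr (mul_pos (by linarith) (by linarith))

lemma timeScale_sq (hα : α 0 2 < α 1 2) (hα' : α 1 2 < α 0 1) :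
    timeScale α ^ 2 = (α 0 1 - α 1 2) * (α 1 2 - α 0 2) :=
  Real.sq_sqrt (mul_nonneg (by linarith) (by linarith))

/-- The number `κ h₄`, the square of which is `-I₄`. Here `κ` is `α₁₂ - α₁₃` divided by the time
scale. -/
noncomputable def root₄ (α : Matrix (Fin 3) (Fin 3) ℝ) (a b c : ℂ) : ℝ :=
  (α 0 1 - α 0 2) / timeScale α * h₄ a b c

lemma root₄_sq (hα : α 0 2 < α 1 2) (hα' : α 1 2 < α 0 1) (a b c : ℂ) :
    root₄ α a b c ^ 2 = -I₄ α a b c := by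
  unfold root₄ I₄
  rw [mul_pow, div_pow, timeScale_sq hα hα']
  ring

/-- The cubic polynomial in the coordinate centred at the three values of `℘(μ)`. -/
lemma cubic_eq (Y : ℝ) (a b c : ℂ) :
    4 * Y ^ 3 - g₂ α a b c * Y - g₃ α a b c =
      4 * (Y - (2 * I₂ α a c / 3 - I₃ α b c / 3)) * (Y - (-(I₂ α a c) / 3 + 2 * I₃ α b c / 3)) *
        (Y - (-(I₂ α a c) / 3 - I₃ α b c / 3)) + I₄ α a b c := by
  unfold g₂ g₃
  ring

/-- The derivative of `|c|²` with respect to `τ`. -/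
noncomputable def speedC (α : Matrix (Fin 3) (Fin 3) ℝ) (a b c : ℂ) : ℝ :=
  2 * (conj c * (-Complex.I * ((α 0 2 - α 0 1 : ℝ) : ℂ) * (conj a * b))).re / timeScale α

lemma speedC_eq (a b c : ℂ) :
    speedC α a b c = -2 * (α 0 1 - α 0 2) / timeScale α * (conj a * b * conj c).im := by
  unfold speedC
  simp; ring

/-- The first integral: the square of `d|c|²/dτ` is the cubic polynomial of
`|c|² - (I₂ + I₃) / 3`. -/
lemma speedC_sq (hα : α 0 2 < α 1 2) (hα' : α 1 2 < α 0 1) (a b c : ℂ) :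
    speedC α a b c ^ 2 = 4 * (‖c‖ ^ 2 - (I₂ α a c + I₃ α b c) / 3) ^ 3 -
      g₂ α a b c * (‖c‖ ^ 2 - (I₂ α a c + I₃ α b c) / 3) - g₃ α a b c := by
  rw [cubic_eq, ← neg_neg (I₄ α a b c), ← root₄_sq hα hα', speedC_eq, root₄,
    IsEulerSolution.h₄_eq_re]
  have h1 : (conj a * b * conj c).re ^ 2 + (conj a * b * conj c).im ^ 2 =
      ‖a‖ ^ 2 * ‖b‖ ^ 2 * ‖c‖ ^ 2 := by
    have := Complex.sq_norm (conj a * b * conj c)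
    rw [Complex.normSq_apply, norm_mul, norm_mul, RCLike.norm_conj, RCLike.norm_conj] at this
    linear_combination -this
  have h2 := norm_sq_a_eq hα hα' a c
  have h3 := norm_sq_b_eq hα hα' b c
  have h4 := timeScale_sq hα hα'
  have h5 := (timeScale_pos hα hα').ne'
  have h6 : α 0 1 - α 0 2 ≠ 0 := by linarith
  have h7 : α 0 1 - α 1 2 ≠ 0 := by linarith
  have h8 : α 1 2 - α 0 2 ≠ 0 := by linarith
  have h9 : 4 * (α 0 1 - α 0 2) ^ 2 / timeScale α ^ 2 * (‖a‖ ^ 2 * ‖b‖ ^ 2 * ‖c‖ ^ 2) =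
      4 * (I₂ α a c - ‖c‖ ^ 2) * (I₃ α b c - ‖c‖ ^ 2) * ‖c‖ ^ 2 := by
    rw [h2, h3, h4]
    field_simp
  rw [← h1] at h9
  generalize (conj a * b * conj c).re = x at *
  generalize (conj a * b * conj c).im = y at *
  field_simp at h9 ⊢
  linear_combination 108 * h9

lemma norm_sq_c_le_I₂ (hα : α 0 2 < α 1 2) (hα' : α 1 2 < α 0 1) (a c : ℂ) :
    ‖c‖ ^ 2 ≤ I₂ α a c := by
  have h := norm_sq_a_eq hα hα' a c
  have h1 : 0 < (α 1 2 - α 0 2) / (α 0 1 - α 0 2) := div_pos (by linarith) (by linarith)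
  have h2 : 0 ≤ ‖a‖ ^ 2 := by positivity
  rw [h] at h2
  linarith [nonneg_of_mul_nonneg_right h2 h1]

lemma norm_sq_c_le_I₃ (hα : α 0 2 < α 1 2) (hα' : α 1 2 < α 0 1) (b c : ℂ) :
    ‖c‖ ^ 2 ≤ I₃ α b c := by
  have h := norm_sq_b_eq hα hα' b c
  have h1 : 0 < (α 0 1 - α 1 2) / (α 0 1 - α 0 2) := div_pos (by linarith) (by linarith)
  have h2 : 0 ≤ ‖b‖ ^ 2 := by positivity
  rw [h] at h2
  linarith [nonneg_of_mul_nonneg_right h2 h1]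

lemma I₄_nonpos (hα : α 0 2 < α 1 2) (hα' : α 1 2 < α 0 1) (a b c : ℂ) : I₄ α a b c ≤ 0 := by
  have := root₄_sq hα hα' a b c
  nlinarith [sq_nonneg (root₄ α a b c)]

/-- The discriminant of the elliptic curve is never negative. With `u = |c|²`, `A = I₂ - u` and
`B = I₃ - u`, the first integral bounds `-I₄` by `4uAB`, and `g₃` is an affine function of `-I₄`. So
`g₃²` is at most the larger of its values at `-I₄ = 0` and `-I₄ = 4uAB`, and for these two the
discriminant is a square up to a nonnegative factor. -/
lemma discr_nonneg (hα : α 0 2 < α 1 2) (hα' : α 1 2 < α 0 1) (a b c : ℂ) :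
    27 * g₃ α a b c ^ 2 ≤ g₂ α a b c ^ 3 := by
  have h1 := norm_sq_c_le_I₂ hα hα' a c
  have h2 := norm_sq_c_le_I₃ hα hα' b c
  have h3 := I₄_nonpos hα hα' a b c
  have h4 : 0 ≤ speedC α a b c ^ 2 := sq_nonneg _
  rw [speedC_sq hα hα', cubic_eq] at h4
  have h5 : 0 ≤ ‖c‖ ^ 2 := by positivity
  obtain ⟨A, hA⟩ : ∃ A, I₂ α a c = A + ‖c‖ ^ 2 := ⟨I₂ α a c - ‖c‖ ^ 2, by ring⟩
  obtain ⟨B, hB⟩ : ∃ B, I₃ α b c = B + ‖c‖ ^ 2 := ⟨I₃ α b c - ‖c‖ ^ 2, by ring⟩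
  obtain ⟨K, hK⟩ : ∃ K, I₄ α a b c = -K := ⟨-I₄ α a b c, by ring⟩
  unfold g₂ g₃
  rw [hA, hB, hK] at h4
  rw [hA] at h1
  rw [hB] at h2
  rw [hK] at h3
  rw [hA, hB, hK]
  clear hA hB hK
  generalize ‖c‖ ^ 2 = u at *
  have hA0 : 0 ≤ A := by linarith
  have hB0 : 0 ≤ B := by linarith
  have hK0 : 0 ≤ K := by linarith
  have hK1 : K ≤ 4 * u * A * B := by linarith
  set g := 4 / 27 * (A + u + (B + u)) *
    (2 * (A + u) ^ 2 - 5 * ((A + u) * (B + u)) + 2 * (B + u) ^ 2) with hg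
  have e0 : 27 * g ^ 2 ≤ (4 / 3 * ((A + u) ^ 2 - (A + u) * (B + u) + (B + u) ^ 2)) ^ 3 := by
    have : 0 ≤ 16 * ((A + u) * (B + u) * (A - B)) ^ 2 := by positivity
    rw [hg]
    linear_combination this
  have e1 : 27 * (4 * u * A * B + g) ^ 2 ≤
      (4 / 3 * ((A + u) ^ 2 - (A + u) * (B + u) + (B + u) ^ 2)) ^ 3 := by
    have : 0 ≤ 16 * ((A - B) ^ 2 + u ^ 2 + 2 * u * (A + B)) * (A * B - (A + B) * u) ^ 2 := by
      positivity
    rw [hg]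
    linear_combination this
  rw [neg_neg]
  refine le_trans ?_ (max_le e0 e1)
  rcases le_total 0 (2 * g + K + 4 * u * A * B) with hs | hs
  · refine le_max_of_le_right ?_
    nlinarith
  · refine le_max_of_le_left ?_
    nlinarith [mul_nonneg hK0 hK0]

/-- The initial value of `|c|² - (I₂ + I₃) / 3` lies between the two smaller roots of the cubic. The
cubic is not negative there, and not positive at the two values `r₁`, `r₂` of `℘(μ)` that lie above
it; were it at least `e₁`, both would equal `e₁`, a simple root. -/
lemma mem_Icc_of_roots (hα : α 0 2 < α 1 2) (hα' : α 1 2 < α 0 1) (a b c : ℂ) {e₁ e₂ e₃ : ℝ}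
    (h32 : e₃ < e₂) (h21 : e₂ < e₁)
    (hP : ∀ Y : ℝ, 4 * Y ^ 3 - g₂ α a b c * Y - g₃ α a b c =
      4 * (Y - e₁) * (Y - e₂) * (Y - e₃)) :
    ‖c‖ ^ 2 - (I₂ α a c + I₃ α b c) / 3 ∈ Set.Icc e₃ e₂ := by
  have h1 := norm_sq_c_le_I₂ hα hα' a c
  have h2 := norm_sq_c_le_I₃ hα hα' b c
  have h3 := I₄_nonpos hα hα' a b c
  have h4 : 0 ≤ speedC α a b c ^ 2 := sq_nonneg _
  rw [speedC_sq hα hα', hP] at h4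
  have q1 := cubic_eq (α := α) (2 * I₂ α a c / 3 - I₃ α b c / 3) a b c
  have q2 := cubic_eq (α := α) (-(I₂ α a c) / 3 + 2 * I₃ α b c / 3) a b c
  have q3 := cubic_eq (α := α) e₂ a b c
  have q0 := cubic_eq (α := α) 0 a b c
  rw [hP] at q1 q2 q3 q0
  have d := hP 1
  have d' := hP (-1)
  have d0 := hP 0
  have hsum : e₁ + e₂ + e₃ = 0 := by linarith
  generalize hY : ‖c‖ ^ 2 - (I₂ α a c + I₃ α b c) / 3 = Y at *
  set r₁ := 2 * I₂ α a c / 3 - I₃ α b c / 3 with hr1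
  set r₂ := -(I₂ α a c) / 3 + 2 * I₃ α b c / 3 with hr2
  have k1 : Y ≤ r₁ := by rw [← hY, hr1]; linarith
  have k2 : Y ≤ r₂ := by rw [← hY, hr2]; linarith
  -- a point beyond the second root where the cubic is not positive is at most `e₁`
  have key : ∀ y, 4 * (y - e₁) * (y - e₂) * (y - e₃) ≤ 0 → e₂ < y → y ≤ e₁ := by
    intro y hy hy2
    by_contra! hlt
    have : 0 < 4 * (y - e₁) * (y - e₂) * (y - e₃) :=
      mul_pos (mul_pos (mul_pos (by norm_num) (by linarith)) (by linarith)) (by linarith)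
    linarith
  constructor
  · by_contra! hlt
    have : 0 < 4 * (e₁ - Y) * (e₂ - Y) * (e₃ - Y) :=
      mul_pos (mul_pos (mul_pos (by norm_num) (by linarith)) (by linarith)) (by linarith)
    linarith
  · by_contra! hlt
    have hYe : e₁ ≤ Y := by
      by_contra! hlt'
      have : 0 < 4 * (e₁ - Y) * (Y - e₂) * (Y - e₃) :=
        mul_pos (mul_pos (mul_pos (by norm_num) (by linarith)) (by linarith)) (by linarith)
      linarith
    have m1 : r₁ = e₁ := le_antisymm (key r₁ (by rw [q1]; simpa using h3) (by linarith))
      (by linarith)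
    have m2 : r₂ = e₁ := le_antisymm (key r₂ (by rw [q2]; simpa using h3) (by linarith))
      (by linarith)
    have m3 : I₄ α a b c = 0 := by
      have := q1
      rw [m1] at this
      simpa using this.symm
    have m4 : -(I₂ α a c) / 3 - I₃ α b c / 3 = -r₁ - r₂ := by rw [hr1, hr2]; ring
    rw [m1, m2, m3, m4, m1, m2] at q3
    have m5 : (e₂ - e₁) ^ 2 * (e₂ + 2 * e₁) = 0 := by linear_combination -q3 / 4
    rcases mul_eq_zero.mp m5 with h | h
    · have := pow_eq_zero_iff (two_ne_zero) |>.mp h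
      linarith
    · linarith

end FlagThree

/-! ### Lamé functions along the shifted real line -/

namespace FlagThree

/-- On the line `τ - τ₀ + ω₂` the function `℘` has the real values `R τ`, and `℘'` has the real
values `P τ`. -/
structure IsRealOnLine (L : PeriodPair) (τ₀ : ℝ) (R P : ℝ → ℝ) : Prop where
  notMem : ∀ τ : ℝ, (τ : ℂ) - τ₀ + L.ω₂ / 2 ∉ L.lattice
  weierstrassP_eq : ∀ τ : ℝ, L.weierstrassP ((τ : ℂ) - τ₀ + L.ω₂ / 2) = R τ
  derivWeierstrassP_eq : ∀ τ : ℝ, L.derivWeierstrassP ((τ : ℂ) - τ₀ + L.ω₂ / 2) = P τ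

variable {L : PeriodPair} {τ₀ : ℝ} {R P : ℝ → ℝ}

lemma hasDerivAt_line (τ : ℝ) : HasDerivAt (fun τ : ℝ => (τ : ℂ) - τ₀ + L.ω₂ / 2) 1 τ :=
  (Complex.ofRealCLM.hasDerivAt (x := τ)).sub_const (τ₀ : ℂ) |>.add_const (L.ω₂ / 2)

namespace IsRealOnLine

lemma hasDerivAt_weierstrassP (h : IsRealOnLine L τ₀ R P) (τ : ℝ) : HasDerivAt R (P τ) τ := by
  have h1 := (L.hasDerivAt_weierstrassP (h.notMem τ)).comp_of_eq τ (hasDerivAt_line τ) rfl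
  have h2 := hasDerivAt_re h1
  simpa [Function.comp_def, h.weierstrassP_eq, h.derivWeierstrassP_eq] using h2

lemma hasDerivAt_derivWeierstrassP (h : IsRealOnLine L τ₀ R P) {g : ℝ} (hg : L.g₂ = g) (τ : ℝ) :
    HasDerivAt P (6 * R τ ^ 2 - g / 2) τ := by
  have h1 := (L.hasDerivAt_derivWeierstrassP (h.notMem τ)).comp_of_eq τ (hasDerivAt_line τ) rfl
  have h2 := hasDerivAt_re h1
  have h3 : ((6 * (R τ : ℂ) ^ 2 - (g : ℂ) / 2) * 1).re = 6 * R τ ^ 2 - g / 2 := by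
    rw [mul_one, ← Complex.ofReal_re (6 * R τ ^ 2 - g / 2)]
    push_cast
    rfl
  rw [h.weierstrassP_eq, hg, h3] at h2
  simpa [Function.comp_def, h.derivWeierstrassP_eq] using h2

lemma sq_eq (h : IsRealOnLine L τ₀ R P) {g g' : ℝ} (hg : L.g₂ = g) (hg' : L.g₃ = g') (τ : ℝ) :
    P τ ^ 2 = 4 * R τ ^ 3 - g * R τ - g' := by
  have := L.derivWeierstrassP_sq _ (h.notMem τ)
  rw [h.weierstrassP_eq, h.derivWeierstrassP_eq, hg, hg'] at this
  exact_mod_cast this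

end IsRealOnLine

section lame

variable {μ : ℂ}

lemma add_notMem_of_weierstrassP_ne {z v : ℂ} (h : L.weierstrassP z ≠ L.weierstrassP v) :
    z + v ∉ L.lattice := fun hm => h <| by
  have := L.weierstrassP_add_coe (-v) ⟨z + v, hm⟩
  rw [show -v + ((⟨z + v, hm⟩ : L.lattice) : ℂ) = z by simp] at this
  rw [this, L.weierstrassP_neg]

lemma sub_notMem_of_weierstrassP_ne {z v : ℂ} (h : L.weierstrassP z ≠ L.weierstrassP v) :
    z - v ∉ L.lattice := by
  rw [sub_eq_add_neg]
  exact add_notMem_of_weierstrassP_ne (by rwa [L.weierstrassP_neg])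

/-- The logarithmic derivative of `y_±(τ|μ)`, by the addition theorem of the `ζ` function. -/
lemma hasDerivAt_lameSol {ε : ℂ} (hε : ε = 1 ∨ ε = -1) (hμ : μ ∉ L.lattice)
    (hz : ∀ τ : ℝ, (τ : ℂ) - τ₀ + L.ω₂ / 2 ∉ L.lattice)
    (hne : ∀ τ : ℝ, L.weierstrassP ((τ : ℂ) - τ₀ + L.ω₂ / 2) ≠ L.weierstrassP μ) (τ : ℝ) :
    HasDerivAt (lameSol L τ₀ μ ε)
      (1 / 2 * (L.derivWeierstrassP ((τ : ℂ) - τ₀ + L.ω₂ / 2) - ε * L.derivWeierstrassP μ) /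
        (L.weierstrassP ((τ : ℂ) - τ₀ + L.ω₂ / 2) - L.weierstrassP μ) * lameSol L τ₀ μ ε τ) τ := by
  have hP : L.weierstrassP (ε * μ) = L.weierstrassP μ := by
    rcases hε with rfl | rfl <;> simp
  have hP' : L.derivWeierstrassP (ε * μ) = ε * L.derivWeierstrassP μ := by
    rcases hε with rfl | rfl <;> simp
  have hZ : L.weierstrassZeta (ε * μ) = ε * L.weierstrassZeta μ := by
    rcases hε with rfl | rfl <;> simp [L.weierstrassZeta_neg]
  have hv : ε * μ ∉ L.lattice := by
    rcases hε with rfl | rfl <;> simpa using hμ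
  have hne' : ∀ τ : ℝ, L.weierstrassP ((τ : ℂ) - τ₀ + L.ω₂ / 2) ≠ L.weierstrassP (ε * μ) := by
    rwa [hP]
  set z : ℂ := (τ : ℂ) - τ₀ + L.ω₂ / 2 with hzdef
  have n1 : z + ε * μ ∉ L.lattice := add_notMem_of_weierstrassP_ne (hne' τ)
  have n2 : z - ε * μ ∉ L.lattice := sub_notMem_of_weierstrassP_ne (hne' τ)
  have n0 : -(τ₀ : ℂ) + L.ω₂ / 2 + ε * μ ∉ L.lattice := by
    simpa using add_notMem_of_weierstrassP_ne (hne' 0)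
  have hadd := L.weierstrassZeta_add (hz τ) hv n1 n2
  rw [hP, hP', hZ] at hadd
  have s1 := (L.hasDerivAt_weierstrassSigma (hz τ)).comp_of_eq τ (hasDerivAt_line τ) rfl
  have s2 := (L.hasDerivAt_weierstrassSigma n1).comp_of_eq τ
    ((hasDerivAt_line (L := L) (τ₀ := τ₀) τ).add_const (ε * μ)) rfl
  have s3 : HasDerivAt (fun τ : ℝ => Complex.exp (-ε * τ * L.weierstrassZeta μ))
      (Complex.exp (-ε * τ * L.weierstrassZeta μ) * (-ε * 1 * L.weierstrassZeta μ)) τ :=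
    ((Complex.ofRealCLM.hasDerivAt (x := τ)).const_mul (-ε) |>.mul_const _).cexp
  have nz := L.weierstrassSigma_ne_zero (hz τ)
  have n0' := L.weierstrassSigma_ne_zero n0
  refine ((s3.mul (s2.mul_const _)).div (s1.mul_const _) (mul_ne_zero nz n0')).congr_deriv ?_
  have hq : 1 / 2 * (L.derivWeierstrassP z - ε * L.derivWeierstrassP μ) /
      (L.weierstrassP z - L.weierstrassP μ) =
      L.weierstrassZeta (z + ε * μ) - L.weierstrassZeta z - ε * L.weierstrassZeta μ := by
    rw [hzdef, hadd, div_mul_eq_div_mul_one_div]; ring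
  rw [hq, lameSol]
  simp only [Function.comp_apply, Pi.mul_apply]
  rw [← hzdef] at nz ⊢
  generalize -(τ₀ : ℂ) + L.ω₂ / 2 + ε * μ = w at n0' ⊢
  generalize -(τ₀ : ℂ) + L.ω₂ / 2 = w'
  generalize z + ε * μ = z'
  field_simp
  ring

lemma lameSol_zero {ε : ℂ} (hε : ε = 1 ∨ ε = -1)
    (hz : ∀ τ : ℝ, (τ : ℂ) - τ₀ + L.ω₂ / 2 ∉ L.lattice)
    (hne : ∀ τ : ℝ, L.weierstrassP ((τ : ℂ) - τ₀ + L.ω₂ / 2) ≠ L.weierstrassP μ) :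
    lameSol L τ₀ μ ε 0 = 1 := by
  have n0 : -(τ₀ : ℂ) + L.ω₂ / 2 + ε * μ ∉ L.lattice := by
    have h0 := hne 0
    have : L.weierstrassP (ε * μ) = L.weierstrassP μ := by rcases hε with rfl | rfl <;> simp
    rw [← this] at h0
    simpa using add_notMem_of_weierstrassP_ne h0
  have n1 : -(τ₀ : ℂ) + L.ω₂ / 2 ∉ L.lattice := by simpa using hz 0
  simp only [lameSol, Complex.ofReal_zero, zero_sub, mul_zero, zero_mul, Complex.exp_zero, one_mul]
  rw [mul_comm]
  exact div_self (mul_ne_zero (L.weierstrassSigma_ne_zero n1) (L.weierstrassSigma_ne_zero n0))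

lemma lameSol_ne_zero {ε : ℂ} (hε : ε = 1 ∨ ε = -1)
    (hz : ∀ τ : ℝ, (τ : ℂ) - τ₀ + L.ω₂ / 2 ∉ L.lattice)
    (hne : ∀ τ : ℝ, L.weierstrassP ((τ : ℂ) - τ₀ + L.ω₂ / 2) ≠ L.weierstrassP μ) (τ : ℝ) :
    lameSol L τ₀ μ ε τ ≠ 0 := by
  have key : ∀ τ : ℝ, (τ : ℂ) - τ₀ + L.ω₂ / 2 + ε * μ ∉ L.lattice := fun τ => by
    have h0 := hne τ
    have : L.weierstrassP (ε * μ) = L.weierstrassP μ := by rcases hε with rfl | rfl <;> simp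
    rw [← this] at h0
    exact add_notMem_of_weierstrassP_ne h0
  have n0 : -(τ₀ : ℂ) + L.ω₂ / 2 + ε * μ ∉ L.lattice := by simpa using key 0
  have n1 : -(τ₀ : ℂ) + L.ω₂ / 2 ∉ L.lattice := by simpa using hz 0
  exact div_ne_zero (mul_ne_zero (Complex.exp_ne_zero _)
    (mul_ne_zero (L.weierstrassSigma_ne_zero (key τ)) (L.weierstrassSigma_ne_zero n1)))
    (mul_ne_zero (L.weierstrassSigma_ne_zero (hz τ)) (L.weierstrassSigma_ne_zero n0))

/-- The combination of `y_+` and `y_-` with initial value `x₀` and initial derivative `w₀`. -/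
noncomputable def lameCombination (L : PeriodPair) (τ₀ : ℝ) (μ x₀ w₀ : ℂ) (τ : ℝ) : ℂ :=
  (1 / 2 * coeffM L τ₀ μ 1 * x₀ - coeffN L τ₀ μ * w₀) * lameSol L τ₀ μ 1 τ +
    (1 / 2 * coeffM L τ₀ μ (-1) * x₀ + coeffN L τ₀ μ * w₀) * lameSol L τ₀ μ (-1) τ

/-- If the initial logarithmic derivative is `(℘' + W) / (2 (℘ - ℘(μ)))` with `W² = ℘'(μ)²`, the
combination is a multiple of one of the functions `y_±`. -/
lemma exists_lameCombination_eq {x₀ w₀ W : ℂ}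
    (hD : L.derivWeierstrassP μ ≠ 0) (hW : W ^ 2 = L.derivWeierstrassP μ ^ 2)
    (hw : 2 * (L.weierstrassP (-(τ₀ : ℂ) + L.ω₂ / 2) - L.weierstrassP μ) * w₀ =
      (L.derivWeierstrassP (-(τ₀ : ℂ) + L.ω₂ / 2) + W) * x₀) :
    ∃ ε : ℂ, (ε = 1 ∨ ε = -1) ∧ W = -ε * L.derivWeierstrassP μ ∧
      lameCombination L τ₀ μ x₀ w₀ = fun τ => x₀ * lameSol L τ₀ μ ε τ := by
  have hN : coeffN L τ₀ μ * w₀ = 1 / 2 *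
      ((L.derivWeierstrassP (-(τ₀ : ℂ) + L.ω₂ / 2) + W) * x₀) / L.derivWeierstrassP μ := by
    rw [← hw, coeffN]; field_simp
  rcases sq_eq_sq_iff_eq_or_eq_neg.mp hW with h | h
  · refine ⟨-1, .inr rfl, by rw [h]; ring, ?_⟩
    ext τ
    rw [lameCombination, hN, h, coeffM, coeffM]
    field_simp
    ring
  · refine ⟨1, .inl rfl, by rw [h]; ring, ?_⟩
    ext τ
    rw [lameCombination, hN, h, coeffM, coeffM]
    field_simp
    ring

/-- Initial value, zeros and logarithmic derivative of a combination that is a multiple of one of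
the functions `y_±`. -/
lemma lameCombination_spec {x₀ w₀ W : ℂ} (hμ : μ ∉ L.lattice)
    (hz : ∀ τ : ℝ, (τ : ℂ) - τ₀ + L.ω₂ / 2 ∉ L.lattice)
    (hne : ∀ τ : ℝ, L.weierstrassP ((τ : ℂ) - τ₀ + L.ω₂ / 2) ≠ L.weierstrassP μ)
    (hD : L.derivWeierstrassP μ ≠ 0) (hW : W ^ 2 = L.derivWeierstrassP μ ^ 2)
    (hw : 2 * (L.weierstrassP (-(τ₀ : ℂ) + L.ω₂ / 2) - L.weierstrassP μ) * w₀ =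
      (L.derivWeierstrassP (-(τ₀ : ℂ) + L.ω₂ / 2) + W) * x₀) :
    lameCombination L τ₀ μ x₀ w₀ 0 = x₀ ∧
    (x₀ ≠ 0 → ∀ τ, lameCombination L τ₀ μ x₀ w₀ τ ≠ 0) ∧
    ∀ τ : ℝ, HasDerivAt (lameCombination L τ₀ μ x₀ w₀)
      (1 / 2 * (L.derivWeierstrassP ((τ : ℂ) - τ₀ + L.ω₂ / 2) + W) /
        (L.weierstrassP ((τ : ℂ) - τ₀ + L.ω₂ / 2) - L.weierstrassP μ) *
        lameCombination L τ₀ μ x₀ w₀ τ) τ := by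
  obtain ⟨ε, hε, hWε, hX⟩ := exists_lameCombination_eq hD hW hw
  rw [hX]
  refine ⟨by simp [lameSol_zero hε hz hne], fun hx τ =>
    mul_ne_zero hx (lameSol_ne_zero hε hz hne τ), fun τ => ?_⟩
  refine ((hasDerivAt_lameSol hε hμ hz hne τ).const_mul x₀).congr_deriv ?_
  rw [hWε]; ring

end lame

lemma hasDerivAt_comp_mul_left {E : Type*} [NormedAddCommGroup E] [NormedSpace ℝ E] {f : ℝ → E}
    {f' : E} {s t : ℝ} (h : HasDerivAt f f' (s * t)) :
    HasDerivAt (fun t => f (s * t)) (s • f') t := by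
  have h1 : HasDerivAt (fun t : ℝ => s * t) s t := by simpa using (hasDerivAt_id t).const_mul s
  exact h.scomp t h1

/-! ### The solution of the Euler equations -/

variable {α : Matrix (Fin 3) (Fin 3) ℝ}

lemma root₄_ne_zero (hα : α 0 2 < α 1 2) (hα' : α 1 2 < α 0 1) {a b c : ℂ} (h : h₄ a b c ≠ 0) :
    root₄ α a b c ≠ 0 :=
  mul_ne_zero (div_ne_zero (by linarith) (timeScale_pos hα hα').ne') h

/-- `d|c|²/dτ + iκh₄ = 2iκ ā b c̄`, with `κ = (α₁₂ - α₁₃) / √((α₁₂ - α₂₃)(α₂₃ - α₁₃))`. -/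
lemma speedC_add_root₄ (a b c : ℂ) : (speedC α a b c : ℂ) + Complex.I * root₄ α a b c =
    2 * Complex.I * ((α 0 1 - α 0 2) / timeScale α : ℝ) * (conj a * b * conj c) := by
  rw [speedC_eq, root₄, IsEulerSolution.h₄_eq_re]
  generalize conj a * b * conj c = F
  conv_rhs => rw [← Complex.re_add_im F]
  push_cast
  linear_combination -2 * ((α 0 1 : ℂ) - α 0 2) / timeScale α * F.im * Complex.I_sq

lemma speedC_sub_root₄ (a b c : ℂ) : (speedC α a b c : ℂ) - Complex.I * root₄ α a b c =
    -2 * Complex.I * ((α 0 1 - α 0 2) / timeScale α : ℝ) * (a * conj b * c) := by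
  have := congrArg conj (speedC_add_root₄ (α := α) a b c)
  simpa [sub_eq_add_neg, Complex.conj_ofNat] using this

lemma kappa_a (hα : α 0 2 < α 1 2) (hα' : α 1 2 < α 0 1) :
    timeScale α * √((α 1 2 - α 0 2) / (α 0 1 - α 1 2)) = α 1 2 - α 0 2 := by
  have h1 : 0 < α 0 1 - α 1 2 := by linarith
  have h2 : 0 < α 1 2 - α 0 2 := by linarith
  rw [timeScale, ← Real.sqrt_mul (mul_pos h1 h2).le,
    show (α 0 1 - α 1 2) * (α 1 2 - α 0 2) * ((α 1 2 - α 0 2) / (α 0 1 - α 1 2)) =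
      (α 1 2 - α 0 2) ^ 2 by field_simp]
  exact Real.sqrt_sq h2.le

lemma kappa_b (hα : α 0 2 < α 1 2) (hα' : α 1 2 < α 0 1) :
    timeScale α * √((α 0 1 - α 1 2) / (α 1 2 - α 0 2)) = α 0 1 - α 1 2 := by
  have h1 : 0 < α 0 1 - α 1 2 := by linarith
  have h2 : 0 < α 1 2 - α 0 2 := by linarith
  rw [timeScale, ← Real.sqrt_mul (mul_pos h1 h2).le,
    show (α 0 1 - α 1 2) * (α 1 2 - α 0 2) * ((α 0 1 - α 1 2) / (α 1 2 - α 0 2)) =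
      (α 0 1 - α 1 2) ^ 2 by field_simp]
  exact Real.sqrt_sq h1.le

/-- The first Euler equation with `b c̄` eliminated. -/
lemma euler_a_eq (hα : α 0 2 < α 1 2) (hα' : α 1 2 < α 0 1) (a b c : ℂ) :
    2 * ((‖c‖ ^ 2 - I₂ α a c : ℝ) : ℂ) * (-Complex.I * ((α 1 2 - α 0 2 : ℝ) : ℂ) * (b * conj c)) =
      timeScale α * ((speedC α a b c + Complex.I * root₄ α a b c) * a) := by
  have h1 := norm_sq_a_eq hα hα' a c
  have h2 : ((α 1 2 - α 0 2) * (‖c‖ ^ 2 - I₂ α a c) : ℝ) = -(α 0 1 - α 0 2) * ‖a‖ ^ 2 := by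
    have : α 0 1 - α 0 2 ≠ 0 := by linarith
    rw [h1]; field_simp; ring
  have h3 : ((timeScale α : ℂ)) ≠ 0 := by exact_mod_cast (timeScale_pos hα hα').ne'
  rw [speedC_add_root₄]
  have h4 := congrArg (fun x : ℝ => (x : ℂ)) h2
  simp only [Complex.ofReal_mul, Complex.ofReal_pow, Complex.ofReal_neg, ← Complex.conj_mul'] at h4
  have h5 : ((((α 0 1 - α 0 2) / timeScale α : ℝ)) : ℂ) * timeScale α = (α 0 1 - α 0 2 : ℝ) := by
    rw [← Complex.ofReal_mul, div_mul_cancel₀ _ (timeScale_pos hα hα').ne']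
  linear_combination -2 * Complex.I * (b * conj c) * h4 -
    2 * Complex.I * conj a * b * conj c * a * h5

lemma euler_b_eq (hα : α 0 2 < α 1 2) (hα' : α 1 2 < α 0 1) (a b c : ℂ) :
    2 * ((‖c‖ ^ 2 - I₃ α b c : ℝ) : ℂ) * (-Complex.I * ((α 1 2 - α 0 1 : ℝ) : ℂ) * (a * c)) =
      timeScale α * ((speedC α a b c - Complex.I * root₄ α a b c) * b) := by
  have h1 := norm_sq_b_eq hα hα' b c
  have h2 : ((α 1 2 - α 0 1) * (‖c‖ ^ 2 - I₃ α b c) : ℝ) = (α 0 1 - α 0 2) * ‖b‖ ^ 2 := by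
    have : α 0 1 - α 0 2 ≠ 0 := by linarith
    rw [h1]; field_simp; ring
  rw [speedC_sub_root₄]
  have h4 := congrArg (fun x : ℝ => (x : ℂ)) h2
  simp only [Complex.ofReal_mul, Complex.ofReal_pow, ← Complex.conj_mul'] at h4
  have h5 : ((((α 0 1 - α 0 2) / timeScale α : ℝ)) : ℂ) * timeScale α = (α 0 1 - α 0 2 : ℝ) := by
    rw [← Complex.ofReal_mul, div_mul_cancel₀ _ (timeScale_pos hα hα').ne']
  linear_combination -2 * Complex.I * (a * c) * h4 +
    2 * Complex.I * a * conj b * c * b * h5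

lemma euler_c_eq (hα : α 0 2 < α 1 2) (hα' : α 1 2 < α 0 1) (a b c : ℂ) :
    2 * ((‖c‖ ^ 2 : ℝ) : ℂ) * (-Complex.I * ((α 0 2 - α 0 1 : ℝ) : ℂ) * (conj a * b)) =
      timeScale α * ((speedC α a b c + Complex.I * root₄ α a b c) * c) := by
  rw [speedC_add_root₄]
  have h5 : ((((α 0 1 - α 0 2) / timeScale α : ℝ)) : ℂ) * timeScale α = (α 0 1 - α 0 2 : ℝ) := by
    rw [← Complex.ofReal_mul, div_mul_cancel₀ _ (timeScale_pos hα hα').ne']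
  simp only [Complex.ofReal_pow, ← Complex.conj_mul']
  push_cast at h5 ⊢
  linear_combination - 2 * Complex.I * conj a * b * conj c * c * h5

end FlagThree

namespace FlagThree

/-- The line `τ - τ₀ + ω₂` is real for `℘` and `℘'`, the invariants are those of the initial data,
and the shift is adapted to them. -/
structure IsAdapted (α : Matrix (Fin 3) (Fin 3) ℝ) (a₀ b₀ c₀ : ℂ) (L : PeriodPair) (τ₀ : ℝ)
    (R P : ℝ → ℝ) : Prop extends IsRealOnLine L τ₀ R P where
  g₂_eq : L.g₂ = g₂ α a₀ b₀ c₀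
  g₃_eq : L.g₃ = g₃ α a₀ b₀ c₀
  R_zero : R 0 = ‖c₀‖ ^ 2 - (I₂ α a₀ c₀ + I₃ α b₀ c₀) / 3
  P_zero : P 0 = speedC α a₀ b₀ c₀

variable {α : Matrix (Fin 3) (Fin 3) ℝ} {a₀ b₀ c₀ : ℂ} {L : PeriodPair} {τ₀ : ℝ} {R P : ℝ → ℝ}
  {a b c : ℝ → ℂ}

/-- The second derivative of `|c|²` with respect to `τ` is `6Y² - g₂/2`, where
`Y = |c|² - (I₂ + I₃)/3`. -/
lemma IsEulerSolution.hasDerivAt_speedC (h : IsEulerSolution α a b c) (hα : α 0 2 < α 1 2)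
    (hα' : α 1 2 < α 0 1) (t : ℝ) :
    HasDerivAt (fun t => speedC α (a t) (b t) (c t)) (timeScale α *
      (6 * (‖c t‖ ^ 2 - (I₂ α (a 0) (c 0) + I₃ α (b 0) (c 0)) / 3) ^ 2 -
        g₂ α (a 0) (b 0) (c 0) / 2)) t := by
  have hs := (timeScale_pos hα hα').ne'
  have hs2 := timeScale_sq hα hα'
  have e1 := norm_sq_a_eq hα hα' (a t) (c t)
  have e2 := norm_sq_b_eq hα hα' (b t) (c t)
  simp only [speedC_eq]
  refine ((hasDerivAt_im (h.hasDerivAt_prod t)).const_mul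
    (-2 * (α 0 1 - α 0 2) / timeScale α)).congr_deriv ?_
  rw [Complex.I_mul_im, Complex.ofReal_re, e1, e2, h.I₂_eq, h.I₃_eq, g₂]
  have h6 : α 0 1 - α 0 2 ≠ 0 := by linarith
  field_simp
  rw [hs2]
  ring

/-- For a solution of the Euler equations `(|c|², d|c|²/dτ)` solves the equation of
`(℘, ℘')` up to a constant. -/
lemma IsAdapted.eq_of_isEulerSolution (H : IsAdapted α a₀ b₀ c₀ L τ₀ R P) (hα : α 0 2 < α 1 2)
    (hα' : α 1 2 < α 0 1) (h : IsEulerSolution α a b c) (ha : a 0 = a₀) (hb : b 0 = b₀)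
    (hc : c 0 = c₀) (t : ℝ) :
    ‖c t‖ ^ 2 - (I₂ α a₀ c₀ + I₃ α b₀ c₀) / 3 = R (timeScale α * t) ∧
      speedC α (a t) (b t) (c t) = P (timeScale α * t) := by
  subst ha hb hc
  have hs := (timeScale_pos hα hα').ne'
  set g := g₂ α (a 0) (b 0) (c 0)
  have hv : ContDiff ℝ 1 (fun x : ℝ × ℝ => (timeScale α * x.2, timeScale α *
      (6 * x.1 ^ 2 - g / 2))) := by fun_prop
  have key := eq_of_hasDerivAt_of_contDiff hv
    (f := fun t => (‖c t‖ ^ 2 - (I₂ α (a 0) (c 0) + I₃ α (b 0) (c 0)) / 3,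
      speedC α (a t) (b t) (c t)))
    (g := fun t => (R (timeScale α * t), P (timeScale α * t))) (fun t => ?_) (fun t => ?_) ?_
  · exact ⟨congrArg Prod.fst (congrFun key t), congrArg Prod.snd (congrFun key t)⟩
  · refine HasDerivAt.prodMk ?_ (h.hasDerivAt_speedC hα hα' t)
    refine ((h.hasDerivAt_norm_sq_c t).sub_const _).congr_deriv ?_
    rw [speedC_eq]
    field_simp
  · exact (hasDerivAt_comp_mul_left (H.hasDerivAt_weierstrassP _)).prodMk
      (hasDerivAt_comp_mul_left (H.hasDerivAt_derivWeierstrassP H.g₂_eq _))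
  · simp [H.R_zero, H.P_zero]

/-- The cubic equation of the curve, with the values `℘(μ)` in place of its roots. -/
lemma IsAdapted.sq_add_sq (H : IsAdapted α a₀ b₀ c₀ L τ₀ R P) (hα : α 0 2 < α 1 2)
    (hα' : α 1 2 < α 0 1) (τ : ℝ) :
    P τ ^ 2 + root₄ α a₀ b₀ c₀ ^ 2 = 4 * (R τ - (2 * I₂ α a₀ c₀ / 3 - I₃ α b₀ c₀ / 3)) *
      (R τ - (-(I₂ α a₀ c₀) / 3 + 2 * I₃ α b₀ c₀ / 3)) *
      (R τ - (-(I₂ α a₀ c₀) / 3 - I₃ α b₀ c₀ / 3)) := by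
  rw [H.sq_eq H.g₂_eq H.g₃_eq, cubic_eq, root₄_sq hα hα']
  ring

/-- If `h₄ ≠ 0`, the function `℘` avoids the three values `℘(μ)` on the line: the cubic is negative
at these values, but equal to the square of a real number on the line. -/
lemma IsAdapted.ne (H : IsAdapted α a₀ b₀ c₀ L τ₀ R P) (hα : α 0 2 < α 1 2)
    (hα' : α 1 2 < α 0 1) (h0 : h₄ a₀ b₀ c₀ ≠ 0) (τ : ℝ) :
    R τ ≠ 2 * I₂ α a₀ c₀ / 3 - I₃ α b₀ c₀ / 3 ∧ R τ ≠ -(I₂ α a₀ c₀) / 3 + 2 * I₃ α b₀ c₀ / 3 ∧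
      R τ ≠ -(I₂ α a₀ c₀) / 3 - I₃ α b₀ c₀ / 3 := by
  have h1 := H.sq_add_sq hα hα' τ
  have h2 : 0 < root₄ α a₀ b₀ c₀ ^ 2 := by have := root₄_ne_zero hα hα' h0; positivity
  refine ⟨fun h => ?_, fun h => ?_, fun h => ?_⟩ <;>
  · rw [h] at h1
    simp only [sub_self, mul_zero, zero_mul] at h1
    nlinarith [sq_nonneg (P τ)]

/-- At a solution of `℘(μ) = r` for one of the three values of `r` the derivative `℘'(μ)` is
`± iκh₄`. -/
lemma IsAdapted.derivWeierstrassP_sq (H : IsAdapted α a₀ b₀ c₀ L τ₀ R P) (hα : α 0 2 < α 1 2)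
    (hα' : α 1 2 < α 0 1) {μ : ℂ} {r : ℝ} (hμ : IsWeierstrassRoot L μ r)
    (hr : r = 2 * I₂ α a₀ c₀ / 3 - I₃ α b₀ c₀ / 3 ∨ r = -(I₂ α a₀ c₀) / 3 + 2 * I₃ α b₀ c₀ / 3 ∨
      r = -(I₂ α a₀ c₀) / 3 - I₃ α b₀ c₀ / 3) :
    L.derivWeierstrassP μ ^ 2 = (Complex.I * root₄ α a₀ b₀ c₀) ^ 2 := by
  have h1 := cubic_eq (α := α) r a₀ b₀ c₀
  have h2 : 4 * r ^ 3 - g₂ α a₀ b₀ c₀ * r - g₃ α a₀ b₀ c₀ = -root₄ α a₀ b₀ c₀ ^ 2 := by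
    rw [h1, root₄_sq hα hα']
    rcases hr with rfl | rfl | rfl <;> ring
  rw [L.derivWeierstrassP_sq μ hμ.1, hμ.2, H.g₂_eq, H.g₃_eq, mul_pow, Complex.I_sq]
  have := congrArg (fun x : ℝ => (x : ℂ)) h2
  push_cast at this
  rw [this]; ring

/-- One component of the explicit solution: initial value and logarithmic derivative. -/
lemma IsAdapted.lameCombination_spec (H : IsAdapted α a₀ b₀ c₀ L τ₀ R P) (hα : α 0 2 < α 1 2)
    (hα' : α 1 2 < α 0 1) (h0 : h₄ a₀ b₀ c₀ ≠ 0) {μ : ℂ} {r : ℝ} (hμ : IsWeierstrassRoot L μ r)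
    (hr : r = 2 * I₂ α a₀ c₀ / 3 - I₃ α b₀ c₀ / 3 ∨ r = -(I₂ α a₀ c₀) / 3 + 2 * I₃ α b₀ c₀ / 3 ∨
      r = -(I₂ α a₀ c₀) / 3 - I₃ α b₀ c₀ / 3) {δ : ℂ} (hδ : δ = 1 ∨ δ = -1) {x₀ w₀ : ℂ}
    (hx : x₀ ≠ 0)
    (hw : 2 * ((R 0 - r : ℝ) : ℂ) * w₀ =
      (speedC α a₀ b₀ c₀ + δ * (Complex.I * root₄ α a₀ b₀ c₀)) * x₀) :
    lameCombination L τ₀ μ x₀ w₀ 0 = x₀ ∧ (∀ τ, lameCombination L τ₀ μ x₀ w₀ τ ≠ 0) ∧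
    ∀ t : ℝ, HasDerivAt (fun t => lameCombination L τ₀ μ x₀ w₀ (timeScale α * t))
      (timeScale α * (1 / 2 * (P (timeScale α * t) + δ * (Complex.I * root₄ α a₀ b₀ c₀)) /
        ((R (timeScale α * t) - r : ℝ) : ℂ)) *
        lameCombination L τ₀ μ x₀ w₀ (timeScale α * t)) t := by
  have hδ2 : δ ^ 2 = 1 := by rcases hδ with rfl | rfl <;> norm_num
  have hsq := H.derivWeierstrassP_sq hα hα' hμ hr
  have hroot : (root₄ α a₀ b₀ c₀ : ℂ) ≠ 0 := by exact_mod_cast root₄_ne_zero hα hα' h0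
  have hD : L.derivWeierstrassP μ ≠ 0 := by
    intro h
    rw [h, zero_pow two_ne_zero] at hsq
    exact pow_ne_zero 2 (mul_ne_zero Complex.I_ne_zero hroot) hsq.symm
  have hne : ∀ τ : ℝ, L.weierstrassP ((τ : ℂ) - τ₀ + L.ω₂ / 2) ≠ L.weierstrassP μ := fun τ => by
    rw [H.weierstrassP_eq, hμ.2]
    obtain ⟨n1, n2, n3⟩ := H.ne hα hα' h0 τ
    norm_cast
    rcases hr with rfl | rfl | rfl <;> assumption
  have e0 : L.weierstrassP (-(τ₀ : ℂ) + L.ω₂ / 2) = R 0 := by simpa using H.weierstrassP_eq 0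
  have e1 : L.derivWeierstrassP (-(τ₀ : ℂ) + L.ω₂ / 2) = P 0 := by
    simpa using H.derivWeierstrassP_eq 0
  obtain ⟨s1, s2, s3⟩ := FlagThree.lameCombination_spec (x₀ := x₀) (w₀ := w₀)
    (W := δ * (Complex.I * root₄ α a₀ b₀ c₀)) hμ.1 H.notMem hne hD
    (by rw [mul_pow, hδ2, hsq, one_mul])
    (by rw [e0, e1, hμ.2, H.P_zero, ← Complex.ofReal_sub, hw])
  refine ⟨s1, s2 hx, fun t => ?_⟩
  refine (hasDerivAt_comp_mul_left (s3 (timeScale α * t))).congr_deriv ?_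
  rw [H.derivWeierstrassP_eq, H.weierstrassP_eq, hμ.2, Complex.real_smul, Complex.ofReal_sub]
  ring

/-- The three functions of the explicit solution: initial values, and logarithmic derivatives with
respect to `t`. -/
lemma IsAdapted.sol_spec (H : IsAdapted α a₀ b₀ c₀ L τ₀ R P) (hα : α 0 2 < α 1 2)
    (hα' : α 1 2 < α 0 1) (h0 : h₄ a₀ b₀ c₀ ≠ 0) {μ₁ μ₂ μ₃ : ℂ}
    (h1 : IsWeierstrassRoot L μ₁ (2 * I₂ α a₀ c₀ / 3 - I₃ α b₀ c₀ / 3))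
    (h2 : IsWeierstrassRoot L μ₂ (-(I₂ α a₀ c₀) / 3 + 2 * I₃ α b₀ c₀ / 3))
    (h3 : IsWeierstrassRoot L μ₃ (-(I₂ α a₀ c₀) / 3 - I₃ α b₀ c₀ / 3)) :
    (solA α a₀ b₀ c₀ L τ₀ μ₁ 0 = a₀ ∧ (∀ τ, solA α a₀ b₀ c₀ L τ₀ μ₁ τ ≠ 0) ∧
      ∀ t : ℝ, HasDerivAt (fun t => solA α a₀ b₀ c₀ L τ₀ μ₁ (timeScale α * t))
        (timeScale α * (1 / 2 * (P (timeScale α * t) + 1 * (Complex.I * root₄ α a₀ b₀ c₀)) /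
        ((R (timeScale α * t) - (2 * I₂ α a₀ c₀ / 3 - I₃ α b₀ c₀ / 3) : ℝ) : ℂ)) *
        solA α a₀ b₀ c₀ L τ₀ μ₁ (timeScale α * t)) t) ∧
    (solB α a₀ b₀ c₀ L τ₀ μ₂ 0 = b₀ ∧ (∀ τ, solB α a₀ b₀ c₀ L τ₀ μ₂ τ ≠ 0) ∧
      ∀ t : ℝ, HasDerivAt (fun t => solB α a₀ b₀ c₀ L τ₀ μ₂ (timeScale α * t))
        (timeScale α * (1 / 2 * (P (timeScale α * t) + -1 * (Complex.I * root₄ α a₀ b₀ c₀)) /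
        ((R (timeScale α * t) - (-(I₂ α a₀ c₀) / 3 + 2 * I₃ α b₀ c₀ / 3) : ℝ) : ℂ)) *
        solB α a₀ b₀ c₀ L τ₀ μ₂ (timeScale α * t)) t) ∧
    (solC α a₀ b₀ c₀ L τ₀ μ₃ 0 = c₀ ∧ (∀ τ, solC α a₀ b₀ c₀ L τ₀ μ₃ τ ≠ 0) ∧
      ∀ t : ℝ, HasDerivAt (fun t => solC α a₀ b₀ c₀ L τ₀ μ₃ (timeScale α * t))
        (timeScale α * (1 / 2 * (P (timeScale α * t) + 1 * (Complex.I * root₄ α a₀ b₀ c₀)) /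
        ((R (timeScale α * t) - (-(I₂ α a₀ c₀) / 3 - I₃ α b₀ c₀ / 3) : ℝ) : ℂ)) *
        solC α a₀ b₀ c₀ L τ₀ μ₃ (timeScale α * t)) t) := by
  have hne : a₀ ≠ 0 ∧ b₀ ≠ 0 ∧ c₀ ≠ 0 := by
    refine ⟨?_, ?_, ?_⟩ <;> rintro rfl <;> exact h0 (by simp [h₄])
  have hs := timeScale_pos hα hα'
  have hs' : (timeScale α : ℂ) ≠ 0 := by exact_mod_cast hs.ne'
  have ka := congrArg (fun x : ℝ => (x : ℂ)) (kappa_a hα hα')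
  have kb := congrArg (fun x : ℝ => (x : ℂ)) (kappa_b hα hα')
  simp only [Complex.ofReal_mul] at ka kb
  refine ⟨?_, ?_, ?_⟩
  · have hX : solA α a₀ b₀ c₀ L τ₀ μ₁ = lameCombination L τ₀ μ₁ a₀
        (-Complex.I * (√((α 1 2 - α 0 2) / (α 0 1 - α 1 2)) : ℝ) * (b₀ * conj c₀)) := by
      ext τ; rw [solA, lameCombination, coeffA, coeffA]; ring
    rw [hX]
    refine H.lameCombination_spec hα hα' h0 h1 (.inl rfl) (.inl rfl) hne.1
      (mul_left_cancel₀ hs' ?_)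
    rw [one_mul, ← euler_a_eq hα hα', ← ka, H.R_zero]
    push_cast
    ring
  · have hX : solB α a₀ b₀ c₀ L τ₀ μ₂ = lameCombination L τ₀ μ₂ b₀
        (Complex.I * (√((α 0 1 - α 1 2) / (α 1 2 - α 0 2)) : ℝ) * (a₀ * c₀)) := by
      ext τ; rw [solB, lameCombination, coeffB, coeffB]; ring
    rw [hX]
    refine H.lameCombination_spec hα hα' h0 h2 (.inr (.inl rfl)) (.inr rfl) hne.2.1
      (mul_left_cancel₀ hs' ?_)
    rw [neg_one_mul, ← sub_eq_add_neg, ← euler_b_eq hα hα', ← neg_sub (α 0 1) (α 1 2),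
      Complex.ofReal_neg, ← kb, H.R_zero]
    push_cast
    ring
  · have hX : solC α a₀ b₀ c₀ L τ₀ μ₃ = lameCombination L τ₀ μ₃ c₀
        (Complex.I * ((α 0 1 - α 0 2) / timeScale α : ℝ) * (conj a₀ * b₀)) := by
      ext τ; rw [solC, lameCombination, coeffC, coeffC, timeScale]; ring
    rw [hX]
    refine H.lameCombination_spec hα hα' h0 h3 (.inr (.inr rfl)) (.inl rfl) hne.2.2
      (mul_left_cancel₀ hs' ?_)
    rw [one_mul, ← euler_c_eq hα hα', H.R_zero]
    push_cast
    field_simp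
    ring

/-- A solution of the Euler equations is given by the explicit formulas: both satisfy the same
scalar linear equations. -/
lemma IsAdapted.eq_sol (H : IsAdapted α a₀ b₀ c₀ L τ₀ R P) (hα : α 0 2 < α 1 2)
    (hα' : α 1 2 < α 0 1) (h0 : h₄ a₀ b₀ c₀ ≠ 0) {μ₁ μ₂ μ₃ : ℂ}
    (h1 : IsWeierstrassRoot L μ₁ (2 * I₂ α a₀ c₀ / 3 - I₃ α b₀ c₀ / 3))
    (h2 : IsWeierstrassRoot L μ₂ (-(I₂ α a₀ c₀) / 3 + 2 * I₃ α b₀ c₀ / 3))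
    (h3 : IsWeierstrassRoot L μ₃ (-(I₂ α a₀ c₀) / 3 - I₃ α b₀ c₀ / 3))
    (h : IsEulerSolution α a b c) (ha : a 0 = a₀) (hb : b 0 = b₀) (hc : c 0 = c₀) :
    (a = fun t => solA α a₀ b₀ c₀ L τ₀ μ₁ (timeScale α * t)) ∧
    (b = fun t => solB α a₀ b₀ c₀ L τ₀ μ₂ (timeScale α * t)) ∧
    (c = fun t => solC α a₀ b₀ c₀ L τ₀ μ₃ (timeScale α * t)) := by
  obtain ⟨⟨a1, a2, a3⟩, ⟨b1, b2, b3⟩, ⟨c1, c2, c3⟩⟩ := H.sol_spec hα hα' h0 h1 h2 h3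
  have hR := fun t => (H.eq_of_isEulerSolution hα hα' h ha hb hc t).1
  have hP := fun t => (H.eq_of_isEulerSolution hα hα' h ha hb hc t).2
  have hI2 : ∀ t, I₂ α (a t) (c t) = I₂ α a₀ c₀ := fun t => by rw [h.I₂_eq, ha, hc]
  have hI3 : ∀ t, I₃ α (b t) (c t) = I₃ α b₀ c₀ := fun t => by rw [h.I₃_eq, hb, hc]
  have hI4 : ∀ t, root₄ α (a t) (b t) (c t) = root₄ α a₀ b₀ c₀ := fun t => by
    rw [root₄, root₄, h.h₄_eq, ha, hb, hc]
  have hn := fun t => H.ne hα hα' h0 (timeScale α * t)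
  refine ⟨eq_of_hasDerivAt_mul (fun t => ?_) a3 (fun t => a2 _) (by simp [a1, ha]),
    eq_of_hasDerivAt_mul (fun t => ?_) b3 (fun t => b2 _) (by simp [b1, hb]),
    eq_of_hasDerivAt_mul (fun t => ?_) c3 (fun t => c2 _) (by simp [c1, hc])⟩
  · refine (h.hasDerivAt_a t).congr_deriv ?_
    have e := euler_a_eq hα hα' (a t) (b t) (c t)
    rw [hI2, hI4, hP, show ‖c t‖ ^ 2 - I₂ α a₀ c₀ = R (timeScale α * t) -
      (2 * I₂ α a₀ c₀ / 3 - I₃ α b₀ c₀ / 3) by rw [← hR]; ring] at e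
    have hd : ((R (timeScale α * t) - (2 * I₂ α a₀ c₀ / 3 - I₃ α b₀ c₀ / 3) : ℝ) : ℂ) ≠ 0 := by
      rw [Complex.ofReal_ne_zero, sub_ne_zero]; exact (hn t).1
    generalize ((R (timeScale α * t) - (2 * I₂ α a₀ c₀ / 3 - I₃ α b₀ c₀ / 3) : ℝ) : ℂ) = d at *
    field_simp
    linear_combination e
  · refine (h.hasDerivAt_b t).congr_deriv ?_
    have e := euler_b_eq hα hα' (a t) (b t) (c t)
    rw [hI3, hI4, hP, show ‖c t‖ ^ 2 - I₃ α b₀ c₀ = R (timeScale α * t) -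
      (-(I₂ α a₀ c₀) / 3 + 2 * I₃ α b₀ c₀ / 3) by rw [← hR]; ring] at e
    have hd : ((R (timeScale α * t) - (-(I₂ α a₀ c₀) / 3 + 2 * I₃ α b₀ c₀ / 3) : ℝ) : ℂ) ≠ 0 := by
      rw [Complex.ofReal_ne_zero, sub_ne_zero]; exact (hn t).2.1
    generalize ((R (timeScale α * t) - (-(I₂ α a₀ c₀) / 3 + 2 * I₃ α b₀ c₀ / 3) : ℝ) : ℂ) = d at *
    field_simp
    linear_combination e
  · refine (h.hasDerivAt_c t).congr_deriv ?_
    have e := euler_c_eq hα hα' (a t) (b t) (c t)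
    rw [hI4, hP, show ‖c t‖ ^ 2 = R (timeScale α * t) -
      (-(I₂ α a₀ c₀) / 3 - I₃ α b₀ c₀ / 3) by rw [← hR]; ring] at e
    have hd : ((R (timeScale α * t) - (-(I₂ α a₀ c₀) / 3 - I₃ α b₀ c₀ / 3) : ℝ) : ℂ) ≠ 0 := by
      rw [Complex.ofReal_ne_zero, sub_ne_zero]; exact (hn t).2.2
    generalize ((R (timeScale α * t) - (-(I₂ α a₀ c₀) / 3 - I₃ α b₀ c₀ / 3) : ℝ) : ℂ) = d at *
    field_simp
    linear_combination e

/-- A function with logarithmic derivative `s (P + iH) / (2 (R - r))`, where `R' = s P`, has a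
squared absolute value proportional to `R - r`. -/
lemma conj_mul_self_eq {x : ℝ → ℂ} {R P : ℝ → ℝ} {s r H k : ℝ}
    (hR : ∀ t, HasDerivAt R (s * P t) t) (hne : ∀ t, R t ≠ r)
    (hx : ∀ t, HasDerivAt x (s * (1 / 2 * (P t + Complex.I * H) / ((R t - r : ℝ) : ℂ)) * x t) t)
    (hk : k ≠ 0) (h0 : conj (x 0) * x 0 = k * (R 0 - r : ℝ)) (t : ℝ) :
    conj (x t) * x t = k * (R t - r : ℝ) := by
  have hd : ∀ t, ((R t - r : ℝ) : ℂ) ≠ 0 := fun t => by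
    rw [Complex.ofReal_ne_zero, sub_ne_zero]; exact hne t
  refine congrFun (eq_of_hasDerivAt_mul (q := fun t => s * P t / ((R t - r : ℝ) : ℂ))
    (f := fun t => conj (x t) * x t) (g := fun t => k * ((R t - r : ℝ) : ℂ))
    (fun t => ?_) (fun t => ?_) (fun t => mul_ne_zero (by exact_mod_cast hk) (hd t)) h0) t
  · refine ((hasDerivAt_conj (hx t)).mul (hx t)).congr_deriv ?_
    have := hd t
    simp only [map_mul, map_div₀, map_add, Complex.conj_ofReal, Complex.conj_I, map_one,
      Complex.conj_ofNat]
    field_simp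
    ring
  · refine (((hR t).sub_const r).ofReal_comp.const_mul (k : ℂ)).congr_deriv ?_
    have := hd t
    push_cast at this ⊢
    field_simp

/-- The explicit formulas solve the Euler equations: `|a|²`, `|b|²`, `|c|²` are multiples of
`℘ - ℘(μᵢ)`, and `ā b c̄` and `℘' + iκh₄` are proportional, because both have the same logarithmic
derivative. -/
lemma IsAdapted.isEulerSolution_sol (H : IsAdapted α a₀ b₀ c₀ L τ₀ R P) (hα : α 0 2 < α 1 2)
    (hα' : α 1 2 < α 0 1) (h0 : h₄ a₀ b₀ c₀ ≠ 0) {μ₁ μ₂ μ₃ : ℂ}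
    (h1 : IsWeierstrassRoot L μ₁ (2 * I₂ α a₀ c₀ / 3 - I₃ α b₀ c₀ / 3))
    (h2 : IsWeierstrassRoot L μ₂ (-(I₂ α a₀ c₀) / 3 + 2 * I₃ α b₀ c₀ / 3))
    (h3 : IsWeierstrassRoot L μ₃ (-(I₂ α a₀ c₀) / 3 - I₃ α b₀ c₀ / 3)) :
    IsEulerSolution α (fun t => solA α a₀ b₀ c₀ L τ₀ μ₁ (timeScale α * t))
      (fun t => solB α a₀ b₀ c₀ L τ₀ μ₂ (timeScale α * t))
      (fun t => solC α a₀ b₀ c₀ L τ₀ μ₃ (timeScale α * t)) := by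
  obtain ⟨⟨a1, a2, a3⟩, ⟨b1, b2, b3⟩, ⟨c1, c2, c3⟩⟩ := H.sol_spec hα hα' h0 h1 h2 h3
  have hn := fun t => H.ne hα hα' h0 (timeScale α * t)
  have hs := timeScale_pos hα hα'
  have hs2 := timeScale_sq hα hα'
  have hR : ∀ t, HasDerivAt (fun t => R (timeScale α * t)) (timeScale α * P (timeScale α * t)) t :=
    fun t => hasDerivAt_comp_mul_left (H.hasDerivAt_weierstrassP _)
  have hP : ∀ t, HasDerivAt (fun t => P (timeScale α * t)) (timeScale α *
      (6 * R (timeScale α * t) ^ 2 - g₂ α a₀ b₀ c₀ / 2)) t :=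
    fun t => hasDerivAt_comp_mul_left (H.hasDerivAt_derivWeierstrassP H.g₂_eq _)
  have hcub := fun t => H.sq_add_sq hα hα' (timeScale α * t)
  have hroot := root₄_ne_zero hα hα' h0
  have hR0 : R (timeScale α * 0) = ‖c₀‖ ^ 2 - (I₂ α a₀ c₀ + I₃ α b₀ c₀) / 3 := by
    rw [mul_zero, H.R_zero]
  have hP0 : P (timeScale α * 0) = speedC α a₀ b₀ c₀ := by rw [mul_zero, H.P_zero]
  have hA : α 0 1 - α 0 2 ≠ 0 := by linarith
  have hB : α 1 2 - α 0 2 ≠ 0 := by linarith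
  have hC : α 0 1 - α 1 2 ≠ 0 := by linarith
  have ea := norm_sq_a_eq hα hα' a₀ c₀
  have eb := norm_sq_b_eq hα hα' b₀ c₀
  have eF := speedC_add_root₄ (α := α) a₀ b₀ c₀
  have eg : g₂ α a₀ b₀ c₀ = 4 / 3 * (I₂ α a₀ c₀ ^ 2 - I₂ α a₀ c₀ * I₃ α b₀ c₀ +
    I₃ α b₀ c₀ ^ 2) := rfl
  generalize hRR : (fun t => R (timeScale α * t)) = R' at hR hP
  generalize hPP : (fun t => P (timeScale α * t)) = P' at hR hP
  have hRt : ∀ t, R (timeScale α * t) = R' t := fun t => congrFun hRR t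
  have hPt : ∀ t, P (timeScale α * t) = P' t := fun t => congrFun hPP t
  have a0 : solA α a₀ b₀ c₀ L τ₀ μ₁ (timeScale α * 0) = a₀ := by rw [mul_zero, a1]
  have b0 : solB α a₀ b₀ c₀ L τ₀ μ₂ (timeScale α * 0) = b₀ := by rw [mul_zero, b1]
  have c0 : solC α a₀ b₀ c₀ L τ₀ μ₃ (timeScale α * 0) = c₀ := by rw [mul_zero, c1]
  have a2' := fun t => a2 (timeScale α * t)
  have b2' := fun t => b2 (timeScale α * t)
  have c2' := fun t => c2 (timeScale α * t)
  simp only [hRt, hPt] at a3 b3 c3 hR hP hn hcub hR0 hP0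
  generalize hxa : (fun t => solA α a₀ b₀ c₀ L τ₀ μ₁ (timeScale α * t)) = x at a3 ⊢
  generalize hyb : (fun t => solB α a₀ b₀ c₀ L τ₀ μ₂ (timeScale α * t)) = y at b3 ⊢
  generalize hzc : (fun t => solC α a₀ b₀ c₀ L τ₀ μ₃ (timeScale α * t)) = z at c3 ⊢
  have hxt : ∀ t, solA α a₀ b₀ c₀ L τ₀ μ₁ (timeScale α * t) = x t := fun t => congrFun hxa t
  have hyt : ∀ t, solB α a₀ b₀ c₀ L τ₀ μ₂ (timeScale α * t) = y t := fun t => congrFun hyb t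
  have hzt : ∀ t, solC α a₀ b₀ c₀ L τ₀ μ₃ (timeScale α * t) = z t := fun t => congrFun hzc t
  simp only [hxt, hyt, hzt] at a3 b3 c3 a0 b0 c0 a2' b2' c2'
  clear a1 a2 b1 b2 c1 c2 hRt hPt hxt hyt hzt hRR hPP hxa hyb hzc h1 h2 h3 H
  generalize root₄ α a₀ b₀ c₀ = q at *
  generalize g₂ α a₀ b₀ c₀ = g at *
  generalize speedC α a₀ b₀ c₀ = p at *
  generalize I₂ α a₀ c₀ = i₂ at *
  generalize I₃ α b₀ c₀ = i₃ at *
  generalize timeScale α = s at *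
  generalize hAv : α 0 1 - α 0 2 = A at *
  generalize hBv : α 1 2 - α 0 2 = B at *
  generalize hCv : α 0 1 - α 1 2 = C at *
  have hs0 := hs.ne'
  -- the squared absolute values
  have na : ∀ t, conj (x t) * x t = (-(B / A) : ℝ) * ((R' t - (2 * i₂ / 3 - i₃ / 3) : ℝ) : ℂ) :=
    conj_mul_self_eq (s := s) (P := P') (H := q) hR (fun t => (hn t).1)
      (fun t => (a3 t).congr_deriv (by rw [one_mul])) (neg_ne_zero.mpr (div_ne_zero hB hA)) (by
        rw [a0, Complex.conj_mul', ← Complex.ofReal_pow, ← Complex.ofReal_mul, ea, hR0]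
        congr 1; ring)
  have nb : ∀ t, conj (y t) * y t = (-(C / A) : ℝ) * ((R' t - (-i₂ / 3 + 2 * i₃ / 3) : ℝ) : ℂ) :=
    conj_mul_self_eq (s := s) (P := P') (H := -q) hR (fun t => (hn t).2.1)
      (fun t => (b3 t).congr_deriv (by push_cast; ring)) (neg_ne_zero.mpr (div_ne_zero hC hA)) (by
        rw [b0, Complex.conj_mul', ← Complex.ofReal_pow, ← Complex.ofReal_mul, eb, hR0]
        congr 1; ring)
  have nc : ∀ t, conj (z t) * z t = (1 : ℝ) * ((R' t - (-i₂ / 3 - i₃ / 3) : ℝ) : ℂ) :=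
    conj_mul_self_eq (s := s) (P := P') (H := q) hR (fun t => (hn t).2.2)
      (fun t => (c3 t).congr_deriv (by rw [one_mul])) one_ne_zero (by
        rw [c0, Complex.conj_mul', ← Complex.ofReal_pow, ← Complex.ofReal_mul, hR0]
        congr 1; ring)
  have d1 : ∀ t, ((R' t - (2 * i₂ / 3 - i₃ / 3) : ℝ) : ℂ) ≠ 0 := fun t => by
    rw [Complex.ofReal_ne_zero, sub_ne_zero]; exact (hn t).1
  have d2 : ∀ t, ((R' t - (-i₂ / 3 + 2 * i₃ / 3) : ℝ) : ℂ) ≠ 0 := fun t => by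
    rw [Complex.ofReal_ne_zero, sub_ne_zero]; exact (hn t).2.1
  have d3 : ∀ t, ((R' t - (-i₂ / 3 - i₃ / 3) : ℝ) : ℂ) ≠ 0 := fun t => by
    rw [Complex.ofReal_ne_zero, sub_ne_zero]; exact (hn t).2.2
  have hsC : (s : ℂ) ≠ 0 := by exact_mod_cast hs0
  have hAC : (A : ℂ) ≠ 0 := by exact_mod_cast hA
  -- the logarithmic derivative of both `2iκ ā b c̄` and `℘' + iκh₄`
  let Q : ℝ → ℂ := fun t => s * (1 / 2 * (P' t - Complex.I * q)) *
    (1 / ((R' t - (2 * i₂ / 3 - i₃ / 3) : ℝ) : ℂ) + 1 / ((R' t - (-i₂ / 3 + 2 * i₃ / 3) : ℝ) : ℂ) +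
      1 / ((R' t - (-i₂ / 3 - i₃ / 3) : ℝ) : ℂ))
  have key : (fun t => 2 * Complex.I * (A / s : ℝ) * (conj (x t) * y t * conj (z t))) =
      fun t => (P' t : ℂ) + Complex.I * q := by
    refine eq_of_hasDerivAt_mul (q := Q) (fun t => ?_) (fun t => ?_) (fun t => ?_) ?_
    · refine ((((hasDerivAt_conj (a3 t)).mul (b3 t)).mul (hasDerivAt_conj (c3 t))).const_mul
        (2 * Complex.I * (A / s : ℝ))).congr_deriv ?_
      have := d1 t
      have := d2 t
      have := d3 t
      simp only [map_mul, map_div₀, map_add, Complex.conj_ofReal, Complex.conj_I, map_one,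
        Complex.conj_ofNat, Pi.mul_apply, Q]
      generalize ((R' t - (2 * i₂ / 3 - i₃ / 3) : ℝ) : ℂ) = D1 at *
      generalize ((R' t - (-i₂ / 3 + 2 * i₃ / 3) : ℝ) : ℂ) = D2 at *
      generalize ((R' t - (-i₂ / 3 - i₃ / 3) : ℝ) : ℂ) = D3 at *
      field_simp
      ring
    · refine ((hP t).ofReal_comp.add_const (Complex.I * (q : ℂ))).congr_deriv ?_
      have hc := congrArg (fun x : ℝ => (x : ℂ)) (hcub t)
      have hD : ((6 * R' t ^ 2 - g / 2 : ℝ) : ℂ) = ((2 * ((R' t - (2 * i₂ / 3 - i₃ / 3)) *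
          (R' t - (-i₂ / 3 + 2 * i₃ / 3)) + (R' t - (2 * i₂ / 3 - i₃ / 3)) *
          (R' t - (-i₂ / 3 - i₃ / 3)) + (R' t - (-i₂ / 3 + 2 * i₃ / 3)) *
          (R' t - (-i₂ / 3 - i₃ / 3))) : ℝ) : ℂ) := by
        rw [eg]; congr 1; ring
      have := d1 t
      have := d2 t
      have := d3 t
      rw [Complex.ofReal_mul, hD]
      simp only [Complex.ofReal_mul, Complex.ofReal_add, Complex.ofReal_pow,
        Complex.ofReal_ofNat, Q] at hc ⊢
      generalize ((R' t - (2 * i₂ / 3 - i₃ / 3) : ℝ) : ℂ) = D1 at *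
      generalize ((R' t - (-i₂ / 3 + 2 * i₃ / 3) : ℝ) : ℂ) = D2 at *
      generalize ((R' t - (-i₂ / 3 - i₃ / 3) : ℝ) : ℂ) = D3 at *
      field_simp
      linear_combination -(D1 * D2 + D1 * D3 + D2 * D3) * hc +
        (q : ℂ) ^ 2 * (D1 * D2 + D1 * D3 + D2 * D3) * Complex.I_sq
    · intro h
      have := congrArg Complex.im h
      simp at this
      exact hroot this
    · rw [a0, b0, c0, hP0, eF]
  have hF : ∀ t, 2 * Complex.I * A * (conj (x t) * y t * conj (z t)) =
      s * ((P' t : ℂ) + Complex.I * q) := fun t => by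
    rw [← congrFun key t]; push_cast; field_simp
  have hF' : ∀ t, -2 * Complex.I * A * (x t * conj (y t) * z t) =
      s * ((P' t : ℂ) - Complex.I * q) := fun t => by
    have := congrArg conj (hF t)
    simpa [sub_eq_add_neg, Complex.conj_ofNat] using this
  refine ⟨fun t => (a3 t).differentiableAt, fun t => (b3 t).differentiableAt,
    fun t => (c3 t).differentiableAt, fun t => ?_, fun t => ?_, fun t => ?_⟩
  -- each linear equation, multiplied by the conjugate of its unknown function, is an Euler equation
  · rw [(a3 t).deriv, hBv]
    have h1 := na t
    have hD := mul_inv_cancel₀ (d1 t)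
    generalize ((R' t - (2 * i₂ / 3 - i₃ / 3) : ℝ) : ℂ) = D1 at *
    have h4 : conj (x t) ≠ 0 := by simpa using a2' t
    refine mul_left_cancel₀ (mul_ne_zero (mul_ne_zero two_ne_zero h4) hAC) ?_
    push_cast at h1 ⊢
    field_simp at h1
    linear_combination Complex.I * s * (P' t + Complex.I * q) * D1⁻¹ * h1 -
      Complex.I * s * (P' t + Complex.I * q) * B * hD + Complex.I * B * hF t -
      2 * A * B * (conj (x t) * y t * conj (z t)) * Complex.I_sq
  · rw [(b3 t).deriv, ← neg_sub (α 0 1), hCv]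
    have h1 := nb t
    have hD := mul_inv_cancel₀ (d2 t)
    generalize ((R' t - (-i₂ / 3 + 2 * i₃ / 3) : ℝ) : ℂ) = D2 at *
    have h4 : conj (y t) ≠ 0 := by simpa using b2' t
    refine mul_left_cancel₀ (mul_ne_zero (mul_ne_zero two_ne_zero h4) hAC) ?_
    push_cast at h1 ⊢
    field_simp at h1
    linear_combination Complex.I * s * (P' t - Complex.I * q) * D2⁻¹ * h1 -
      Complex.I * s * (P' t - Complex.I * q) * C * hD + Complex.I * C * hF' t +
      2 * A * C * (x t * conj (y t) * z t) * Complex.I_sq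
  · rw [(c3 t).deriv, ← neg_sub (α 0 1), hAv]
    have h1 := nc t
    have hD := mul_inv_cancel₀ (d3 t)
    generalize ((R' t - (-i₂ / 3 - i₃ / 3) : ℝ) : ℂ) = D3 at *
    have h4 : conj (z t) ≠ 0 := by simpa using c2' t
    refine mul_left_cancel₀ (mul_ne_zero two_ne_zero h4) ?_
    push_cast at h1 ⊢
    linear_combination Complex.I * s * (P' t + Complex.I * q) * D3⁻¹ * h1 +
      Complex.I * s * (P' t + Complex.I * q) * hD - Complex.I * hF t +
      2 * A * (conj (x t) * y t * conj (z t)) * Complex.I_sq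

end FlagThree

/-! ### Relabelling of the sites -/

namespace FlagThree

variable {α : Matrix (Fin 3) (Fin 3) ℝ} {a b c : ℝ → ℂ}

lemma momentum_conj (a b c : ℂ) (i j : Fin 3) :
    momentum a b c j i = conj (momentum a b c i j) := by
  fin_cases i <;> fin_cases j <;> simp [momentum]

lemma momentum_diag (a b c : ℂ) (i : Fin 3) : momentum a b c i i = 0 := by
  fin_cases i <;> simp [momentum]

lemma momentum_submatrix (a b c : ℂ) (π : Equiv.Perm (Fin 3)) :
    (momentum a b c).submatrix π π = momentum (momentum a b c (π 0) (π 1))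
      (momentum a b c (π 0) (π 2)) (momentum a b c (π 1) (π 2)) := by
  ext i j
  have h1 := momentum_conj a b c (π 0) (π 1)
  have h2 := momentum_conj a b c (π 0) (π 2)
  have h3 := momentum_conj a b c (π 1) (π 2)
  fin_cases i <;> fin_cases j <;>
    simp [h1, h2, h3, momentum_diag] <;> simp [momentum]

lemma momentum_inj {a b c a' b' c' : ℂ} (h : momentum a b c = momentum a' b' c') :
    a = a' ∧ b = b' ∧ c = c' :=
  ⟨by simpa [momentum] using congrFun (congrFun h 0) 1,
    by simpa [momentum] using congrFun (congrFun h 0) 2,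
    by simpa [momentum] using congrFun (congrFun h 1) 2⟩

/-- The Euler equations in a form that is symmetric in the three sites: the entries of
`i dL/dt = [L, ℑ(L)]` off the diagonal. -/
lemma isEulerSolution_iff (hα : α.IsSymm) : IsEulerSolution α a b c ↔
    ∀ i j k : Fin 3, i ≠ j → j ≠ k → i ≠ k → ∀ t,
      HasDerivAt (fun t => momentum (a t) (b t) (c t) i j)
        (-Complex.I * ((α k j - α i k : ℝ) : ℂ) * (momentum (a t) (b t) (c t) i k *
          momentum (a t) (b t) (c t) k j)) t := by
  have s10 := hα.apply 0 1
  have s20 := hα.apply 0 2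
  have s21 := hα.apply 1 2
  constructor
  · intro h i j k hij hjk hik t
    have ha := h.hasDerivAt_a t
    have hb := h.hasDerivAt_b t
    have hc := h.hasDerivAt_c t
    have ha' := hasDerivAt_conj ha
    have hb' := hasDerivAt_conj hb
    have hc' := hasDerivAt_conj hc
    fin_cases i <;> fin_cases j <;> fin_cases k <;>
      first | exact absurd rfl hij | exact absurd rfl hjk | exact absurd rfl hik | skip
    · refine ha.congr_deriv ?_
      simp [momentum, s21]
    · refine hb.congr_deriv ?_
      simp [momentum]
    · refine ha'.congr_deriv ?_
      simp [momentum, s20]; ring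
    · refine hc.congr_deriv ?_
      simp [momentum, s10]
    · refine hb'.congr_deriv ?_
      simp [momentum, s10, s21]; ring
    · refine hc'.congr_deriv ?_
      simp [momentum, s20]; ring
  · intro h
    have ha := h 0 1 2 (by decide) (by decide) (by decide)
    have hb := h 0 2 1 (by decide) (by decide) (by decide)
    have hc := h 1 2 0 (by decide) (by decide) (by decide)
    simp only [momentum, Matrix.of_apply, Matrix.cons_val', Matrix.cons_val_zero,
      Matrix.cons_val_one, Matrix.cons_val, s21, s10] at ha hb hc
    refine ⟨fun t => (ha t).differentiableAt, fun t => (hb t).differentiableAt,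
      fun t => (hc t).differentiableAt, fun t => ?_, fun t => ?_, fun t => ?_⟩
    · rw [(ha t).deriv]
      linear_combination -((α 1 2 - α 0 2 : ℝ) : ℂ) * (b t * conj (c t)) * Complex.I_sq
    · rw [(hb t).deriv]
      linear_combination -((α 1 2 - α 0 1 : ℝ) : ℂ) * (a t * c t) * Complex.I_sq
    · rw [(hc t).deriv]
      linear_combination -((α 0 2 - α 0 1 : ℝ) : ℂ) * (conj (a t) * b t) * Complex.I_sq

lemma isEulerSolution_relabel (hα : α.IsSymm) (π : Equiv.Perm (Fin 3)) :
    IsEulerSolution α a b c ↔ IsEulerSolution (α.submatrix π π)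
      (fun t => momentum (a t) (b t) (c t) (π 0) (π 1))
      (fun t => momentum (a t) (b t) (c t) (π 0) (π 2))
      (fun t => momentum (a t) (b t) (c t) (π 1) (π 2)) := by
  rw [isEulerSolution_iff hα, isEulerSolution_iff (hα.submatrix π)]
  simp only [← momentum_submatrix, Matrix.submatrix_apply]
  constructor
  · intro h i j k hij hjk hik t
    exact h _ _ _ (π.injective.ne hij) (π.injective.ne hjk) (π.injective.ne hik) t
  · intro h i j k hij hjk hik t
    simpa using h (π.symm i) (π.symm j) (π.symm k) (π.symm.injective.ne hij)
      (π.symm.injective.ne hjk) (π.symm.injective.ne hik) t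

/-! ### The Weierstrass functions of the initial data -/

section lattice

variable {p q : ℝ} (hp : 0 < p) (hq : 0 < q)

/-- On the line through the half-period `ω₂` parallel to the real axis, `℘` and `℘'` of a
rectangular lattice are real. -/
lemma isRealOnLine_rect (τ₀ : ℝ) : IsRealOnLine (PeriodPair.rect p q hp hq) τ₀
    (fun τ => ((PeriodPair.rect p q hp hq).weierstrassP ((τ - τ₀ : ℝ) + q * Complex.I)).re)
    (fun τ => ((PeriodPair.rect p q hp hq).derivWeierstrassP
      ((τ - τ₀ : ℝ) + q * Complex.I)).re) := by
  have e : ∀ τ : ℝ, (τ : ℂ) - τ₀ + (PeriodPair.rect p q hp hq).ω₂ / 2 =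
      (τ - τ₀ : ℝ) + q * Complex.I := fun τ => by
    simp only [PeriodPair.rect]; push_cast; ring
  refine ⟨fun τ => ?_, fun τ => ?_, fun τ => ?_⟩
  · rw [e]; exact PeriodPair.shift_notMem_rect hp hq _
  · rw [e]
    exact Complex.ext rfl (by simpa using PeriodPair.weierstrassP_rect_shift_im hp hq (τ - τ₀))
  · rw [e]
    exact Complex.ext rfl (by simpa using PeriodPair.derivWeierstrassP_rect_shift_im hp hq (τ - τ₀))

/-- An initial shift for a rectangular lattice with the invariants of the initial data is adapted.
-/
lemma isAdapted_rect {a₀ b₀ c₀ : ℂ} {τ₀ : ℝ}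
    (h2 : (PeriodPair.rect p q hp hq).g₂ = g₂ α a₀ b₀ c₀)
    (h3 : (PeriodPair.rect p q hp hq).g₃ = g₃ α a₀ b₀ c₀)
    (h : IsInitialShift α a₀ b₀ c₀ (PeriodPair.rect p q hp hq) τ₀) :
    IsAdapted α a₀ b₀ c₀ (PeriodPair.rect p q hp hq) τ₀
    (fun τ => ((PeriodPair.rect p q hp hq).weierstrassP ((τ - τ₀ : ℝ) + q * Complex.I)).re)
    (fun τ => ((PeriodPair.rect p q hp hq).derivWeierstrassP
      ((τ - τ₀ : ℝ) + q * Complex.I)).re) := by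
  have H := isRealOnLine_rect hp hq τ₀
  refine ⟨H, h2, h3, ?_, ?_⟩
  · have := H.weierstrassP_eq 0
    rw [Complex.ofReal_zero, zero_sub, h.1] at this
    exact_mod_cast this.symm
  · have := H.derivWeierstrassP_eq 0
    rw [Complex.ofReal_zero, zero_sub, h.2] at this
    exact (Complex.ofReal_injective this).symm

/-- The initial value of `|c|²` is attained by `℘` on the line, and the sign of the derivative is
corrected by a reflection of the line. -/
lemma exists_isInitialShift (hα : α 0 2 < α 1 2) (hα' : α 1 2 < α 0 1) {a₀ b₀ c₀ : ℂ}
    (h2 : (PeriodPair.rect p q hp hq).g₂ = g₂ α a₀ b₀ c₀)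
    (h3 : (PeriodPair.rect p q hp hq).g₃ = g₃ α a₀ b₀ c₀)
    (hY : ‖c₀‖ ^ 2 - (I₂ α a₀ c₀ + I₃ α b₀ c₀) / 3 ∈
      Set.Icc (-PeriodPair.rectReal q p hq hp q) (PeriodPair.rectMid p q hp hq)) :
    ∃ τ₀ : ℝ, IsInitialShift α a₀ b₀ c₀ (PeriodPair.rect p q hp hq) τ₀ := by
  obtain ⟨x, hx⟩ := PeriodPair.exists_weierstrassP_rect_shift hp hq hY.1 hY.2
  set L := PeriodPair.rect p q hp hq with hL
  have hω : L.ω₂ / 2 = q * Complex.I := by rw [hL]; simp only [PeriodPair.rect]; ring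
  have hsq : L.derivWeierstrassP (x + q * Complex.I) ^ 2 = (speedC α a₀ b₀ c₀ : ℂ) ^ 2 := by
    rw [L.derivWeierstrassP_sq _ (PeriodPair.shift_notMem_rect hp hq x), hx, h2, h3]
    exact_mod_cast (speedC_sq hα hα' a₀ b₀ c₀).symm
  rcases sq_eq_sq_iff_eq_or_eq_neg.mp hsq with h | h
  · refine ⟨-x, ?_, ?_⟩
    · rw [hω, Complex.ofReal_neg, neg_neg, hx]
    · rw [hω, Complex.ofReal_neg, neg_neg, h]; rfl
  -- `℘` is even, `℘'` is odd, and the reflected line differs by the period `2ω₂`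
  · have hmem : (2 * q * Complex.I : ℂ) ∈ L.lattice := L.ω₂_mem_lattice
    have e : -(x : ℂ) + q * Complex.I = -(x + q * Complex.I) + (⟨_, hmem⟩ : L.lattice) := by
      push_cast; ring
    refine ⟨x, ?_, ?_⟩
    · rw [hω, e, L.weierstrassP_add_coe, L.weierstrassP_neg, hx]
    · rw [hω, e, L.derivWeierstrassP_add_coe, L.derivWeierstrassP_neg, h, neg_neg]; rfl

end lattice

/-- The solution of the Euler equations, for arbitrary labels of the sites. -/
theorem euler_solution (hsymm : α.IsSymm) (π : Equiv.Perm (Fin 3)) (β : Matrix (Fin 3) (Fin 3) ℝ)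
    (hβ : β = α.submatrix π π) (hα : β 0 2 < β 1 2) (hα' : β 1 2 < β 0 1) (a₀ b₀ c₀ : ℂ)
    (hdisc : g₂ β a₀ b₀ c₀ ^ 3 - 27 * g₃ β a₀ b₀ c₀ ^ 2 ≠ 0) :
      ∃ e₁ e₂ e₃ : ℝ, e₃ < e₂ ∧ e₂ < e₁ ∧
        (∀ Y : ℝ, 4 * Y ^ 3 - g₂ β a₀ b₀ c₀ * Y - g₃ β a₀ b₀ c₀ =
          4 * (Y - e₁) * (Y - e₂) * (Y - e₃)) ∧
      ∃ L : PeriodPair,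
        L.ω₁ / 2 = (∫ Y in Set.Ioi e₁,
          1 / √(4 * Y ^ 3 - g₂ β a₀ b₀ c₀ * Y - g₃ β a₀ b₀ c₀) : ℝ) ∧
        L.ω₂ / 2 = Complex.I * (∫ Y in Set.Ioi (-e₃),
          1 / √(4 * Y ^ 3 - g₂ β a₀ b₀ c₀ * Y + g₃ β a₀ b₀ c₀) : ℝ) ∧
        L.g₂ = g₂ β a₀ b₀ c₀ ∧ L.g₃ = g₃ β a₀ b₀ c₀ ∧
        (∃ τ₀ : ℝ, IsInitialShift β a₀ b₀ c₀ L τ₀) ∧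
        (∀ r : ℝ, ∃ μ : ℂ, IsWeierstrassRoot L μ r) ∧
        ∀ τ₀ : ℝ, IsInitialShift β a₀ b₀ c₀ L τ₀ →
          (∀ a b c : ℝ → ℂ, IsEulerSolution α a b c →
            (momentum (a 0) (b 0) (c 0)).submatrix π π = momentum a₀ b₀ c₀ →
            ∀ t : ℝ, ((‖momentum (a t) (b t) (c t) (π 1) (π 2)‖ ^ 2 : ℝ) : ℂ) =
              L.weierstrassP ((timeScale β * t : ℝ) - τ₀ + L.ω₂ / 2) +
                ((I₂ β a₀ c₀ + I₃ β b₀ c₀) / 3 : ℝ)) ∧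
          (h₄ a₀ b₀ c₀ ≠ 0 →
            ∀ μ₁ μ₂ μ₃ : ℂ,
              IsWeierstrassRoot L μ₁ (2 * I₂ β a₀ c₀ / 3 - I₃ β b₀ c₀ / 3) →
              IsWeierstrassRoot L μ₂ (-(I₂ β a₀ c₀) / 3 + 2 * I₃ β b₀ c₀ / 3) →
              IsWeierstrassRoot L μ₃ (-(I₂ β a₀ c₀) / 3 - I₃ β b₀ c₀ / 3) →
              ∀ a b c : ℝ → ℂ,
                (IsEulerSolution α a b c ∧
                  (momentum (a 0) (b 0) (c 0)).submatrix π π = momentum a₀ b₀ c₀) ↔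
                ∀ t : ℝ, (momentum (a t) (b t) (c t)).submatrix π π =
                  momentum (solA β a₀ b₀ c₀ L τ₀ μ₁ (timeScale β * t))
                    (solB β a₀ b₀ c₀ L τ₀ μ₂ (timeScale β * t))
                    (solC β a₀ b₀ c₀ L τ₀ μ₃ (timeScale β * t))) := by
  have hlt : 27 * g₃ β a₀ b₀ c₀ ^ 2 < g₂ β a₀ b₀ c₀ ^ 3 :=
    lt_of_le_of_ne (discr_nonneg hα hα' a₀ b₀ c₀) fun h => hdisc (by rw [h, sub_self])
  obtain ⟨p, q, hp, hq, h2, h3⟩ := PeriodPair.exists_rect_of_discr_pos hlt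
  have r2 : (PeriodPair.rect p q hp hq).g₂.re = g₂ β a₀ b₀ c₀ := by rw [h2, Complex.ofReal_re]
  have r3 : (PeriodPair.rect p q hp hq).g₃.re = g₃ β a₀ b₀ c₀ := by rw [h3, Complex.ofReal_re]
  obtain ⟨c1, c2, c3⟩ := PeriodPair.rect_cubic hp hq
  rw [r2] at c2
  rw [r3] at c3
  have l1 := PeriodPair.rectMid_lt hp hq
  have l2 := PeriodPair.neg_rectReal_swap_lt hp hq
  have hP : ∀ Y : ℝ, 4 * Y ^ 3 - g₂ β a₀ b₀ c₀ * Y - g₃ β a₀ b₀ c₀ =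
      4 * (Y - PeriodPair.rectReal p q hp hq p) * (Y - PeriodPair.rectMid p q hp hq) *
        (Y - -PeriodPair.rectReal q p hq hp q) := fun Y => by
    rw [c2, c3]
    linear_combination 4 * Y ^ 2 * c1
  have i1 := PeriodPair.rect_halfPeriod_eq_integral hp hq
  have i2 := PeriodPair.rect_halfPeriod_eq_integral hq hp
  rw [r2, r3] at i1
  rw [PeriodPair.g₂_rect_swap, PeriodPair.g₃_rect_swap, Complex.neg_re, r2, r3] at i2
  simp only [sub_neg_eq_add] at i2
  refine ⟨_, _, _, l2, l1, hP, PeriodPair.rect p q hp hq, ?_, ?_, h2, h3,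
    exists_isInitialShift hp hq hα hα' h2 h3 (mem_Icc_of_roots hα hα' a₀ b₀ c₀ l2 l1 hP),
    fun r => PeriodPair.exists_weierstrassP_rect_eq hp hq r, fun τ₀ hτ => ?_⟩
  · rw [i1]; simp [PeriodPair.rect]
  · rw [neg_neg, i2]; simp only [PeriodPair.rect]; ring
  have H := isAdapted_rect hp hq h2 h3 hτ
  refine ⟨fun a b c h h0 t => ?_, fun h0 μ₁ μ₂ μ₃ m1 m2 m3 a b c => ?_⟩
  · rw [momentum_submatrix] at h0
    obtain ⟨x0, y0, z0⟩ := momentum_inj h0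
    have h' := (isEulerSolution_relabel hsymm π).mp h
    rw [← hβ] at h'
    have key := (H.eq_of_isEulerSolution hα hα' h' x0 y0 z0 t).1
    rw [H.weierstrassP_eq, ← Complex.ofReal_add, ← key, sub_add_cancel]
  · rw [isEulerSolution_relabel hsymm π, ← hβ]
    simp only [momentum_submatrix]
    constructor
    · rintro ⟨h, hi⟩ t
      obtain ⟨x0, y0, z0⟩ := momentum_inj hi
      obtain ⟨ea, eb, ec⟩ := H.eq_sol hα hα' h0 m1 m2 m3 h x0 y0 z0
      rw [congrFun ea t, congrFun eb t, congrFun ec t]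
    · intro h
      have ea := funext fun t => (momentum_inj (h t)).1
      have eb := funext fun t => (momentum_inj (h t)).2.1
      have ec := funext fun t => (momentum_inj (h t)).2.2
      rw [ea, eb, ec]
      refine ⟨H.isEulerSolution_sol hα hα' h0 m1 m2 m3, ?_⟩
      obtain ⟨⟨a1, -⟩, ⟨b1, -⟩, ⟨c1, -⟩⟩ := H.sol_spec hα hα' h0 m1 m2 m3
      rw [h 0, mul_zero, a1, b1, c1]

end FlagThree

/-! ### Calculus of matrix-valued curves -/

namespace FlagThree

/-- The entrywise derivative of the curve `U` at `t` is `U'`. -/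
def HasMatDerivAt (U : ℝ → Matrix (Fin 3) (Fin 3) ℂ) (U' : Matrix (Fin 3) (Fin 3) ℂ) (t : ℝ) :
    Prop :=
  ∀ i j, HasDerivAt (fun s => U s i j) (U' i j) t

namespace HasMatDerivAt

variable {U V : ℝ → Matrix (Fin 3) (Fin 3) ℂ} {U' V' : Matrix (Fin 3) (Fin 3) ℂ} {t : ℝ}

lemma matDeriv_eq (h : HasMatDerivAt U U' t) : matDeriv U t = U' := by
  ext i j
  exact (h i j).deriv

lemma congr_deriv (h : HasMatDerivAt U U' t) (e : U' = V') : HasMatDerivAt U V' t := e ▸ h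

lemma mul (hU : HasMatDerivAt U U' t) (hV : HasMatDerivAt V V' t) :
    HasMatDerivAt (fun t => U t * V t) (U' * V t + U t * V') t := by
  intro i j
  simp only [Matrix.mul_apply, Matrix.add_apply]
  rw [← Finset.sum_add_distrib]
  exact HasDerivAt.fun_sum fun k _ => (hU i k).mul (hV k j)

lemma conjTranspose (hU : HasMatDerivAt U U' t) :
    HasMatDerivAt (fun t => (U t).conjTranspose) U'.conjTranspose t :=
  fun i j => hasDerivAt_conj (hU j i)

lemma add (hU : HasMatDerivAt U U' t) (hV : HasMatDerivAt V V' t) :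
    HasMatDerivAt (fun t => U t + V t) (U' + V') t :=
  fun i j => (hU i j).add (hV i j)

lemma const (M : Matrix (Fin 3) (Fin 3) ℂ) : HasMatDerivAt (fun _ => M) 0 t :=
  fun _ _ => hasDerivAt_const _ _

lemma const_mul (M : Matrix (Fin 3) (Fin 3) ℂ) (hU : HasMatDerivAt U U' t) :
    HasMatDerivAt (fun t => M * U t) (M * U') t :=
  ((const M).mul hU).congr_deriv (by rw [zero_mul, zero_add])

lemma diagonal {d : ℝ → Fin 3 → ℂ} {d' : Fin 3 → ℂ}
    (h : ∀ k, HasDerivAt (fun t => d t k) (d' k) t) :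
    HasMatDerivAt (fun t => Matrix.diagonal (d t)) (Matrix.diagonal d') t := by
  intro i j
  by_cases hij : i = j
  · subst hij; simpa using h i
  · simpa [Matrix.diagonal_apply_ne _ hij] using hasDerivAt_const t (0 : ℂ)

lemma trace (hU : HasMatDerivAt U U' t) : HasDerivAt (fun t => (U t).trace) U'.trace t :=
  HasDerivAt.fun_sum fun k _ => hU k k

end HasMatDerivAt

lemma hasMatDerivAt_of_differentiable {U : ℝ → Matrix (Fin 3) (Fin 3) ℂ}
    (h : ∀ i j, Differentiable ℝ fun t => U t i j) (t : ℝ) : HasMatDerivAt U (matDeriv U t) t :=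
  fun i j => (h i j t).hasDerivAt

/-- A curve of matrices with derivative zero on `(-r, r)` is constant there. -/
lemma eq_of_hasMatDerivAt_zero_on {G : ℝ → Matrix (Fin 3) (Fin 3) ℂ} {r : ℝ}
    (h : ∀ t ∈ Set.Ioo (-r) r, HasMatDerivAt G 0 t) {t : ℝ} (ht : t ∈ Set.Ioo (-r) r) :
    G t = G 0 := by
  ext i j
  have hr : (0 : ℝ) ∈ Set.Ioo (-r) r :=
    ⟨by linarith [ht.1.trans ht.2], by linarith [ht.1.trans ht.2]⟩
  have := (convex_Ioo (-r) r).norm_image_sub_le_of_norm_hasDerivWithin_le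
    (f := fun s => G s i j) (f' := fun _ => 0) (C := 0)
    (fun s hs => (h s hs i j).hasDerivWithinAt) (fun s _ => by simp) hr ht
  simpa [sub_eq_zero] using this

lemma eq_of_hasMatDerivAt_zero {G : ℝ → Matrix (Fin 3) (Fin 3) ℂ}
    (h : ∀ t, HasMatDerivAt G 0 t) (t : ℝ) : G t = G 0 :=
  eq_of_hasMatDerivAt_zero_on (r := |t| + 1) (fun s _ => h s)
    (abs_lt.mp (by linarith))

/-- `Y` solves `Y' = i W Y` on `(-r, r)`. -/
def IsFrameOn (W Y : ℝ → Matrix (Fin 3) (Fin 3) ℂ) (r : ℝ) : Prop :=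
  ∀ t ∈ Set.Ioo (-r) r, HasMatDerivAt Y (Complex.I • (W t * Y t)) t

/-- `Y† Z` is constant for two solutions, because `i W` is skew-Hermitian. -/
lemma conjTranspose_mul_eq_of_isFrameOn {W Y Z : ℝ → Matrix (Fin 3) (Fin 3) ℂ} {r : ℝ}
    (hW : ∀ t, (W t).IsHermitian) (hY : IsFrameOn W Y r) (hZ : IsFrameOn W Z r) {t : ℝ}
    (ht : t ∈ Set.Ioo (-r) r) : (Y t).conjTranspose * Z t = (Y 0).conjTranspose * Z 0 := by
  refine eq_of_hasMatDerivAt_zero_on (G := fun t => (Y t).conjTranspose * Z t) (fun s hs => ?_) ht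
  refine ((hY s hs).conjTranspose.mul (hZ s hs)).congr_deriv ?_
  rw [Matrix.conjTranspose_smul, Matrix.conjTranspose_mul, (hW s).eq]
  simp [Matrix.mul_assoc]

lemma eq_of_isFrameOn {W Y Z : ℝ → Matrix (Fin 3) (Fin 3) ℂ} {r : ℝ}
    (hW : ∀ t, (W t).IsHermitian) (hY : IsFrameOn W Y r) (hZ : IsFrameOn W Z r) (h0 : Y 0 = Z 0)
    (hu : Y 0 ∈ Matrix.unitaryGroup (Fin 3) ℂ) {t : ℝ} (ht : t ∈ Set.Ioo (-r) r) : Y t = Z t := by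
  have h1 := conjTranspose_mul_eq_of_isFrameOn hW hY hZ ht
  have h2 := conjTranspose_mul_eq_of_isFrameOn hW hY hY ht
  rw [← h0, ← Matrix.star_eq_conjTranspose, ← Matrix.star_eq_conjTranspose,
    Matrix.mem_unitaryGroup_iff'.mp hu] at h1
  rw [← Matrix.star_eq_conjTranspose, ← Matrix.star_eq_conjTranspose,
    Matrix.mem_unitaryGroup_iff'.mp hu] at h2
  have h3 := mul_eq_one_comm.mp h2
  calc Y t = Y t * (star (Y t) * Z t) := by rw [h1, mul_one]
    _ = Z t := by rw [← mul_assoc, h3, one_mul]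

/-- The equation `Y' = i W Y` is solvable on every interval about zero. Multiplied by a cut-off
function its right side is bounded, so that the Picard-Lindelöf theorem gives a solution on the
whole interval; the solution of the cut-off equation stays unitary, hence in the region where the
cut-off function is one. -/
lemma exists_isFrameOn {W : ℝ → Matrix (Fin 3) (Fin 3) ℂ} (hW : ∀ t, (W t).IsHermitian)
    (hc : ∀ i j, ContDiff ℝ 1 fun t => W t i j) {Y₀ : Matrix (Fin 3) (Fin 3) ℂ}
    (hY₀ : Y₀ ∈ Matrix.unitaryGroup (Fin 3) ℂ) {r : ℝ} (hr : 0 < r) :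
    ∃ Y : ℝ → Matrix (Fin 3) (Fin 3) ℂ, Y 0 = Y₀ ∧ IsFrameOn W Y r := by
  let F := Fin 3 → Fin 3 → ℂ
  let φ : ContDiffBump (0 : F) := ⟨2, 3, by norm_num, by norm_num⟩
  let v : ℝ → F → F := fun t x i j => (φ x : ℂ) * (Complex.I * ∑ k, W t i k * x k j)
  have hv : ContDiff ℝ 1 (fun p : ℝ × F => v p.1 p.2) := by
    refine contDiff_pi.mpr fun i => contDiff_pi.mpr fun j => ?_
    refine ContDiff.mul ?_ (contDiff_const.mul (ContDiff.sum fun k _ => ?_))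
    · exact Complex.ofRealCLM.contDiff.comp (φ.contDiff.comp contDiff_snd)
    · refine ((hc i k).comp contDiff_fst).mul ?_
      fun_prop
  obtain ⟨C, hC⟩ := ((isCompact_Icc (a := -r) (b := r)).prod
    (isCompact_closedBall (0 : F) 3)).exists_bound_of_continuousOn hv.continuous.continuousOn
  have hC' : ∀ t ∈ Set.Icc (-r) r, ∀ x : F, ‖v t x‖ ≤ max C 0 := by
    intro t ht x
    by_cases hx : x ∈ Metric.closedBall (0 : F) 3
    · exact (hC (t, x) ⟨ht, hx⟩).trans (le_max_left _ _)
    · have h0 : φ x = 0 := φ.zero_of_le_dist (by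
        rw [Metric.mem_closedBall, not_le] at hx; exact hx.le)
      have : v t x = 0 := by funext i j; simp only [v, h0]; simp; rfl
      rw [this, norm_zero]; exact le_max_right _ _
  let B : NNReal := ⟨max C 0, le_max_right _ _⟩
  let a : NNReal := B * ⟨r, hr.le⟩
  have hloc := hv.locallyLipschitz.locallyLipschitzOn
    (s := Set.Icc (-r) r ×ˢ Metric.closedBall (fun i j => Y₀ i j : F) a)
  obtain ⟨K, hK⟩ := hloc.exists_lipschitzOnWith_of_compact
      (isCompact_Icc.prod (isCompact_closedBall _ _))
  have h0mem : (0 : ℝ) ∈ Set.Icc (-r) r := ⟨by linarith, hr.le⟩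
  have hPL : IsPicardLindelof v (⟨0, h0mem⟩ : Set.Icc (-r) r) (fun i j => Y₀ i j : F) a 0 B K := by
    refine ⟨fun t ht x hx y hy => ?_, fun x _ => ?_, fun t ht x _ => hC' t ht x, ?_⟩
    · have := hK (x := (t, x)) ⟨ht, hx⟩ (y := (t, y)) ⟨ht, hy⟩
      simpa [Prod.edist_eq] using this
    · exact (hv.continuous.comp (by fun_prop : Continuous fun t : ℝ => (t, x))).continuousOn
    · simp only [sub_zero, zero_sub, neg_neg, max_self, NNReal.coe_zero]
      exact le_rfl
  obtain ⟨y, hy0, hy⟩ := hPL.exists_eq_forall_mem_Icc_hasDerivWithinAt₀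
  let Y : ℝ → Matrix (Fin 3) (Fin 3) ℂ := fun t => Matrix.of (y t)
  have hY : ∀ t ∈ Set.Ioo (-r) r, HasMatDerivAt Y
      ((φ (y t) : ℂ) • (Complex.I • (W t * Y t))) t := by
    intro t ht i j
    have h1 := (hy t (Set.Ioo_subset_Icc_self ht)).hasDerivAt (Icc_mem_nhds ht.1 ht.2)
    have h2 := hasDerivAt_pi.mp (hasDerivAt_pi.mp h1 i) j
    exact h2
  have hY0 : Y 0 = Y₀ := by ext i j; exact congrFun (congrFun hy0 i) j
  have hun : ∀ t ∈ Set.Ioo (-r) r, (Y t).conjTranspose * Y t = 1 := by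
    intro t ht
    have := eq_of_hasMatDerivAt_zero_on (G := fun t => (Y t).conjTranspose * Y t) (r := r)
      (fun s hs => ((hY s hs).conjTranspose.mul (hY s hs)).congr_deriv (by
        rw [Matrix.conjTranspose_smul, Matrix.conjTranspose_smul, Matrix.conjTranspose_mul,
          (hW s).eq]
        simp [Matrix.mul_assoc])) ht
    rw [this, hY0]
    exact Matrix.mem_unitaryGroup_iff'.mp hY₀
  refine ⟨Y, hY0, fun t ht => (hY t ht).congr_deriv ?_⟩
  have h1 : φ (y t) = 1 := by
    refine φ.one_of_mem_closedBall ?_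
    rw [mem_closedBall_zero_iff]
    have hb : ∀ i j, ‖y t i j‖ ≤ 1 := fun i j =>
      entry_norm_bound_of_unitary (U := Y t) (Matrix.mem_unitaryGroup_iff'.mpr (hun t ht)) i j
    have : ‖y t‖ ≤ 1 := (pi_norm_le_iff_of_nonneg zero_le_one).mpr fun i =>
      (pi_norm_le_iff_of_nonneg zero_le_one).mpr fun j => hb i j
    exact this.trans (by norm_num [φ])
  rw [h1]; simp

/-- The equation `Y' = i W Y` with Hermitian `W` has a global unitary solution. -/
lemma exists_frame {W : ℝ → Matrix (Fin 3) (Fin 3) ℂ} (hW : ∀ t, (W t).IsHermitian)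
    (hc : ∀ i j, ContDiff ℝ 1 fun t => W t i j) {Y₀ : Matrix (Fin 3) (Fin 3) ℂ}
    (hY₀ : Y₀ ∈ Matrix.unitaryGroup (Fin 3) ℂ) :
    ∃ Y : ℝ → Matrix (Fin 3) (Fin 3) ℂ, Y 0 = Y₀ ∧
      (∀ t, Y t ∈ Matrix.unitaryGroup (Fin 3) ℂ) ∧
      ∀ t, HasMatDerivAt Y (Complex.I • (W t * Y t)) t := by
  -- the solutions on `(-(n + 1), n + 1)` agree on the common domain
  choose y hy0 hy using fun n : ℕ => exists_isFrameOn hW hc hY₀ (r := n + 1) (by positivity)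
  have hmono : ∀ {n m : ℕ}, n ≤ m → IsFrameOn W (y m) (n + 1) := fun {n m} h t ht => hy m t
    ⟨lt_of_le_of_lt (by gcongr) ht.1, lt_of_lt_of_le ht.2 (by gcongr)⟩
  have heq : ∀ {n m : ℕ}, n ≤ m → ∀ t ∈ Set.Ioo (-((n : ℝ) + 1)) (n + 1), y n t = y m t :=
    fun {n m} h t ht => eq_of_isFrameOn hW (hy n) (hmono h) (by rw [hy0, hy0]) (by rwa [hy0]) ht
  have hmem : ∀ t : ℝ, t ∈ Set.Ioo (-((⌊|t|⌋₊ : ℝ) + 1)) (⌊|t|⌋₊ + 1) := fun t =>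
    abs_lt.mp (Nat.lt_floor_add_one |t|)
  have hloc : ∀ (n : ℕ), ∀ t ∈ Set.Ioo (-((n : ℝ) + 1)) (n + 1), y ⌊|t|⌋₊ t = y n t := by
    intro n t ht
    rcases le_total ⌊|t|⌋₊ n with h | h
    · exact heq h t (hmem t)
    · exact (heq h t ht).symm
  have hD : ∀ t, HasMatDerivAt (fun t => y ⌊|t|⌋₊ t) (Complex.I • (W t * y ⌊|t|⌋₊ t)) t := by
    intro t i j
    refine (hy _ t (hmem t) i j).congr_of_eventuallyEq ?_
    filter_upwards [Ioo_mem_nhds (hmem t).1 (hmem t).2] with s hs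
    exact congrFun (congrFun (hloc _ s hs) i) j
  refine ⟨fun t => y ⌊|t|⌋₊ t, by simp [hy0], fun t => ?_, hD⟩
  rw [Matrix.mem_unitaryGroup_iff', Matrix.star_eq_conjTranspose,
    conjTranspose_mul_eq_of_isFrameOn hW (r := |t| + 1) (fun s _ => hD s) (fun s _ => hD s)
      (abs_lt.mp (by linarith))]
  simp only [abs_zero, Nat.floor_zero, hy0]
  exact Matrix.mem_unitaryGroup_iff'.mp hY₀

end FlagThree

/-! ### Eigenframes and the transport matrix -/

namespace FlagThree

variable {α : Matrix (Fin 3) (Fin 3) ℝ} {a b c : ℝ → ℂ} {M E : ℝ → Matrix (Fin 3) (Fin 3) ℂ}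

lemma momentum_isHermitian (a b c : ℂ) : (momentum a b c).IsHermitian := by
  ext i j
  rw [Matrix.conjTranspose_apply, momentum_conj a b c i j]
  exact star_star _

lemma inertia_isHermitian (hα : α.IsSymm) {M : Matrix (Fin 3) (Fin 3) ℂ} (hM : M.IsHermitian) :
    (inertia α M).IsHermitian := by
  ext i j
  simp only [inertia, Matrix.conjTranspose_apply, Matrix.of_apply, star_mul', ← hα.apply i j,
    ← hM.apply i j, Complex.star_def, Complex.conj_ofReal]

/-- The Euler equations as a matrix equation `i dM/dt = [M, ℑ(M)]`. -/
lemma IsEulerSolution.hasMatDerivAt (h : IsEulerSolution α a b c) (hα : α.IsSymm) (t : ℝ) :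
    HasMatDerivAt (fun t => momentum (a t) (b t) (c t))
      (-Complex.I • (momentum (a t) (b t) (c t) * inertia α (momentum (a t) (b t) (c t)) -
        inertia α (momentum (a t) (b t) (c t)) * momentum (a t) (b t) (c t))) t := by
  have H := (isEulerSolution_iff hα).mp h
  intro i j
  by_cases hij : i = j
  · subst hij
    have : (fun s => momentum (a s) (b s) (c s) i i) = fun _ => 0 := by
      ext s; exact momentum_diag _ _ _ i
    rw [this]
    refine (hasDerivAt_const t (0 : ℂ)).congr_deriv ?_
    simp only [Matrix.smul_apply, Matrix.sub_apply, Matrix.mul_apply, inertia, Matrix.of_apply]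
    rw [← Finset.sum_sub_distrib, Finset.sum_eq_zero, smul_zero]
    intro k _
    rw [hα.apply i k]; ring
  · obtain ⟨k, hik, hjk⟩ : ∃ k : Fin 3, i ≠ k ∧ j ≠ k := by
      revert hij; revert i j; decide
    refine (H i j k hij hjk hik t).congr_deriv ?_
    have hsum : ∀ f : Fin 3 → ℂ, ∑ l, f l = f i + f j + f k := by
      intro f
      have : (Finset.univ : Finset (Fin 3)) = {i, j, k} := by
        revert hij hik hjk; revert i j k; decide
      rw [this, Finset.sum_insert (by simp [hij, hik]), Finset.sum_pair hjk]; ring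
    simp only [Matrix.smul_apply, Matrix.sub_apply, Matrix.mul_apply, inertia, Matrix.of_apply,
      hsum, momentum_diag, smul_eq_mul]
    push_cast
    ring

lemma isEulerSolution_of_hasMatDerivAt (hα : α.IsSymm)
    (h : ∀ t, HasMatDerivAt (fun t => momentum (a t) (b t) (c t))
      (-Complex.I • (momentum (a t) (b t) (c t) * inertia α (momentum (a t) (b t) (c t)) -
        inertia α (momentum (a t) (b t) (c t)) * momentum (a t) (b t) (c t))) t) :
    IsEulerSolution α a b c := by
  refine (isEulerSolution_iff hα).mpr fun i j k hij hjk hik t => ?_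
  refine (h t i j).congr_deriv ?_
  have hsum : ∀ f : Fin 3 → ℂ, ∑ l, f l = f i + f j + f k := by
    intro f
    have : (Finset.univ : Finset (Fin 3)) = {i, j, k} := by
      clear h f
      revert hij hik hjk; revert i j k; decide
    rw [this, Finset.sum_insert (by simp [hij, hik]), Finset.sum_pair hjk]; ring
  simp only [Matrix.smul_apply, Matrix.sub_apply, Matrix.mul_apply, inertia, Matrix.of_apply,
    hsum, momentum_diag, smul_eq_mul]
  push_cast
  ring

/-- Solutions of the Euler equations are smooth. -/
lemma IsEulerSolution.contDiff (h : IsEulerSolution α a b c) :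
    ContDiff ℝ ∞ a ∧ ContDiff ℝ ∞ b ∧ ContDiff ℝ ∞ c := by
  have key : ∀ n : ℕ, ContDiff ℝ n a ∧ ContDiff ℝ n b ∧ ContDiff ℝ n c := by
    intro n
    induction n with
    | zero =>
      simp only [Nat.cast_zero, contDiff_zero]
      exact ⟨h.differentiable_a.continuous, h.differentiable_b.continuous,
        h.differentiable_c.continuous⟩
    | succ n ih =>
      obtain ⟨ha, hb, hc⟩ := ih
      have hconj : ∀ {f : ℝ → ℂ}, ContDiff ℝ n f → ContDiff ℝ n fun t => conj (f t) :=
        fun hf => Complex.conjCLE.contDiff.comp hf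
      simp only [Nat.cast_add, Nat.cast_one, contDiff_succ_iff_deriv]
      refine ⟨⟨h.differentiable_a, by simp, ?_⟩, ⟨h.differentiable_b, by simp, ?_⟩,
        ⟨h.differentiable_c, by simp, ?_⟩⟩
      · rw [funext fun t => (h.hasDerivAt_a t).deriv]
        exact contDiff_const.mul (hb.mul (hconj hc))
      · rw [funext fun t => (h.hasDerivAt_b t).deriv]
        exact contDiff_const.mul (ha.mul hc)
      · rw [funext fun t => (h.hasDerivAt_c t).deriv]
        exact contDiff_const.mul ((hconj ha).mul hb)
  exact ⟨contDiff_infty.mpr fun n => (key n).1, contDiff_infty.mpr fun n => (key n).2.1,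
    contDiff_infty.mpr fun n => (key n).2.2⟩

lemma IsEulerSolution.contDiff_momentum (h : IsEulerSolution α a b c) (i j : Fin 3) :
    ContDiff ℝ ∞ fun t => momentum (a t) (b t) (c t) i j := by
  obtain ⟨ha, hb, hc⟩ := h.contDiff
  have hconj : ∀ {f : ℝ → ℂ}, ContDiff ℝ ∞ f → ContDiff ℝ ∞ fun t => conj (f t) :=
    fun hf => Complex.conjCLE.contDiff.comp hf
  fin_cases i <;> fin_cases j <;> simp [momentum] <;>
    first | exact contDiff_const | assumption | (apply hconj; assumption)

/-- A frame moving by `E' = i ℑ(M) E` diagonalises `M` at all times if it does at time zero. -/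
lemma exists_isEigenframe (h : IsEulerSolution α a b c) (hα : α.IsSymm) :
    ∃ E, IsEigenframe (fun t => momentum (a t) (b t) (c t)) E := by
  set M : ℝ → Matrix (Fin 3) (Fin 3) ℂ := fun t => momentum (a t) (b t) (c t) with hM
  have hH : ∀ t, (M t).IsHermitian := fun t => momentum_isHermitian _ _ _
  have hW : ∀ t, (inertia α (M t)).IsHermitian := fun t => inertia_isHermitian hα (hH t)
  have hcW : ∀ i j, ContDiff ℝ ∞ fun t => inertia α (M t) i j := fun i j =>
    contDiff_const.mul (h.contDiff_momentum i j)
  obtain ⟨Y₀, hY₀, Λ, hΛ⟩ : ∃ Y₀ ∈ Matrix.unitaryGroup (Fin 3) ℂ, ∃ Λ : Fin 3 → ℂ,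
      M 0 = Y₀ * Matrix.diagonal Λ * Y₀.conjTranspose :=
    ⟨_, (hH 0).eigenvectorUnitary.2, _, (hH 0).spectral_theorem⟩
  obtain ⟨E, hE0, hu, hE⟩ := exists_frame hW (fun i j => (hcW i j).of_le (by exact_mod_cast le_top))
    hY₀
  refine ⟨E, fun i j => ?_, hu, Λ, fun t => ?_⟩
  · rw [show (1 : WithTop ℕ∞) = 0 + 1 by rfl, contDiff_succ_iff_deriv]
    refine ⟨fun t => (hE t i j).differentiableAt, by simp, ?_⟩
    rw [funext fun t => (hE t i j).deriv, contDiff_zero]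
    have hEc : ∀ i j, Continuous fun t => E t i j := fun i j =>
      continuous_iff_continuousAt.mpr fun t => (hE t i j).continuousAt
    simp only [Matrix.smul_apply, Matrix.mul_apply, smul_eq_mul]
    exact continuous_const.mul
      (continuous_finsetSum _ fun k _ => (hcW i k).continuous.mul (hEc k j))
  · have key : ∀ t, HasMatDerivAt (fun t => (E t).conjTranspose * (M t * E t)) 0 t := fun t => by
      refine ((hE t).conjTranspose.mul ((h.hasMatDerivAt hα t).mul (hE t))).congr_deriv ?_
      rw [Matrix.conjTranspose_smul, Matrix.conjTranspose_mul, (hW t).eq]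
      simp only [Complex.star_def, Complex.conj_I, Matrix.smul_mul, Matrix.mul_smul,
        Matrix.mul_add, Matrix.sub_mul, Matrix.mul_sub, Matrix.mul_assoc]
      module
    have h1 := eq_of_hasMatDerivAt_zero key t
    have hs : Y₀.conjTranspose * Y₀ = 1 := Matrix.mem_unitaryGroup_iff'.mp hY₀
    have h3 : (E 0).conjTranspose * (M 0 * E 0) = Matrix.diagonal Λ := by
      rw [hE0, hΛ, mul_assoc _ Y₀.conjTranspose, hs, mul_one, ← mul_assoc, hs, one_mul]
    have h4 : E t * (E t).conjTranspose = 1 := Matrix.mem_unitaryGroup_iff.mp (hu t)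
    rw [← h3, ← h1, ← mul_assoc (E t), h4, one_mul, mul_assoc, h4, mul_one]

lemma injective_of_nodup_roots {Λ : Fin 3 → ℂ} (h : (Matrix.diagonal Λ).charpoly.roots.Nodup) :
    Function.Injective Λ := by
  rw [Matrix.charpoly_diagonal, Polynomial.roots_prod _ _ (Finset.prod_ne_zero_iff.mpr fun i _ =>
    Polynomial.X_sub_C_ne_zero _)] at h
  simp only [Polynomial.roots_X_sub_C, Multiset.bind_singleton] at h
  intro i j hij
  exact Multiset.inj_on_of_nodup_map h i (Finset.mem_univ_val i) j (Finset.mem_univ_val j) hij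

lemma IsEigenframe.hasMatDerivAt (hE : IsEigenframe M E) (t : ℝ) :
    HasMatDerivAt E (matDeriv E t) t :=
  hasMatDerivAt_of_differentiable (fun i j => (hE.contDiff i j).differentiable one_ne_zero) t

/-- `U† U'` is skew-Hermitian for a curve of unitary matrices. -/
lemma conjTranspose_mul_deriv {U : ℝ → Matrix (Fin 3) (Fin 3) ℂ} {U' : Matrix (Fin 3) (Fin 3) ℂ}
    {t : ℝ} (hu : ∀ t, U t ∈ Matrix.unitaryGroup (Fin 3) ℂ) (h : HasMatDerivAt U U' t) :
    U'.conjTranspose * U t = -((U t).conjTranspose * U') := by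
  have h1 := (h.conjTranspose.mul h).matDeriv_eq
  have e : (fun t => (U t).conjTranspose * U t) = fun _ => 1 := by
    ext1 t; exact Matrix.mem_unitaryGroup_iff'.mp (hu t)
  rw [e, (HasMatDerivAt.const 1).matDeriv_eq] at h1
  exact eq_neg_of_add_eq_zero_left h1.symm

/-- For an eigenframe of a solution `Q` commutes with the diagonal matrix of the eigenvalues, which
are distinct. -/
lemma IsEigenframe.isDiag_connection (hE : IsEigenframe M E) (hs : HasSimpleSpectrum (M 0))
    (hM : ∀ t, HasMatDerivAt M (-Complex.I • (M t * inertia α (M t) - inertia α (M t) * M t)) t)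
    (t : ℝ) : (connection α M E t).IsDiag := by
  obtain ⟨Λ, hΛ⟩ := hE.eq
  have hu' : ∀ t, (E t).conjTranspose * E t = 1 := fun t =>
    Matrix.mem_unitaryGroup_iff'.mp (hE.unitary t)
  have hinj : Function.Injective Λ := by
    refine injective_of_nodup_roots ?_
    have : (M 0).charpoly = (Matrix.diagonal Λ).charpoly := by
      rw [hΛ 0, mul_assoc, Matrix.charpoly_mul_comm, mul_assoc, hu', mul_one]
    rw [← this]; exact hs
  have hd := hE.hasMatDerivAt t
  have h1 := conjTranspose_mul_deriv hE.unitary hd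
  have h2 := ((hd.mul (HasMatDerivAt.const (Matrix.diagonal Λ))).mul hd.conjTranspose).matDeriv_eq
  rw [← funext hΛ, (hM t).matDeriv_eq] at h2
  set E' := matDeriv E t
  set W := inertia α (M t) with hWdef
  set S := (E t).conjTranspose * E' with hS
  set K := (E t).conjTranspose * W * E t with hK
  set D := Matrix.diagonal Λ with hD
  have h3 := congrArg (fun X => (E t).conjTranspose * X * E t) h2
  -- the derivative of `E Λ E†`, conjugated by the frame
  have h4 : -Complex.I • (D * K - K * D) = S * D - D * S := by
    have e1 : (E t).conjTranspose * (-Complex.I • (M t * W - W * M t)) * E t =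
        -Complex.I • (((E t).conjTranspose * E t) * D * K -
          K * D * ((E t).conjTranspose * E t)) := by
      rw [hΛ t, hK]
      simp only [Matrix.mul_smul, Matrix.smul_mul, Matrix.mul_sub, Matrix.sub_mul, Matrix.mul_assoc]
    have e2 : (E t).conjTranspose * ((E' * D + E t * 0) * (E t).conjTranspose +
        E t * D * E'.conjTranspose) * E t =
        S * D * ((E t).conjTranspose * E t) +
          ((E t).conjTranspose * E t) * D * (E'.conjTranspose * E t) := by
      rw [hS]
      simp only [mul_zero, add_zero, Matrix.mul_add, Matrix.add_mul, Matrix.mul_assoc]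
    have h5 := (e1.symm.trans h3).trans e2
    rw [hu', h1, one_mul, mul_one, mul_one, mul_neg, ← sub_eq_add_neg] at h5
    exact h5
  have hQ : connection α M E t * D = D * connection α M E t := by
    have : connection α M E t = -Complex.I • S - K := rfl
    rw [this, Matrix.sub_mul, Matrix.mul_sub, Matrix.smul_mul, Matrix.mul_smul]
    have h6 : -Complex.I • (S * D - D * S) = -(D * K - K * D) := by
      rw [← h4, smul_smul]; simp
    rw [smul_sub, sub_eq_iff_eq_add] at h6
    rw [h6]; abel
  intro i j hij
  have h7 := congrFun (congrFun hQ i) j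
  rw [hD, Matrix.mul_diagonal, Matrix.diagonal_mul] at h7
  have h8 : connection α M E t i j * (Λ j - Λ i) = 0 := by linear_combination h7
  exact (mul_eq_zero.mp h8).resolve_right (sub_ne_zero.mpr fun h => hij (hinj h).symm)

lemma transport_zero (hE : IsEigenframe M E) : transport α M E 0 = 1 := by
  have : E 0 * (E 0).conjTranspose = 1 := Matrix.mem_unitaryGroup_iff.mp (hE.unitary 0)
  simp [transport, this]

lemma IsEigenframe.continuous_connection (hE : IsEigenframe M E)
    (hM : ∀ i j, Continuous fun t => M t i j) (i j : Fin 3) :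
    Continuous fun t => connection α M E t i j := by
  have h1 : ∀ i j, Continuous fun t => E t i j := fun i j => (hE.contDiff i j).continuous
  have h2 : ∀ i j, Continuous fun t => conj (E t i j) := fun i j =>
    Complex.continuous_conj.comp (h1 i j)
  have h3 : ∀ i j, Continuous fun t => deriv (fun s => E s i j) t := fun i j =>
    (hE.contDiff i j).continuous_deriv le_rfl
  simp only [connection, Matrix.sub_apply, Matrix.smul_apply, Matrix.mul_apply, inertia, matDeriv,
    Matrix.of_apply, Matrix.conjTranspose_apply, smul_eq_mul]
  refine (continuous_const.mul (continuous_finsetSum _ fun k _ => (h2 k i).mul (h3 k j))).sub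
    (continuous_finsetSum _ fun k _ => (continuous_finsetSum _ fun l _ =>
      (h2 l i).mul (continuous_const.mul (hM l k))).mul (h1 k j))

/-- `V' = -i V ℑ(M)`, because `Q` is the diagonal correction between the eigenframe and a frame
that moves by `i ℑ(M)`. -/
lemma IsEigenframe.hasMatDerivAt_transport (hE : IsEigenframe M E)
    (hM : ∀ i j, Continuous fun t => M t i j) (hQ : ∀ t, (connection α M E t).IsDiag) (t : ℝ) :
    HasMatDerivAt (transport α M E) (-Complex.I • (transport α M E t * inertia α (M t))) t := by
  have hd := hE.hasMatDerivAt t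
  have hc : ∀ k, HasDerivAt (fun t => ∫ s in (0 : ℝ)..t, connection α M E s k k)
      (connection α M E t k k) t := fun k => by
    have hk := hE.continuous_connection (α := α) hM k k
    exact (intervalIntegral.integral_hasStrictDerivAt_right (hk.intervalIntegrable _ _)
      hk.stronglyMeasurable.stronglyMeasurableAtFilter hk.continuousAt).hasDerivAt
  have h1 := HasMatDerivAt.diagonal fun k => ((hc k).const_mul Complex.I).cexp
  refine ((h1.const_mul (E 0)).mul hd.conjTranspose).congr_deriv ?_
  set D := Matrix.diagonal fun k =>
    Complex.exp (Complex.I * ∫ s in (0 : ℝ)..t, connection α M E s k k) with hD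
  have h2 : (Matrix.diagonal fun k => Complex.exp (Complex.I * ∫ s in (0 : ℝ)..t,
      connection α M E s k k) * (Complex.I * connection α M E t k k)) =
      D * (Complex.I • connection α M E t) := by
    rw [← (hQ t).diagonal_diag, ← Matrix.diagonal_smul, hD, Matrix.diagonal_mul_diagonal]
    simp
  have h3 := conjTranspose_mul_deriv hE.unitary hd
  have h4 : E t * (E t).conjTranspose = 1 := Matrix.mem_unitaryGroup_iff.mp (hE.unitary t)
  have h5 : (matDeriv E t).conjTranspose = -((E t).conjTranspose * matDeriv E t *
      (E t).conjTranspose) := by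
    rw [← neg_mul, ← h3, mul_assoc, h4, mul_one]
  have h6 : Complex.I • connection α M E t = (E t).conjTranspose * matDeriv E t -
      Complex.I • ((E t).conjTranspose * inertia α (M t) * E t) := by
    rw [connection, smul_sub, smul_smul]; simp
  have h7 : transport α M E t = E 0 * D * (E t).conjTranspose := rfl
  have h8 : (E t).conjTranspose * inertia α (M t) * E t * (E t).conjTranspose =
      (E t).conjTranspose * inertia α (M t) := by rw [mul_assoc _ (E t), h4, mul_one]
  rw [h2, h5, h6, h7]
  simp only [Matrix.mul_sub, Matrix.sub_mul, Matrix.mul_neg, Matrix.mul_smul, Matrix.smul_mul,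
    ← Matrix.mul_assoc] at h8 ⊢
  have h9 : E 0 * D * (E t).conjTranspose * inertia α (M t) * E t * (E t).conjTranspose =
      E 0 * D * (E t).conjTranspose * inertia α (M t) := by
    rw [mul_assoc _ (E t), h4, mul_one]
  rw [h9]
  module

/-- Solutions of `V' = -i V W` with Hermitian `W` stay unitary. -/
lemma mem_unitaryGroup_of_hasMatDerivAt {V W : ℝ → Matrix (Fin 3) (Fin 3) ℂ}
    (hW : ∀ t, (W t).IsHermitian) (hV : ∀ t, HasMatDerivAt V (-Complex.I • (V t * W t)) t)
    (h0 : V 0 ∈ Matrix.unitaryGroup (Fin 3) ℂ) (t : ℝ) : V t ∈ Matrix.unitaryGroup (Fin 3) ℂ := by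
  rw [Matrix.mem_unitaryGroup_iff] at h0 ⊢
  rw [← h0]
  refine eq_of_hasMatDerivAt_zero (G := fun t => V t * star (V t)) (fun t => ?_) t
  refine ((hV t).mul (hV t).conjTranspose).congr_deriv ?_
  rw [Matrix.conjTranspose_smul, Matrix.conjTranspose_mul, (hW t).eq]
  simp [Matrix.mul_assoc]

/-- Two solutions of `V' = -i V W` agree if they agree at time zero and one of them is unitary. -/
lemma eq_of_hasMatDerivAt {V V₁ W : ℝ → Matrix (Fin 3) (Fin 3) ℂ}
    (hW : ∀ t, (W t).IsHermitian) (hV : ∀ t, HasMatDerivAt V (-Complex.I • (V t * W t)) t)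
    (hV₁ : ∀ t, HasMatDerivAt V₁ (-Complex.I • (V₁ t * W t)) t)
    (h0 : V₁ 0 = V 0) (hu : V 0 ∈ Matrix.unitaryGroup (Fin 3) ℂ) (t : ℝ) : V₁ t = V t := by
  have h1 : V₁ t * (V t).conjTranspose = V₁ 0 * (V 0).conjTranspose := by
    refine eq_of_hasMatDerivAt_zero (G := fun t => V₁ t * (V t).conjTranspose) (fun t => ?_) t
    refine ((hV₁ t).mul (hV t).conjTranspose).congr_deriv ?_
    rw [Matrix.conjTranspose_smul, Matrix.conjTranspose_mul, (hW t).eq]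
    simp [Matrix.mul_assoc]
  have h2 : V 0 * (V 0).conjTranspose = 1 := Matrix.mem_unitaryGroup_iff.mp hu
  have h3 : (V t).conjTranspose * V t = 1 :=
    Matrix.mem_unitaryGroup_iff'.mp (mem_unitaryGroup_of_hasMatDerivAt hW hV hu t)
  calc V₁ t = V₁ t * ((V t).conjTranspose * V t) := by rw [h3, mul_one]
    _ = V t := by rw [← mul_assoc, h1, h0, h2, one_mul]

/-- Solutions of `V' = -i V W` with smooth `W` are smooth. -/
lemma contDiff_of_hasMatDerivAt {V W : ℝ → Matrix (Fin 3) (Fin 3) ℂ}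
    (hW : ∀ i j, ContDiff ℝ ∞ fun t => W t i j)
    (hV : ∀ t, HasMatDerivAt V (-Complex.I • (V t * W t)) t) (i j : Fin 3) :
    ContDiff ℝ ∞ fun t => V t i j := by
  have key : ∀ n : ℕ, ∀ i j, ContDiff ℝ n fun t => V t i j := by
    intro n
    induction n with
    | zero =>
      intro i j
      simp only [Nat.cast_zero, contDiff_zero]
      exact continuous_iff_continuousAt.mpr fun t => (hV t i j).continuousAt
    | succ n ih =>
      intro i j
      simp only [Nat.cast_add, Nat.cast_one, contDiff_succ_iff_deriv]
      refine ⟨fun t => (hV t i j).differentiableAt, by simp, ?_⟩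
      rw [funext fun t => (hV t i j).deriv]
      simp only [Matrix.smul_apply, Matrix.mul_apply, smul_eq_mul]
      exact contDiff_const.mul (ContDiff.sum fun k _ => (ih i k).mul
        ((hW k j).of_le (by exact_mod_cast le_top)))
  exact contDiff_infty.mpr fun n => key n i j

end FlagThree

/-! ### The first variation of the energy -/

namespace FlagThree

section partials

variable {F : Type*} [NormedAddCommGroup F] [NormedSpace ℝ F] {f : ℝ × ℝ → F}

/-- The partial derivative with respect to the first variable. -/
noncomputable def derivFst (f : ℝ × ℝ → F) (x : ℝ × ℝ) : F := fderiv ℝ f x (1, 0)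

/-- The partial derivative with respect to the second variable. -/
noncomputable def derivSnd (f : ℝ × ℝ → F) (x : ℝ × ℝ) : F := fderiv ℝ f x (0, 1)

lemma hasDerivAt_derivFst (hf : ContDiff ℝ ∞ f) (s t : ℝ) :
    HasDerivAt (fun s => f (s, t)) (derivFst f (s, t)) s := by
  have h1 := (hf.differentiable (by simp) (s, t)).hasFDerivAt
  exact h1.comp_hasDerivAt_of_eq s ((hasDerivAt_id s).prodMk (hasDerivAt_const s t)) rfl

lemma hasDerivAt_derivSnd (hf : ContDiff ℝ ∞ f) (s t : ℝ) :
    HasDerivAt (fun t => f (s, t)) (derivSnd f (s, t)) t := by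
  have h1 := (hf.differentiable (by simp) (s, t)).hasFDerivAt
  exact h1.comp_hasDerivAt_of_eq t ((hasDerivAt_const t s).prodMk (hasDerivAt_id t)) rfl

lemma contDiff_derivFst (hf : ContDiff ℝ ∞ f) : ContDiff ℝ ∞ (derivFst f) :=
  (hf.fderiv_right (by simp)).clm_apply contDiff_const

lemma contDiff_derivSnd (hf : ContDiff ℝ ∞ f) : ContDiff ℝ ∞ (derivSnd f) :=
  (hf.fderiv_right (by simp)).clm_apply contDiff_const

lemma derivFst_derivSnd (hf : ContDiff ℝ ∞ f) : derivFst (derivSnd f) = derivSnd (derivFst f) := by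
  ext1 x
  have h1 : ContDiff ℝ ∞ (fderiv ℝ f) := hf.fderiv_right (by simp)
  have h2 := (h1.differentiable (by simp) x).hasFDerivAt
  have h3 := fun v : ℝ × ℝ => (h2.clm_apply (hasFDerivAt_const v x)).fderiv
  have h4 := second_derivative_symmetric
    (fun y => (hf.differentiable (by simp) y).hasFDerivAt) h2 (1, 0) (0, 1)
  unfold derivFst derivSnd
  rw [h3, h3]
  simpa using h4

/-- Differentiation under the integral sign for a smooth integrand. -/
lemma hasDerivAt_integral_derivFst {f : ℝ × ℝ → ℝ} (hf : ContDiff ℝ ∞ f) (t₀ t₁ : ℝ) :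
    HasDerivAt (fun s => ∫ t in t₀..t₁, f (s, t)) (∫ t in t₀..t₁, derivFst f (0, t)) 0 := by
  have hc : ∀ {g : ℝ × ℝ → ℝ}, Continuous g → ∀ s, Continuous fun t => g (s, t) :=
    fun hg s => hg.comp (by fun_prop)
  have hd := (contDiff_derivFst hf).continuous
  obtain ⟨C, hC⟩ := ((isCompact_Icc (a := (-1 : ℝ)) (b := 1)).prod
    (isCompact_uIcc (a := t₀) (b := t₁))).exists_bound_of_continuousOn hd.continuousOn
  refine (intervalIntegral.hasDerivAt_integral_of_dominated_loc_of_deriv_le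
    (F := fun s t => f (s, t)) (F' := fun s t => derivFst f (s, t)) (bound := fun _ => C)
    (s := Set.Icc (-1) 1) (Icc_mem_nhds (by norm_num) (by norm_num))
    (.of_forall fun s => (hc hf.continuous s).aestronglyMeasurable)
    ((hc hf.continuous 0).intervalIntegrable _ _) (hc hd 0).aestronglyMeasurable
    (.of_forall fun t ht s hs => hC (s, t) ⟨hs, Set.uIoc_subset_uIcc ht⟩) (by simp)
    (.of_forall fun t _ s _ => hasDerivAt_derivFst hf s t)).2

end partials

variable {α : Matrix (Fin 3) (Fin 3) ℝ}

/-- The derivative of the squared speed in the direction `Z`, as a trace against the momentum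
`L` of the velocity `Ω`. -/
lemma sum_speed_eq_trace (hpos : ∀ i j, i ≠ j → 0 < α i j)
    {L Ω Z : Matrix (Fin 3) (Fin 3) ℂ} (hL : L.IsHermitian) (hd : ∀ i, L i i = 0)
    (hLΩ : ∀ i j, i ≠ j → (α i j : ℂ) * L i j = Complex.I * Ω i j) (hZ : Z.conjTranspose = -Z) :
    ∑ i, ∑ j ∈ Finset.Ioi i, (α i j)⁻¹ * (2 * (conj (Ω i j) * Z i j).re) =
      (Complex.I * (L * Z).trace).re := by
  have key : ∀ i j, i ≠ j → (α i j)⁻¹ * (2 * (conj (Ω i j) * Z i j).re) =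
      (Complex.I * (L j i * Z i j)).re + (Complex.I * (L i j * Z j i)).re := by
    intro i j hij
    have h1 : Ω i j = -Complex.I * (α i j * L i j) := by
      rw [hLΩ i j hij, ← mul_assoc]; simp
    have h2 : L j i = conj (L i j) := (hL.apply j i).symm
    have h3 : Z j i = -conj (Z i j) := by
      have := congrFun (congrFun hZ j) i
      rw [Matrix.conjTranspose_apply, Matrix.neg_apply] at this
      rw [← neg_eq_iff_eq_neg, ← this]; rfl
    have h4 := (hpos i j hij).ne'
    rw [h1, h2, h3]
    simp
    field_simp
    ring
  have i0 : Finset.Ioi (0 : Fin 3) = {1, 2} := rfl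
  have i1 : Finset.Ioi (1 : Fin 3) = {2} := rfl
  have i2 : Finset.Ioi (2 : Fin 3) = ∅ := rfl
  rw [Fin.sum_univ_three, i0, i1, i2, Finset.sum_pair (by decide), Finset.sum_singleton,
    Finset.sum_empty, key _ _ (by decide), key _ _ (by decide), key _ _ (by decide)]
  simp only [Matrix.trace, Matrix.diag_apply, Matrix.mul_apply, Fin.sum_univ_three, hd, mul_add,
    Complex.add_re, zero_mul, mul_zero, Complex.zero_re]
  ring

lemma eq_zero_of_const_variation {Φ : ℝ → ℝ → Matrix (Fin 3) (Fin 3) ℂ}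
    {U : ℝ → Matrix (Fin 3) (Fin 3) ℂ} {t : ℝ} (h : ∀ s, Φ s t = U t) :
    matDeriv (fun s => Φ s t) 0 = 0 := by
  rw [show (fun s => Φ s t) = fun _ => U t from funext h]
  exact (HasMatDerivAt.const (U t)).matDeriv_eq

/-- The first variation formula: for a variation with velocity `Ω = U† ∂ₜU`, momentum `L` and
variation field `X = U† ∂ₛU`, the derivative of the energy is the integral of
`Re (i tr (([L, Ω] - L') X))`. -/
lemma hasDerivAt_energy (hpos : ∀ i j, i ≠ j → 0 < α i j) {t₀ t₁ : ℝ}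
    {Φ : ℝ → ℝ → Matrix (Fin 3) (Fin 3) ℂ}
    (hΦ : ∀ i j, ContDiff ℝ ∞ fun x : ℝ × ℝ => Φ x.1 x.2 i j)
    (hu : ∀ s t, Φ s t ∈ Matrix.unitaryGroup (Fin 3) ℂ)
    (h₀ : ∀ s, Φ s t₀ = Φ 0 t₀) (h₁ : ∀ s, Φ s t₁ = Φ 0 t₁)
    {L L' Ω : ℝ → Matrix (Fin 3) (Fin 3) ℂ} (hL : ∀ t, HasMatDerivAt L (L' t) t)
    (hLc : ∀ i j, Continuous fun t => L' t i j)
    (hLH : ∀ t, (L t).IsHermitian) (hLd : ∀ t i, L t i i = 0)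
    (hΩ : ∀ t, Ω t = (Φ 0 t).conjTranspose * matDeriv (Φ 0) t)
    (hLΩ : ∀ t i j, i ≠ j → (α i j : ℂ) * L t i j = Complex.I * Ω t i j) :
    HasDerivAt (fun s => ∫ t in t₀..t₁, speedSq α (Φ s) t)
      (-∫ t in t₀..t₁, (Complex.I * ((L' t - (L t * Ω t - Ω t * L t)) *
        ((Φ 0 t).conjTranspose * matDeriv (fun s => Φ s t) 0)).trace).re) 0 := by
  let A : ℝ × ℝ → Matrix (Fin 3) (Fin 3) ℂ := fun x =>
    Matrix.of fun i j => derivFst (fun x : ℝ × ℝ => Φ x.1 x.2 i j) x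
  let B : ℝ × ℝ → Matrix (Fin 3) (Fin 3) ℂ := fun x =>
    Matrix.of fun i j => derivSnd (fun x : ℝ × ℝ => Φ x.1 x.2 i j) x
  let N : ℝ × ℝ → Matrix (Fin 3) (Fin 3) ℂ := fun x =>
    Matrix.of fun i j => derivFst (derivSnd fun x : ℝ × ℝ => Φ x.1 x.2 i j) x
  have hA : ∀ s t, HasMatDerivAt (fun s => Φ s t) (A (s, t)) s := fun s t i j =>
    hasDerivAt_derivFst (hΦ i j) s t
  have hB : ∀ s t, HasMatDerivAt (Φ s) (B (s, t)) t := fun s t i j =>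
    hasDerivAt_derivSnd (hΦ i j) s t
  have hN : ∀ s t, HasMatDerivAt (fun s => B (s, t)) (N (s, t)) s := fun s t i j =>
    hasDerivAt_derivFst (contDiff_derivSnd (hΦ i j)) s t
  have hN' : ∀ s t, HasMatDerivAt (fun t => A (s, t)) (N (s, t)) t := fun s t i j => by
    have := hasDerivAt_derivSnd (contDiff_derivFst (hΦ i j)) s t
    rw [← derivFst_derivSnd (hΦ i j)] at this
    exact this
  have hBm : ∀ s t, matDeriv (Φ s) t = B (s, t) := fun s t => (hB s t).matDeriv_eq
  have hAm : ∀ t, matDeriv (fun s => Φ s t) 0 = A (0, t) := fun t => (hA 0 t).matDeriv_eq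
  have hconj : ∀ {f : ℝ × ℝ → ℂ}, ContDiff ℝ ∞ f → ContDiff ℝ ∞ fun t => conj (f t) :=
    fun hf => Complex.conjCLE.contDiff.comp hf
  -- the squared speed as a smooth function of both variables
  let G : ℝ × ℝ → ℝ := fun x => ∑ i, ∑ j ∈ Finset.Ioi i,
    (α i j)⁻¹ * ‖((Φ x.1 x.2).conjTranspose * B x) i j‖ ^ 2
  have hG : ContDiff ℝ ∞ G := by
    refine ContDiff.sum fun i _ => ContDiff.sum fun j _ => contDiff_const.mul
      (ContDiff.norm_sq ℝ ?_)
    simp only [Matrix.mul_apply, Matrix.conjTranspose_apply]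
    exact ContDiff.sum fun k _ => (hconj (hΦ k i)).mul (contDiff_derivSnd (hΦ k j))
  have hGe : (fun s => ∫ t in t₀..t₁, speedSq α (Φ s) t) = fun s => ∫ t in t₀..t₁, G (s, t) := by
    ext s
    simp only [speedSq, hBm, G]
  let X : ℝ → Matrix (Fin 3) (Fin 3) ℂ := fun t => (Φ 0 t).conjTranspose * A (0, t)
  let X' : ℝ → Matrix (Fin 3) (Fin 3) ℂ := fun t =>
    (B (0, t)).conjTranspose * A (0, t) + (Φ 0 t).conjTranspose * N (0, t)
  have hX : ∀ t, HasMatDerivAt X (X' t) t := fun t => (hB 0 t).conjTranspose.mul (hN' 0 t)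
  have hΩB : ∀ t, Ω t = (Φ 0 t).conjTranspose * B (0, t) := fun t => by rw [hΩ, hBm]
  have huu : ∀ t, Φ 0 t * (Φ 0 t).conjTranspose = 1 := fun t =>
    Matrix.mem_unitaryGroup_iff.mp (hu 0 t)
  have sA : ∀ t, (A (0, t)).conjTranspose * Φ 0 t = -X t := fun t =>
    conjTranspose_mul_deriv (U := fun s => Φ s t) (fun s => hu s t) (hA 0 t)
  have sB : ∀ t, (B (0, t)).conjTranspose * Φ 0 t = -Ω t := fun t => by
    rw [hΩB]; exact conjTranspose_mul_deriv (fun t => hu 0 t) (hB 0 t)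
  -- the derivative of the velocity is `X' + [Ω, X]`
  let Z : ℝ → Matrix (Fin 3) (Fin 3) ℂ := fun t => X' t + Ω t * X t - X t * Ω t
  have hZ : ∀ t, (A (0, t)).conjTranspose * B (0, t) + (Φ 0 t).conjTranspose * N (0, t) = Z t := by
    intro t
    have e1 : (A (0, t)).conjTranspose * B (0, t) = -(X t * Ω t) := by
      rw [hΩB, ← neg_mul, ← sA, mul_assoc, ← mul_assoc (Φ 0 t), huu, one_mul]
    have e2 : (B (0, t)).conjTranspose * A (0, t) = -(Ω t * X t) := by
      rw [← neg_mul, ← sB, mul_assoc, ← mul_assoc (Φ 0 t), huu, one_mul]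
    simp only [Z, X', e1, e2]
    abel
  have hXs : ∀ t, (X t).conjTranspose = -X t := fun t => by
    rw [← sA]; simp [X]
  have hΩs : ∀ t, (Ω t).conjTranspose = -Ω t := fun t => by
    rw [← sB, hΩB]; simp
  have hX's : ∀ t, (X' t).conjTranspose = -X' t := fun t => by
    have h1 := (hX t).conjTranspose.add (hX t)
    have h2 : (fun t => (X t).conjTranspose + X t) = fun _ => 0 := by
      ext1 s; rw [hXs, neg_add_cancel]
    rw [h2] at h1
    exact eq_neg_of_add_eq_zero_left
      (h1.matDeriv_eq.symm.trans (HasMatDerivAt.const 0).matDeriv_eq)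
  have hZs : ∀ t, (Z t).conjTranspose = -Z t := fun t => by
    simp only [Z, Matrix.conjTranspose_sub, Matrix.conjTranspose_add, Matrix.conjTranspose_mul,
      hXs, hX's, hΩs]
    simp only [neg_mul_neg]
    abel
  have hGd : ∀ t, derivFst G (0, t) = (Complex.I * (L t * Z t).trace).re := by
    intro t
    rw [← sum_speed_eq_trace hpos (hLH t) (hLd t) (hLΩ t) (hZs t)]
    refine (hasDerivAt_derivFst hG 0 t).unique ?_
    refine HasDerivAt.fun_sum fun i _ => HasDerivAt.fun_sum fun j _ => HasDerivAt.const_mul _ ?_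
    have h1 := hasDerivAt_norm_sq (((hA 0 t).conjTranspose.mul (hN 0 t)) i j)
    rw [hΩB, ← hZ]
    exact h1
  have hD : ∀ t, HasDerivAt (fun t => (Complex.I * (L t * X t).trace).re)
      (Complex.I * (L' t * X t + L t * X' t).trace).re t := fun t =>
    hasDerivAt_re ((((hL t).mul (hX t)).trace).const_mul Complex.I)
  -- integration by parts; the boundary terms vanish for fixed end points
  have hsplit : ∀ t, derivFst G (0, t) = (Complex.I * (L' t * X t + L t * X' t).trace).re -
      (Complex.I * ((L' t - (L t * Ω t - Ω t * L t)) * X t).trace).re := by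
    intro t
    rw [hGd, ← Complex.sub_re, ← mul_sub, ← Matrix.trace_sub]
    have e : (L t * (X t * Ω t)).trace = (Ω t * L t * X t).trace := by
      rw [← mul_assoc, Matrix.trace_mul_comm, ← mul_assoc]
    simp only [Z, mul_add, mul_sub, sub_mul, Matrix.trace_add, Matrix.trace_sub, e, mul_assoc]
    congr 1
    ring
  have cL : ∀ i j, Continuous fun t => L t i j := fun i j =>
    continuous_iff_continuousAt.mpr fun t => (hL t i j).continuousAt
  have cp : Continuous fun t : ℝ => ((0 : ℝ), t) := by fun_prop
  have cA : ∀ i j, Continuous fun t => A (0, t) i j := fun i j =>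
    (contDiff_derivFst (hΦ i j)).continuous.comp cp
  have cB : ∀ i j, Continuous fun t => B (0, t) i j := fun i j =>
    (contDiff_derivSnd (hΦ i j)).continuous.comp cp
  have cN : ∀ i j, Continuous fun t => N (0, t) i j := fun i j =>
    (contDiff_derivFst (contDiff_derivSnd (hΦ i j))).continuous.comp cp
  have cΦ : ∀ i j, Continuous fun t => conj (Φ 0 t j i) := fun i j =>
    Complex.continuous_conj.comp ((hΦ j i).continuous.comp cp)
  have cX : ∀ i j, Continuous fun t => X t i j := fun i j =>
    continuous_iff_continuousAt.mpr fun t => (hX t i j).continuousAt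
  have cX' : ∀ i j, Continuous fun t => X' t i j := fun i j => by
    simp only [X', Matrix.add_apply, Matrix.mul_apply, Matrix.conjTranspose_apply]
    exact (continuous_finsetSum _ fun k _ => (Complex.continuous_conj.comp (cB k i)).mul
      (cA k j)).add (continuous_finsetSum _ fun k _ => (cΦ i k).mul (cN k j))
  have c1 : Continuous fun t => (Complex.I * (L' t * X t + L t * X' t).trace).re := by
    refine Complex.continuous_re.comp (continuous_const.mul (continuous_finsetSum _ fun k _ => ?_))
    simp only [Matrix.diag_apply, Matrix.add_apply, Matrix.mul_apply]
    exact (continuous_finsetSum _ fun l _ => (hLc k l).mul (cX l k)).add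
      (continuous_finsetSum _ fun l _ => (cL k l).mul (cX' l k))
  have c2 : Continuous fun t =>
      (Complex.I * ((L' t - (L t * Ω t - Ω t * L t)) * X t).trace).re := by
    have h1 : (fun t => (Complex.I * ((L' t - (L t * Ω t - Ω t * L t)) * X t).trace).re) =
        fun t => (Complex.I * (L' t * X t + L t * X' t).trace).re - derivFst G (0, t) := by
      ext t; rw [hsplit]; ring
    rw [h1]
    exact c1.sub ((contDiff_derivFst hG).continuous.comp cp)
  have hmain := hasDerivAt_integral_derivFst hG t₀ t₁
  rw [hGe]
  refine hmain.congr_deriv ?_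
  simp only [hsplit, hAm]
  rw [intervalIntegral.integral_sub (c1.intervalIntegrable _ _) (c2.intervalIntegrable _ _),
    intervalIntegral.integral_eq_sub_of_hasDerivAt (fun t _ => hD t) (c1.intervalIntegrable _ _)]
  have e0 : X t₀ = 0 := by
    simp only [X, ← hAm, eq_zero_of_const_variation (U := Φ 0) h₀, mul_zero]
  have e1 : X t₁ = 0 := by
    simp only [X, ← hAm, eq_zero_of_const_variation (U := Φ 0) h₁, mul_zero]
  rw [e0, e1]
  simp [X]

end FlagThree

/-! ### Geodesics -/

namespace FlagThree

variable {α : Matrix (Fin 3) (Fin 3) ℝ}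

/-- A curve with `i U' = U ℑ(M)` is a geodesic if `M` solves the Euler equations: `M` is the
momentum of its velocity, and the first variation vanishes. -/
lemma isGeodesic_of_hasMatDerivAt (hpos : ∀ i j, i ≠ j → 0 < α i j)
    {U M : ℝ → Matrix (Fin 3) (Fin 3) ℂ} (hU : ∀ i j, ContDiff ℝ ∞ fun t => U t i j)
    (hu : ∀ t, U t ∈ Matrix.unitaryGroup (Fin 3) ℂ)
    (hU' : ∀ t, HasMatDerivAt U (-Complex.I • (U t * inertia α (M t))) t)
    (hMc : ∀ i j, Continuous fun t => M t i j)
    (hM : ∀ t, HasMatDerivAt M (-Complex.I • (M t * inertia α (M t) - inertia α (M t) * M t)) t)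
    (hMH : ∀ t, (M t).IsHermitian) (hMd : ∀ t i, M t i i = 0) : IsGeodesic α U := by
  refine ⟨hU, hu, fun t₀ t₁ _ Φ hΦ hΦu hΦ0 hΦe => ?_⟩
  have h0 : Φ 0 = U := funext hΦ0
  have e0 : ∀ s, Φ s t₀ = Φ 0 t₀ := fun s => by
    rw [hΦe s t₀ (by simp), hΦe 0 t₀ (by simp)]
  have e1 : ∀ s, Φ s t₁ = Φ 0 t₁ := fun s => by
    rw [hΦe s t₁ (by simp), hΦe 0 t₁ (by simp)]
  refine (hasDerivAt_energy (Ω := fun t => -Complex.I • inertia α (M t)) hpos hΦ hΦu e0 e1 hM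
    (fun i j => ?_) hMH hMd (fun t => ?_) (fun t i j _ => ?_)).congr_deriv ?_
  · simp only [Matrix.smul_apply, Matrix.sub_apply, Matrix.mul_apply, inertia, Matrix.of_apply,
      smul_eq_mul]
    exact continuous_const.mul ((continuous_finsetSum _ fun k _ => (hMc i k).mul
      (continuous_const.mul (hMc k j))).sub (continuous_finsetSum _ fun k _ =>
        (continuous_const.mul (hMc i k)).mul (hMc k j)))
  · have h1 : (U t).conjTranspose * U t = 1 := Matrix.mem_unitaryGroup_iff'.mp (hu t)
    rw [h0, (hU' t).matDeriv_eq, Matrix.mul_smul, ← mul_assoc, h1, one_mul]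
  · simp only [Matrix.smul_apply, inertia, Matrix.of_apply, smul_eq_mul]
    rw [← mul_assoc, mul_neg, Complex.I_mul_I, neg_neg, one_mul]
  · have : ∀ t, -Complex.I • (M t * inertia α (M t) - inertia α (M t) * M t) -
        (M t * (-Complex.I • inertia α (M t)) - (-Complex.I • inertia α (M t)) * M t) = 0 := by
      intro t
      rw [Matrix.mul_smul, Matrix.smul_mul]; module
    simp only [this, zero_mul, Matrix.trace_zero, mul_zero, Complex.zero_re,
      intervalIntegral.integral_zero, neg_zero]

/-! ### The equations of a geodesic -/

/-- The momentum of the velocity `Ω`: `Lᵢⱼ = i Ωᵢⱼ / αᵢⱼ` off the diagonal. -/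
noncomputable def velocityMomentum (α : Matrix (Fin 3) (Fin 3) ℝ) (Ω : Matrix (Fin 3) (Fin 3) ℂ) :
    Matrix (Fin 3) (Fin 3) ℂ :=
  Matrix.of fun i j => if i = j then 0 else Complex.I * Ω i j / α i j

lemma velocityMomentum_diag (Ω : Matrix (Fin 3) (Fin 3) ℂ) (i : Fin 3) :
    velocityMomentum α Ω i i = 0 := by
  simp [velocityMomentum]

lemma mul_velocityMomentum (hpos : ∀ i j, i ≠ j → 0 < α i j) (Ω : Matrix (Fin 3) (Fin 3) ℂ)
    {i j : Fin 3} (hij : i ≠ j) :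
    (α i j : ℂ) * velocityMomentum α Ω i j = Complex.I * Ω i j := by
  have : (α i j : ℂ) ≠ 0 := by exact_mod_cast (hpos i j hij).ne'
  simp only [velocityMomentum, Matrix.of_apply, if_neg hij]
  field_simp

lemma velocityMomentum_isHermitian (hα : α.IsSymm) {Ω : Matrix (Fin 3) (Fin 3) ℂ}
    (hΩ : Ω.conjTranspose = -Ω) : (velocityMomentum α Ω).IsHermitian := by
  ext i j
  by_cases hij : i = j
  · subst hij; simp [velocityMomentum]
  · have h1 : conj (Ω j i) = -Ω i j := congrFun (congrFun hΩ i) j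
    simp only [Matrix.conjTranspose_apply, velocityMomentum, Matrix.of_apply, if_neg hij,
      if_neg (Ne.symm hij)]
    rw [Complex.star_def, map_div₀, map_mul, h1, Complex.conj_I, Complex.conj_ofReal, hα.apply i j]
    ring

/-- An infinitesimal rotation in the plane of two coordinates, with the entries `w` and `-w̄`. -/
def planeRotation (j k : Fin 3) (w : ℂ) : Matrix (Fin 3) (Fin 3) ℂ :=
  Matrix.single j k w - Matrix.single k j (conj w)

lemma planeRotation_conjTranspose (j k : Fin 3) (w : ℂ) :
    (planeRotation j k w).conjTranspose = -planeRotation j k w := by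
  simp [planeRotation, Matrix.conjTranspose_sub, Matrix.conjTranspose_single]

lemma planeRotation_cube {j k : Fin 3} (hjk : j ≠ k) {w : ℂ} (hw : w * conj w = 1) :
    planeRotation j k w * planeRotation j k w * planeRotation j k w = -planeRotation j k w := by
  have hw' : conj w * w = 1 := by rw [mul_comm, hw]
  simp [planeRotation, Matrix.sub_mul, Matrix.mul_sub, hjk, hjk.symm, hw, hw']
  abel

/-- The rotation `exp(θ X)` for `X³ = -X`, by the formula of Rodrigues. -/
noncomputable def rodrigues (X : Matrix (Fin 3) (Fin 3) ℂ) (θ : ℝ) : Matrix (Fin 3) (Fin 3) ℂ :=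
  1 + (Real.sin θ : ℂ) • X + ((1 - Real.cos θ : ℝ) : ℂ) • (X * X)

lemma rodrigues_zero (X : Matrix (Fin 3) (Fin 3) ℂ) : rodrigues X 0 = 1 := by
  simp [rodrigues]

lemma rodrigues_mem_unitaryGroup {X : Matrix (Fin 3) (Fin 3) ℂ} (hX : X.conjTranspose = -X)
    (hX3 : X * X * X = -X) (θ : ℝ) : rodrigues X θ ∈ Matrix.unitaryGroup (Fin 3) ℂ := by
  rw [Matrix.mem_unitaryGroup_iff', Matrix.star_eq_conjTranspose]
  have h1 : (rodrigues X θ).conjTranspose =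
      1 - (Real.sin θ : ℂ) • X + ((1 - Real.cos θ : ℝ) : ℂ) • (X * X) := by
    simp only [rodrigues, Matrix.conjTranspose_add, Matrix.conjTranspose_smul,
      Matrix.conjTranspose_one, Matrix.conjTranspose_mul, hX, Complex.star_def,
      Complex.conj_ofReal, smul_neg, neg_mul_neg, ← sub_eq_add_neg]
  have h2 : X * (X * X) = -X := by rw [← mul_assoc, hX3]
  have h3 : X * X * (X * X) = -(X * X) := by rw [← mul_assoc, hX3, neg_mul]
  have h4 : (1 - (Real.sin θ : ℂ) • X + ((1 - Real.cos θ : ℝ) : ℂ) • (X * X)) *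
      (1 + (Real.sin θ : ℂ) • X + ((1 - Real.cos θ : ℝ) : ℂ) • (X * X)) =
      1 + ((2 * (1 - Real.cos θ) - Real.sin θ ^ 2 - (1 - Real.cos θ) ^ 2 : ℝ) : ℂ) • (X * X) := by
    simp only [mul_add, add_mul, sub_mul, mul_one, one_mul, Matrix.smul_mul, Matrix.mul_smul, hX3,
      h2, h3]
    push_cast
    module
  rw [h1, rodrigues, h4, show 2 * (1 - Real.cos θ) - Real.sin θ ^ 2 - (1 - Real.cos θ) ^ 2 = 0 by
    linear_combination -Real.sin_sq_add_cos_sq θ]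
  simp

/-- A critical point of the energy satisfies the Euler equation off the diagonal, tested against a
rotation in a coordinate plane with a smooth angle of compact support. -/
lemma IsGeodesic.re_trace_eq_zero (hα : α.IsSymm) (hpos : ∀ i j, i ≠ j → 0 < α i j)
    {U : ℝ → Matrix (Fin 3) (Fin 3) ℂ} (h : IsGeodesic α U)
    {Ω L L' : ℝ → Matrix (Fin 3) (Fin 3) ℂ} (hΩ : ∀ t, Ω t = (U t).conjTranspose * matDeriv U t)
    (hΩs : ∀ t, (Ω t).conjTranspose = -Ω t) (hΩc : ∀ i j, Continuous fun t => Ω t i j)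
    (hL : ∀ t, L t = velocityMomentum α (Ω t))
    (hL' : ∀ t, HasMatDerivAt L (L' t) t) (hLc : ∀ i j, Continuous fun t => L' t i j)
    {X : Matrix (Fin 3) (Fin 3) ℂ} (hX : X.conjTranspose = -X) (hX3 : X * X * X = -X) (t : ℝ) :
    (Complex.I * ((L' t - (L t * Ω t - Ω t * L t)) * X).trace).re = 0 := by
  set g : ℝ → ℝ := fun t => (Complex.I * ((L' t - (L t * Ω t - Ω t * L t)) * X).trace).re with hg
  have cL : ∀ i j, Continuous fun t => L t i j := fun i j =>
    continuous_iff_continuousAt.mpr fun t => (hL' t i j).continuousAt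
  have hgc : Continuous g := by
    refine Complex.continuous_re.comp (continuous_const.mul (continuous_finsetSum _ fun k _ => ?_))
    simp only [Matrix.diag_apply, Matrix.sub_apply, Matrix.mul_apply]
    exact continuous_finsetSum _ fun l _ => ((hLc k l).sub
      ((continuous_finsetSum _ fun m _ => (cL k m).mul (hΩc m l)).sub
        (continuous_finsetSum _ fun m _ => (hΩc k m).mul (cL m l)))).mul continuous_const
  -- the fundamental lemma of the calculus of variations
  suffices hae : ∀ᵐ t, g t = 0 from
    congrFun ((hgc.ae_eq_iff_eq MeasureTheory.volume continuous_const).mp hae) t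
  refine ae_eq_zero_of_integral_contDiff_smul_eq_zero hgc.locallyIntegrable fun f hf hfc => ?_
  obtain ⟨r, hr⟩ := hfc.isCompact.isBounded.subset_ball 0
  rw [Real.ball_eq_Ioo, zero_sub, zero_add] at hr
  set R := max r 1 with hR
  have hR0 : 0 < R := lt_of_lt_of_le one_pos (le_max_right _ _)
  have hsupp : tsupport f ⊆ Set.Ioo (-R) R := hr.trans
    (Set.Ioo_subset_Ioo (neg_le_neg (le_max_left _ _)) (le_max_left _ _))
  have hf0 : ∀ t, t ∉ Set.Ioo (-R) R → f t = 0 := fun t ht =>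
    image_eq_zero_of_notMem_tsupport fun h => ht (hsupp h)
  -- the variation by rotations with angle `s f(t)`
  let Φ : ℝ → ℝ → Matrix (Fin 3) (Fin 3) ℂ := fun s t => U t * rodrigues X (s * f t)
  have hΦ : ∀ i j, ContDiff ℝ ∞ fun x : ℝ × ℝ => Φ x.1 x.2 i j := by
    intro i j
    simp only [Φ, Matrix.mul_apply, rodrigues, Matrix.add_apply, Matrix.smul_apply, smul_eq_mul]
    have hθ : ContDiff ℝ ∞ fun x : ℝ × ℝ => x.1 * f x.2 :=
      contDiff_fst.mul (hf.comp contDiff_snd)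
    refine ContDiff.sum fun k _ => ((h.smooth i k).comp contDiff_snd).mul ?_
    refine (contDiff_const.add ?_).add ?_
    · exact (Complex.ofRealCLM.contDiff.comp (Real.contDiff_sin.comp hθ)).mul contDiff_const
    · exact (Complex.ofRealCLM.contDiff.comp
        (contDiff_const.sub (Real.contDiff_cos.comp hθ))).mul contDiff_const
  have hΦu : ∀ s t, Φ s t ∈ Matrix.unitaryGroup (Fin 3) ℂ := fun s t =>
    mul_mem (h.unitary t) (rodrigues_mem_unitaryGroup hX hX3 _)
  have hΦ0 : ∀ t, Φ 0 t = U t := fun t => by simp [Φ, rodrigues_zero]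
  have hΦe : ∀ s t, t ∉ Set.Ioo (-R) R → Φ s t = U t := fun s t ht => by
    simp [Φ, hf0 t ht, rodrigues_zero]
  have h0 : Φ 0 = U := funext hΦ0
  have hcrit := h.critical (-R) R (by linarith) Φ hΦ hΦu hΦ0 hΦe
  have hfirst := hasDerivAt_energy (Ω := Ω) (L := L) (L' := L') hpos (t₀ := -R) (t₁ := R) hΦ hΦu
    (fun s => by rw [hΦe s _ (by simp), hΦ0]) (fun s => by rw [hΦe s _ (by simp), hΦ0]) hL' hLc
    (fun t => by rw [hL]; exact velocityMomentum_isHermitian hα (hΩs t))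
    (fun t i => by rw [hL]; exact velocityMomentum_diag _ i)
    (fun t => by rw [h0, hΩ]) (fun t i j hij => by rw [hL]; exact mul_velocityMomentum hpos _ hij)
  have hz := hfirst.unique hcrit
  rw [neg_eq_zero] at hz
  have hXd : ∀ t, (Φ 0 t).conjTranspose * matDeriv (fun s => Φ s t) 0 = (f t : ℂ) • X := by
    intro t
    have hs : HasMatDerivAt (fun s => rodrigues X (s * f t)) ((f t : ℂ) • X) 0 := by
      intro i j
      have h1 : HasDerivAt (fun s : ℝ => s * f t) (f t) 0 := by
        simpa using (hasDerivAt_id (0 : ℝ)).mul_const (f t)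
      have h2 := (h1.sin.ofReal_comp.mul_const (X i j)).const_add ((1 : Matrix _ _ ℂ) i j)
      have h3 := ((h1.cos.const_sub 1).ofReal_comp.mul_const ((X * X) i j))
      refine (h2.add h3).congr_deriv ?_
      simp
    have h1 : (U t).conjTranspose * U t = 1 := Matrix.mem_unitaryGroup_iff'.mp (h.unitary t)
    rw [(hs.const_mul (U t)).matDeriv_eq, hΦ0, ← mul_assoc, h1, one_mul]
  have hint : ∀ t, (Complex.I * ((L' t - (L t * Ω t - Ω t * L t)) *
      ((Φ 0 t).conjTranspose * matDeriv (fun s => Φ s t) 0)).trace).re = f t • g t := fun t => by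
    rw [hXd, Matrix.mul_smul, Matrix.trace_smul, hg, smul_eq_mul, smul_eq_mul,
      ← Complex.re_ofReal_mul]
    congr 1; ring
  simp only [hint] at hz
  rw [← hz]
  refine (intervalIntegral.integral_eq_integral_of_support_subset fun t ht => ?_).symm
  have : f t ≠ 0 := fun h0 => ht (by simp [h0])
  have hmem : t ∈ Set.Ioo (-R) R := by
    by_contra hcon
    exact this (hf0 t hcon)
  exact Set.Ioo_subset_Ioc_self hmem

lemma trace_mul_planeRotation (Y : Matrix (Fin 3) (Fin 3) ℂ) (j k : Fin 3) (w : ℂ) :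
    (Y * planeRotation j k w).trace = Y k j * w - Y j k * conj w := by
  rw [planeRotation, Matrix.mul_sub, Matrix.trace_sub, Matrix.trace_mul_single,
    Matrix.trace_mul_single]
  rfl

/-- A geodesic satisfies the Euler equation `L' = [L, Ω]`, with the momentum `L` of its velocity
`Ω = U† U'`. -/
lemma IsGeodesic.hasMatDerivAt_velocityMomentum (hα : α.IsSymm)
    (hpos : ∀ i j, i ≠ j → 0 < α i j) {U : ℝ → Matrix (Fin 3) (Fin 3) ℂ} (h : IsGeodesic α U)
    {Ω : ℝ → Matrix (Fin 3) (Fin 3) ℂ} (hΩ : ∀ t, Ω t = (U t).conjTranspose * matDeriv U t)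
    (hΩs : ∀ t, (Ω t).conjTranspose = -Ω t) (hΩd : ∀ i j, ContDiff ℝ 1 fun t => Ω t i j) (t : ℝ) :
    HasMatDerivAt (fun t => velocityMomentum α (Ω t))
      (velocityMomentum α (Ω t) * Ω t - Ω t * velocityMomentum α (Ω t)) t := by
  set L : ℝ → Matrix (Fin 3) (Fin 3) ℂ := fun t => velocityMomentum α (Ω t) with hL
  have hLd : ∀ i j, ContDiff ℝ 1 fun t => L t i j := by
    intro i j
    simp only [hL, velocityMomentum, Matrix.of_apply]
    split_ifs
    · exact contDiff_const
    · exact (contDiff_const.mul (hΩd i j)).div_const _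
  have hL' : ∀ t, HasMatDerivAt L (matDeriv L t) t := hasMatDerivAt_of_differentiable
    fun i j => (hLd i j).differentiable one_ne_zero
  have hLH : ∀ t, (L t).IsHermitian := fun t => velocityMomentum_isHermitian hα (hΩs t)
  have hL'H : (matDeriv L t).conjTranspose = matDeriv L t := by
    have h1 := (hL' t).conjTranspose.matDeriv_eq
    rw [show (fun t => (L t).conjTranspose) = L from funext fun t => (hLH t).eq] at h1
    exact h1.symm
  set Y := matDeriv L t - (L t * Ω t - Ω t * L t) with hY
  have hYH : Y.conjTranspose = Y := by
    rw [hY, Matrix.conjTranspose_sub, Matrix.conjTranspose_sub, Matrix.conjTranspose_mul,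
      Matrix.conjTranspose_mul, hΩs, (hLH t).eq, hL'H, neg_mul, mul_neg]
    abel
  have key : ∀ X : Matrix (Fin 3) (Fin 3) ℂ, X.conjTranspose = -X → X * X * X = -X →
      (Complex.I * (Y * X).trace).re = 0 := fun X hX hX3 =>
    h.re_trace_eq_zero hα hpos hΩ hΩs (fun i j => (hΩd i j).continuous) (fun t => rfl) hL'
      (fun i j => (hLd i j).continuous_deriv le_rfl) hX hX3 t
  refine (hL' t).congr_deriv (sub_eq_zero.mp ?_)
  rw [← hY]
  ext j k
  by_cases hjk : j = k
  · subst hjk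
    -- the diagonal of `[L, Ω]` vanishes, because `αⱼₖ` is symmetric
    have h1 : matDeriv L t j j = 0 := by
      have e : (fun s => L s j j) = fun _ => 0 := by
        ext s; exact velocityMomentum_diag _ j
      simp [matDeriv, e]
    rw [hY, Matrix.sub_apply, Matrix.sub_apply, h1, zero_sub, Matrix.mul_apply, Matrix.mul_apply,
      ← Finset.sum_sub_distrib, Matrix.zero_apply, neg_eq_zero]
    refine Finset.sum_eq_zero fun k _ => ?_
    by_cases hk : j = k
    · subst hk
      rw [show L t j j = 0 from velocityMomentum_diag _ j]; ring
    · have e1 := mul_velocityMomentum hpos (Ω t) hk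
      have e2 := mul_velocityMomentum hpos (Ω t) (Ne.symm hk)
      rw [hα.apply j k] at e2
      change (α j k : ℂ) * L t j k = _ at e1
      change (α j k : ℂ) * L t k j = _ at e2
      linear_combination -Complex.I * L t k j * e1 + Complex.I * L t j k * e2 +
        (L t j k * Ω t k j - Ω t j k * L t k j) * Complex.I_sq
  -- rotations with `w = 1` and `w = i` test the imaginary and the real part of the entry
  · have hkj : Y k j = conj (Y j k) := by
      have := congrFun (congrFun hYH k) j
      rw [← this]; rfl
    have k1 := key (planeRotation j k 1) (planeRotation_conjTranspose _ _ _)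
      (planeRotation_cube hjk (by simp))
    have k2 := key (planeRotation j k Complex.I) (planeRotation_conjTranspose _ _ _)
      (planeRotation_cube hjk (by simp))
    rw [trace_mul_planeRotation, hkj] at k1 k2
    simp at k1 k2
    exact Complex.ext (by simp; linarith) (by simp; linarith)

end FlagThree

/-! ### Uniqueness of the geodesic with given initial data -/

namespace FlagThree

variable {α : Matrix (Fin 3) (Fin 3) ℝ} {a b c : ℝ → ℂ}

/-- Two solutions of the Euler equations with the same initial values agree. -/
lemma IsEulerSolution.unique (h : IsEulerSolution α a b c) {a' b' c' : ℝ → ℂ}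
    (h' : IsEulerSolution α a' b' c') (ha : a 0 = a' 0) (hb : b 0 = b' 0) (hc : c 0 = c' 0) :
    a = a' ∧ b = b' ∧ c = c' := by
  let v : ℂ × ℂ × ℂ → ℂ × ℂ × ℂ := fun x =>
    (-Complex.I * ((α 1 2 - α 0 2 : ℝ) : ℂ) * (x.2.1 * conj x.2.2),
      -Complex.I * ((α 1 2 - α 0 1 : ℝ) : ℂ) * (x.1 * x.2.2),
      -Complex.I * ((α 0 2 - α 0 1 : ℝ) : ℂ) * (conj x.1 * x.2.1))
  have hconj : ∀ {f : ℂ × ℂ × ℂ → ℂ}, ContDiff ℝ 1 f → ContDiff ℝ 1 fun t => conj (f t) :=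
    fun hf => Complex.conjCLE.contDiff.comp hf
  have hv : ContDiff ℝ 1 v := by
    refine ContDiff.prodMk ?_ (ContDiff.prodMk ?_ ?_)
    · exact contDiff_const.mul ((contDiff_fst.comp contDiff_snd).mul
        (hconj (contDiff_snd.comp contDiff_snd)))
    · exact contDiff_const.mul (contDiff_fst.mul (contDiff_snd.comp contDiff_snd))
    · exact contDiff_const.mul ((hconj contDiff_fst).mul (contDiff_fst.comp contDiff_snd))
  have key := eq_of_hasDerivAt_of_contDiff hv (f := fun t => (a t, b t, c t))
    (g := fun t => (a' t, b' t, c' t))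
    (fun t => (h.hasDerivAt_a t).prodMk ((h.hasDerivAt_b t).prodMk (h.hasDerivAt_c t)))
    (fun t => (h'.hasDerivAt_a t).prodMk ((h'.hasDerivAt_b t).prodMk (h'.hasDerivAt_c t)))
    (by simp [ha, hb, hc])
  refine ⟨funext fun t => ?_, funext fun t => ?_, funext fun t => ?_⟩
  · exact congrArg (fun x => x.1) (congrFun key t)
  · exact congrArg (fun x => x.2.1) (congrFun key t)
  · exact congrArg (fun x => x.2.2) (congrFun key t)

lemma eq_momentum {M : Matrix (Fin 3) (Fin 3) ℂ} (hM : M.IsHermitian) (hd : ∀ i, M i i = 0) :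
    M = momentum (M 0 1) (M 0 2) (M 1 2) := by
  ext i j
  have h1 := hM.apply 1 0
  have h2 := hM.apply 2 0
  have h3 := hM.apply 2 1
  simp only [Complex.star_def] at h1 h2 h3
  fin_cases i <;> fin_cases j <;> simp [momentum, hd, h1, h2, h3]

/-- The scaling `ℑ` commutes with the conjugation by a diagonal matrix. -/
lemma inertia_diagonal (d e : Fin 3 → ℂ) (M : Matrix (Fin 3) (Fin 3) ℂ) :
    inertia α (Matrix.diagonal d * M * Matrix.diagonal e) =
      Matrix.diagonal d * inertia α M * Matrix.diagonal e := by
  ext i j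
  simp only [inertia, Matrix.of_apply, Matrix.mul_diagonal, Matrix.diagonal_mul]
  ring

/-- A gauge of diagonal unitary matrices that removes the diagonal `θ` of a velocity. -/
lemma exists_gauge {θ : ℝ → Fin 3 → ℂ} (hθ : ∀ k, Continuous fun t => θ t k)
    (hs : ∀ t k, conj (θ t k) = -θ t k) :
    ∃ d : ℝ → Fin 3 → ℂ, (∀ k, d 0 k = 1) ∧ (∀ t k, ‖d t k‖ = 1) ∧
      ∀ t k, HasDerivAt (fun t => d t k) (-(θ t k) * d t k) t := by
  have hd : ∀ t k, HasDerivAt (fun t => Complex.exp (-∫ s in (0 : ℝ)..t, θ s k))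
      (-(θ t k) * Complex.exp (-∫ s in (0 : ℝ)..t, θ s k)) t := fun t k => by
    have h1 := (intervalIntegral.integral_hasStrictDerivAt_right
      ((hθ k).intervalIntegrable 0 t) (hθ k).stronglyMeasurable.stronglyMeasurableAtFilter
      (hθ k).continuousAt).hasDerivAt
    exact h1.fun_neg.cexp.congr_deriv (by ring)
  refine ⟨fun t k => Complex.exp (-∫ s in (0 : ℝ)..t, θ s k), by simp, fun t k => ?_, hd⟩
  have h1 := eq_of_hasDerivAt_zero (f := fun t => ‖Complex.exp (-∫ s in (0 : ℝ)..t, θ s k)‖ ^ 2)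
    (fun t => (hasDerivAt_norm_sq (hd t k)).congr_deriv (by
      have h0 : (θ t k).re = 0 := by
        have := congrArg Complex.re (hs t k)
        simp at this
        linarith
      generalize Complex.exp (-∫ s in (0 : ℝ)..t, θ s k) = e
      simp [h0]
      ring)) t 0
  refine (pow_left_inj₀ (norm_nonneg _) zero_le_one two_ne_zero).mp (h1.trans ?_)
  simp

/-- A geodesic whose initial velocity has the momentum `M(0)` is, up to a diagonal gauge, the
solution of `i V' = V ℑ(M)`: without the diagonal part of the velocity its momentum solves the Euler
equations with the same initial values. -/
lemma IsGeodesic.eq_mul_diagonal (hα : α.IsSymm) (hpos : ∀ i j, i ≠ j → 0 < α i j)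
    (hE : IsEulerSolution α a b c) {U V : ℝ → Matrix (Fin 3) (Fin 3) ℂ}
    {U₀ : Matrix (Fin 3) (Fin 3) ℂ} (h : IsGeodesic α U)
    (h0 : HasInitialData α U U₀ (momentum (a 0) (b 0) (c 0)))
    (hV : ∀ t, HasMatDerivAt V (-Complex.I • (V t * inertia α (momentum (a t) (b t) (c t)))) t)
    (hV0 : V 0 = U₀) :
    ∃ d : ℝ → Fin 3 → ℂ, (∀ t k, ‖d t k‖ = 1) ∧ ∀ t, U t = V t * Matrix.diagonal (d t) := by
  set Ω : ℝ → Matrix (Fin 3) (Fin 3) ℂ := fun t => (U t).conjTranspose * matDeriv U t with hΩ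
  have hU : ∀ t, HasMatDerivAt U (matDeriv U t) t := hasMatDerivAt_of_differentiable
    fun i j => (h.smooth i j).differentiable (by simp)
  have hΩs : ∀ t, (Ω t).conjTranspose = -Ω t := fun t => by
    rw [← conjTranspose_mul_deriv h.unitary (hU t), hΩ, Matrix.conjTranspose_mul,
      Matrix.conjTranspose_conjTranspose]
  have hΩd : ∀ i j, ContDiff ℝ 1 fun t => Ω t i j := by
    intro i j
    simp only [hΩ, Matrix.mul_apply, Matrix.conjTranspose_apply, matDeriv, Matrix.of_apply]
    refine ContDiff.sum fun k _ => ContDiff.mul ?_ ?_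
    · exact Complex.conjCLE.contDiff.comp ((h.smooth k i).of_le (by exact_mod_cast le_top))
    · exact ((contDiff_infty_iff_deriv.mp (h.smooth k j)).2).of_le (by exact_mod_cast le_top)
  set L : ℝ → Matrix (Fin 3) (Fin 3) ℂ := fun t => velocityMomentum α (Ω t) with hL
  have hLe : ∀ t, HasMatDerivAt L (L t * Ω t - Ω t * L t) t :=
    h.hasMatDerivAt_velocityMomentum hα hpos (fun t => rfl) hΩs hΩd
  have hLH : ∀ t, (L t).IsHermitian := fun t => velocityMomentum_isHermitian hα (hΩs t)
  -- the velocity without its diagonal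
  have hΩo : ∀ t, Ω t - Matrix.diagonal (fun k => Ω t k k) = -Complex.I • inertia α (L t) := by
    intro t
    ext i j
    by_cases hij : i = j
    · subst hij
      simp [inertia, hL, velocityMomentum_diag]
    · have := mul_velocityMomentum hpos (Ω t) hij
      simp only [Matrix.sub_apply, Matrix.diagonal_apply_ne _ hij, Matrix.smul_apply, inertia,
        Matrix.of_apply, smul_eq_mul, sub_zero, hL, this]
      rw [← mul_assoc, neg_mul, Complex.I_mul_I, neg_neg, one_mul]
  obtain ⟨d, hd0, hd1, hdd⟩ := exists_gauge (θ := fun t k => Ω t k k)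
    (fun k => (hΩd k k).continuous) (fun t k => congrFun (congrFun (hΩs t) k) k)
  set D : ℝ → Matrix (Fin 3) (Fin 3) ℂ := fun t => Matrix.diagonal (d t) with hD
  have hDt : ∀ t, D t = Matrix.diagonal (d t) := fun _ => rfl
  have hDd : ∀ t, HasMatDerivAt D (-(Matrix.diagonal (fun k => Ω t k k) * D t)) t := fun t =>
    (HasMatDerivAt.diagonal fun k => hdd t k).congr_deriv (by
      rw [hDt, Matrix.diagonal_mul_diagonal]
      ext i j
      by_cases hij : i = j <;> simp [hij])
  have hdc : ∀ t k, d t k * conj (d t k) = 1 := fun t k => by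
    rw [Complex.mul_conj', hd1]; simp
  have hDc : ∀ t, (D t).conjTranspose = Matrix.diagonal (fun k => conj (d t k)) := fun t => by
    rw [hDt, Matrix.diagonal_conjTranspose]; rfl
  have hDD : ∀ t, D t * (D t).conjTranspose = 1 := fun t => by
    rw [hDc, hDt, Matrix.diagonal_mul_diagonal]
    simp [hdc]
  have hθs : ∀ t, (Matrix.diagonal fun k => Ω t k k).conjTranspose =
      -(Matrix.diagonal fun k => Ω t k k) := fun t => by
    rw [Matrix.diagonal_conjTranspose]
    ext i j
    by_cases hij : i = j
    · subst hij
      simpa using congrFun (congrFun (hΩs t) i) i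
    · simp [hij]
  -- the momentum in the new gauge
  set N : ℝ → Matrix (Fin 3) (Fin 3) ℂ := fun t => (D t).conjTranspose * L t * D t with hN
  have hNt : ∀ t, N t = (D t).conjTranspose * L t * D t := fun _ => rfl
  have hNi : ∀ t, inertia α (N t) = (D t).conjTranspose * inertia α (L t) * D t := fun t => by
    rw [hNt, hDc, hDt, inertia_diagonal]
  have hNe : ∀ t, HasMatDerivAt N
      (-Complex.I • (N t * inertia α (N t) - inertia α (N t) * N t)) t := by
    intro t
    refine (((hDd t).conjTranspose.mul (hLe t)).mul (hDd t)).congr_deriv ?_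
    have e1 : Ω t = -Complex.I • inertia α (L t) + Matrix.diagonal (fun k => Ω t k k) := by
      rw [← hΩo]; abel
    have e2 : ∀ A B : Matrix (Fin 3) (Fin 3) ℂ, (D t).conjTranspose * A * D t *
        ((D t).conjTranspose * B * D t) = (D t).conjTranspose * A * B * D t := fun A B => by
      calc (D t).conjTranspose * A * D t * ((D t).conjTranspose * B * D t)
          = (D t).conjTranspose * A * (D t * (D t).conjTranspose) * B * D t := by
            simp only [mul_assoc]
        _ = _ := by rw [hDD, mul_one]
    rw [hNi, hNt, e2, e2, Matrix.conjTranspose_neg, Matrix.conjTranspose_mul, hθs]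
    generalize Matrix.diagonal (fun k => Ω t k k) = w at e1 ⊢
    rw [e1]
    simp only [mul_add, add_mul, mul_sub, sub_mul, neg_mul, mul_neg, Matrix.smul_mul,
      Matrix.mul_smul, mul_assoc]
    module
  have hNH : ∀ t, (N t).IsHermitian := fun t => by
    rw [Matrix.IsHermitian, hNt, Matrix.conjTranspose_mul, Matrix.conjTranspose_mul,
      Matrix.conjTranspose_conjTranspose, (hLH t).eq, mul_assoc]
  have hNd : ∀ t i, N t i i = 0 := fun t i => by
    rw [hNt, hDc, hDt]
    simp [Matrix.mul_diagonal, Matrix.diagonal_mul, hL, velocityMomentum_diag]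
  have hNm : ∀ t, N t = momentum (N t 0 1) (N t 0 2) (N t 1 2) := fun t =>
    eq_momentum (hNH t) (hNd t)
  have hNE : IsEulerSolution α (fun t => N t 0 1) (fun t => N t 0 2) (fun t => N t 1 2) := by
    refine isEulerSolution_of_hasMatDerivAt hα fun t => ?_
    simp only [← hNm]
    exact hNe t
  have hD0 : D 0 = 1 := by
    rw [hDt, ← Matrix.diagonal_one, funext hd0]
  have hN0 : N 0 = momentum (a 0) (b 0) (c 0) := by
    simp only [hN, hD0, Matrix.conjTranspose_one, one_mul, mul_one]
    ext i j
    by_cases hij : i = j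
    · subst hij; rw [momentum_diag]; exact velocityMomentum_diag _ i
    · have h1 := mul_velocityMomentum hpos (Ω 0) hij
      have h2 : Ω 0 i j = -Complex.I * inertia α (momentum (a 0) (b 0) (c 0)) i j := h0.2 i j hij
      have h3 : (α i j : ℂ) ≠ 0 := by exact_mod_cast (hpos i j hij).ne'
      refine mul_left_cancel₀ h3 (h1.trans ?_)
      rw [h2, inertia, Matrix.of_apply, ← mul_assoc, mul_neg, Complex.I_mul_I, neg_neg, one_mul]
  obtain ⟨ea, eb, ec⟩ := momentum_inj ((hNm 0).symm.trans hN0)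
  obtain ⟨fa, fb, fc⟩ := hNE.unique hE ea eb ec
  have hNM : ∀ t, N t = momentum (a t) (b t) (c t) := fun t => by
    rw [hNm t, ← fa, ← fb, ← fc]
  -- both curves solve the same linear equation
  have hUD : ∀ t, HasMatDerivAt (fun t => U t * D t)
      (-Complex.I • (U t * D t * inertia α (momentum (a t) (b t) (c t)))) t := by
    intro t
    refine ((hU t).mul (hDd t)).congr_deriv ?_
    have e1 : matDeriv U t = U t * Ω t := by
      have : U t * (U t).conjTranspose = 1 := Matrix.mem_unitaryGroup_iff.mp (h.unitary t)
      rw [hΩ, ← mul_assoc, this, one_mul]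
    have e2 : matDeriv U t * D t + U t * -(Matrix.diagonal (fun k => Ω t k k) * D t) =
        U t * (Ω t - Matrix.diagonal (fun k => Ω t k k)) * D t := by
      rw [e1, mul_sub, sub_mul, mul_neg, ← sub_eq_add_neg, mul_assoc (U t) (Matrix.diagonal _)]
    rw [e2, hΩo, ← hNM, hNi, Matrix.mul_smul, Matrix.smul_mul]
    congr 1
    calc U t * inertia α (L t) * D t
        = U t * (D t * (D t).conjTranspose) * inertia α (L t) * D t := by rw [hDD, mul_one]
      _ = _ := by simp only [mul_assoc]
  have hfin := eq_of_hasMatDerivAt (fun t => inertia_isHermitian hα (momentum_isHermitian _ _ _))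
    hUD hV (by rw [hD0, mul_one, hV0, h0.1]) (by rw [hD0, mul_one]; exact h.unitary 0)
  refine ⟨fun t k => conj (d t k), fun t k => by rw [RCLike.norm_conj, hd1], fun t => ?_⟩
  rw [hfin t, ← hDc, mul_assoc, hDD, mul_one]

/-- The eigenframes, the transport matrix and the geodesics of a solution of the Euler equations. -/
theorem geodesics (hsymm : α.IsSymm) (hpos : ∀ i j, i ≠ j → 0 < α i j)
    (h : IsEulerSolution α a b c) (M : ℝ → Matrix (Fin 3) (Fin 3) ℂ)
    (hM : ∀ t, M t = momentum (a t) (b t) (c t)) (hs : HasSimpleSpectrum (M 0)) :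
      (∃ E, IsEigenframe M E) ∧
      ∀ E, IsEigenframe M E →
        (∀ t, (connection α M E t).IsDiag) ∧
        transport α M E 0 = 1 ∧
        (∀ t i j, HasDerivAt (fun s => transport α M E s i j)
          ((-Complex.I • (transport α M E t * inertia α (M t))) i j) t) ∧
        ∀ U₀ ∈ Matrix.unitaryGroup (Fin 3) ℂ,
          IsGeodesic α (fun t => U₀ * transport α M E t) ∧
          HasInitialData α (fun t => U₀ * transport α M E t) U₀ (M 0) ∧
          ∀ U : ℝ → Matrix (Fin 3) (Fin 3) ℂ, IsGeodesic α U → HasInitialData α U U₀ (M 0) →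
            ∃ d : ℝ → Fin 3 → ℂ, (∀ t k, ‖d t k‖ = 1) ∧
              ∀ t, U t = U₀ * transport α M E t * Matrix.diagonal (d t) := by
  obtain rfl : M = fun t => momentum (a t) (b t) (c t) := funext hM
  set M : ℝ → Matrix (Fin 3) (Fin 3) ℂ := fun t => momentum (a t) (b t) (c t) with hMdef
  have hMe := fun t => h.hasMatDerivAt hsymm t
  have hMc : ∀ i j, Continuous fun t => M t i j := fun i j => (h.contDiff_momentum i j).continuous
  have hMH : ∀ t, (M t).IsHermitian := fun t => momentum_isHermitian _ _ _
  have hW : ∀ t, (inertia α (M t)).IsHermitian := fun t => inertia_isHermitian hsymm (hMH t)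
  refine ⟨exists_isEigenframe h hsymm, fun E hE => ?_⟩
  have hQ := fun t => hE.isDiag_connection hs hMe t
  have hV := fun t => hE.hasMatDerivAt_transport hMc hQ t
  have hV0 := transport_zero (α := α) hE
  refine ⟨hQ, hV0, fun t i j => hV t i j, fun U₀ hU₀ => ?_⟩
  have hUV : ∀ t, HasMatDerivAt (fun t => U₀ * transport α M E t)
      (-Complex.I • (U₀ * transport α M E t * inertia α (M t))) t := fun t =>
    ((hV t).const_mul U₀).congr_deriv (by rw [Matrix.mul_smul, mul_assoc])
  have hu0 : U₀ * transport α M E 0 ∈ Matrix.unitaryGroup (Fin 3) ℂ := by rwa [hV0, mul_one]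
  have hu := mem_unitaryGroup_of_hasMatDerivAt hW hUV hu0
  have hWc : ∀ i j, ContDiff ℝ ∞ fun t => inertia α (M t) i j := fun i j =>
    contDiff_const.mul (h.contDiff_momentum i j)
  refine ⟨isGeodesic_of_hasMatDerivAt hpos (contDiff_of_hasMatDerivAt hWc hUV) hu hUV hMc hMe hMH
    (fun t i => momentum_diag _ _ _ i), ⟨by simp only [hV0, mul_one], fun i j _ => ?_⟩,
    fun U hU hUi => ?_⟩
  · have h1 : (U₀ * transport α M E 0).conjTranspose * (U₀ * transport α M E 0) = 1 :=
      Matrix.mem_unitaryGroup_iff'.mp (hu 0)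
    rw [(hUV 0).matDeriv_eq, Matrix.mul_smul, ← mul_assoc, h1, one_mul]
    rfl
  · exact hU.eq_mul_diagonal hsymm hpos h hUi hUV (by simp only [hV0, mul_one])

end FlagThree

theorem mainTheorem2 (α : Matrix (Fin 3) (Fin 3) ℝ) (hsymm : α.IsSymm)
    (hpos : ∀ i j, i ≠ j → 0 < α i j) :
    -- the solution of the Euler equations, for every relabelling `π` of the three sites such
    -- that the relabelled parameters `β` satisfy `β₁₂ > β₂₃ > β₁₃`
    (∀ (π : Equiv.Perm (Fin 3)) (β : Matrix (Fin 3) (Fin 3) ℝ), β = α.submatrix π π →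
      β 0 2 < β 1 2 → β 1 2 < β 0 1 →
      ∀ a₀ b₀ c₀ : ℂ, g₂ β a₀ b₀ c₀ ^ 3 - 27 * g₃ β a₀ b₀ c₀ ^ 2 ≠ 0 →
      ∃ e₁ e₂ e₃ : ℝ, e₃ < e₂ ∧ e₂ < e₁ ∧
        (∀ Y : ℝ, 4 * Y ^ 3 - g₂ β a₀ b₀ c₀ * Y - g₃ β a₀ b₀ c₀ =
          4 * (Y - e₁) * (Y - e₂) * (Y - e₃)) ∧
      ∃ L : PeriodPair,
        L.ω₁ / 2 = (∫ Y in Set.Ioi e₁,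
          1 / √(4 * Y ^ 3 - g₂ β a₀ b₀ c₀ * Y - g₃ β a₀ b₀ c₀) : ℝ) ∧
        L.ω₂ / 2 = Complex.I * (∫ Y in Set.Ioi (-e₃),
          1 / √(4 * Y ^ 3 - g₂ β a₀ b₀ c₀ * Y + g₃ β a₀ b₀ c₀) : ℝ) ∧
        L.g₂ = g₂ β a₀ b₀ c₀ ∧ L.g₃ = g₃ β a₀ b₀ c₀ ∧
        (∃ τ₀ : ℝ, IsInitialShift β a₀ b₀ c₀ L τ₀) ∧
        (∀ r : ℝ, ∃ μ : ℂ, IsWeierstrassRoot L μ r) ∧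
        ∀ τ₀ : ℝ, IsInitialShift β a₀ b₀ c₀ L τ₀ →
          (∀ a b c : ℝ → ℂ, IsEulerSolution α a b c →
            (momentum (a 0) (b 0) (c 0)).submatrix π π = momentum a₀ b₀ c₀ →
            ∀ t : ℝ, ((‖momentum (a t) (b t) (c t) (π 1) (π 2)‖ ^ 2 : ℝ) : ℂ) =
              L.weierstrassP ((timeScale β * t : ℝ) - τ₀ + L.ω₂ / 2) +
                ((I₂ β a₀ c₀ + I₃ β b₀ c₀) / 3 : ℝ)) ∧
          (h₄ a₀ b₀ c₀ ≠ 0 →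
            ∀ μ₁ μ₂ μ₃ : ℂ,
              IsWeierstrassRoot L μ₁ (2 * I₂ β a₀ c₀ / 3 - I₃ β b₀ c₀ / 3) →
              IsWeierstrassRoot L μ₂ (-(I₂ β a₀ c₀) / 3 + 2 * I₃ β b₀ c₀ / 3) →
              IsWeierstrassRoot L μ₃ (-(I₂ β a₀ c₀) / 3 - I₃ β b₀ c₀ / 3) →
              ∀ a b c : ℝ → ℂ,
                (IsEulerSolution α a b c ∧
                  (momentum (a 0) (b 0) (c 0)).submatrix π π = momentum a₀ b₀ c₀) ↔
                ∀ t : ℝ, (momentum (a t) (b t) (c t)).submatrix π π =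
                  momentum (solA β a₀ b₀ c₀ L τ₀ μ₁ (timeScale β * t))
                    (solB β a₀ b₀ c₀ L τ₀ μ₂ (timeScale β * t))
                    (solC β a₀ b₀ c₀ L τ₀ μ₃ (timeScale β * t)))) ∧
    -- the geodesics
    (∀ a b c : ℝ → ℂ, IsEulerSolution α a b c →
      ∀ M : ℝ → Matrix (Fin 3) (Fin 3) ℂ, (∀ t, M t = momentum (a t) (b t) (c t)) →
      HasSimpleSpectrum (M 0) →
      (∃ E, IsEigenframe M E) ∧
      ∀ E, IsEigenframe M E →
        (∀ t, (connection α M E t).IsDiag) ∧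
        transport α M E 0 = 1 ∧
        (∀ t i j, HasDerivAt (fun s => transport α M E s i j)
          ((-Complex.I • (transport α M E t * inertia α (M t))) i j) t) ∧
        ∀ U₀ ∈ Matrix.unitaryGroup (Fin 3) ℂ,
          IsGeodesic α (fun t => U₀ * transport α M E t) ∧
          HasInitialData α (fun t => U₀ * transport α M E t) U₀ (M 0) ∧
          ∀ U : ℝ → Matrix (Fin 3) (Fin 3) ℂ, IsGeodesic α U → HasInitialData α U U₀ (M 0) →
            ∃ d : ℝ → Fin 3 → ℂ, (∀ t k, ‖d t k‖ = 1) ∧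
              ∀ t, U t = U₀ * transport α M E t * Matrix.diagonal (d t)) :=
  ⟨fun π β hβ h1 h2 a₀ b₀ c₀ hd => euler_solution hsymm π β hβ h1 h2 a₀ b₀ c₀ hd,
    fun _ _ _ h M hM hs => geodesics hsymm hpos h M hM hs⟩
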